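/- **Setting.** A learner and an adversary play $T$ rounds. In round $t$ the learner chooses a distribution $\rho_t$ on $[0,1]$; the adversary, knowing $\rho_t$ and the transcript of the earlier rounds, reveals a convex $1$-Lipschitz loss $\ell_t:[0,1]\to\mathbb R$; then $p_t$ is drawn from $\rho_t$. The swap regret is $$\mathsf{SR}(p_{1:T};\ell_{1:T})=\sup_{\sigma:[0,1]\to[0,1]}\sum_{t=1}^T\bigl(\ell_t(p_t)-\ell_t(\sigma(p_t))\bigr).$$ For a loss $\ell$ let $\varphi_\ell$ be the unique distribution on $[0,1]$ with $\ell(p)=\mathbb E_{v\sim\varphi_\ell}|p-v|+\frac{\ell(0)+\ell(1)-1}{2}$ for all $p\in[0,1]$. **Constraints.** Let $T>2$ be an integer, $\delta\in(0,1/T]$ and $\gamma=\min\{1,\sqrt{(\ln T)(\ln(1/\delta))/T}\}$. Let $R=\{\gamma,2\gamma,4\gamma,\dots\}\cap[0,1]$, $B_r=\{0,r,2r,\dots\}\cap[0,1]$ and $\Theta=\{(r,b):r\in R,\ b\in B_r\}$. For $(r,b),(r',b')\in\Theta$ and $v\in[0,1]$ put $h_{r,b,+2}(r',b',v)=\mathbb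 I[(r',b')=(r,b)]\bigl(\mathbb I[v>b+2r]-(\frac12-\frac{\gamma}{4r})\bigr)$, $h_{r,b,-2}(r',b',v)=\mathbb I[(r',b')=(r,b)]\bigl(\mathbb I[v<b-2r]-(\frac12-\frac{\gamma}{4r})\bigr)$, $h_{r,b,+1}(r',b',v)=\mathbb I[(r',b')=(r,b)]\bigl((\frac12-\frac{\gamma}{2r})-\mathbb I[v\ge b]\bigr)$, $h_{r,b,-1}(r',b',v)=\mathbb I[(r',b')=(r,b)]\bigl((\frac12-\frac{\gamma}{2r})-\mathbb I[v\le b]\bigr)$. **Expert algorithm (MsMwC of Chen, Luo and Wei).** With learning rates $\eta\in\mathbb R_{>0}^n$ and initial point $y_1$ in the simplex $\Delta_n$, MsMwC plays $y_t$ and, on receiving the loss vector $c_t$, sets $y_{t+1}=\arg\min_{x\in\Delta_n}\sum_i x_i\bigl(c_{t,i}+32\eta_ic_{t,i}^2\bigr)+\sum_i\frac1{\eta_i}\bigl(x_i\ln\frac{x_i}{y_{t,i}}-x_i+y_{t,i}\bigr)$. For $k=1,\dots,\lceil\log_2T\rceil$ let $\eta_k=1/(32\cdot2^k)$; the $k$-th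 base algorithm is MsMwC with uniform initial point and all learning rates $2\eta_k$; the master is MsMwC over $k$ with learning rates $\eta_k$, initial point proportional to $\eta_k^2$, and as losses the losses of the base algorithms. The output is the average of the base weights under the master's weights. **Prediction algorithm.** In round $t$: (1) compute weights $w^{(t)}_{r,b,\xi}$ by the expert algorithm with loss vectors $-u^{(1)},\dots,-u^{(t-1)}$, and let $\bar h_t=\sum_{r,b,\xi}w^{(t)}_{r,b,\xi}h_{r,b,\xi}$; (2) compute a distribution $\kappa_t$ on $\Theta$ that solves the linear program $\mathbb E_{(r',b')\sim\kappa_t}\bar h_t(r',b',v)\le0$ for all $v\in[0,1]$; (3) draw $(r_t,b_t)\sim\kappa_t$ and predict $p_t=b_t$; (4) observe $\ell_t$ and set $u^{(t)}_{r,b,\xi}=\mathbb E_{(r',b')\sim\kappa_t}\mathbb E_{v\sim\varphi_{\ell_t}}h_{r,b,\xi}(r',b',v)$. For $\varepsilon\ge0$, an $\varepsilon$-accurate execution is one in which the weights $w^{(t)}$ (still a point of the simplex, and the ones used in $\bar h_t$) may differ in each round from those of the expert algorithm by at most $\varepsilon$ in $\ell_1$ norm; $\varepsilon=0$ is the algorithm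 in exact arithmetic. **Lemma.** (a) There is an absolute constant $C>0$ such that for every integer $T>2$, every $\delta\in(0,1/T]$, every $\varepsilon\in[0,1/T]$, every $\varepsilon$-accurate execution of the algorithm and every adaptive adversary, $$\mathsf{SR}(p_{1:T};\ell_{1:T})\le C\sqrt{(T\log T)\log(1/\delta)}\quad\text{with probability at least }1-\delta,$$ and, if $\delta=1/T$, also $\mathbb E[\mathsf{SR}(p_{1:T};\ell_{1:T})]\le C\sqrt T\log T$. (b) The algorithm in exact arithmetic is well defined: the linear programs are always feasible. (c) The algorithm runs in $\mathsf{poly}(T)$ time: there are one program on a real random access machine (unit-cost arithmetic, exponential, logarithm and comparison of reals, and queries to the value and the one-sided derivatives of the loss just revealed) and one polynomial $q$ such that for all $T>2$ and $\delta\in(0,1/T]$ the program, on input $(T,\delta)$ and any sequence of losses, outputs in every round the table of the probabilities of $\kappa_t$ of a $1/T$-accurate execution, within $q(T)$ steps over all rounds. -/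

import Mathlib

noncomputable section

namespace SwapRegret

/-! ### The prediction problem -/

/-- A convex `1`-Lipschitz loss function on `[0,1]`. -/
structure Loss where
  toFun : unitInterval → ℝ
  lipschitz : LipschitzWith 1 toFun
  convex : ConvexOn ℝ (Set.Icc 0 1) (Set.IccExtend (zero_le_one' ℝ) toFun)

/-- A transcript `(p_t, ℓ_t)`, most recent round first. -/
abbrev Transcript := List (unitInterval × Loss)

/-- The swap regret `sup_{σ : [0,1] → [0,1]} ∑_t (ℓ_t(p_t) - ℓ_t(σ(p_t)))` of a transcript. -/
def swapRegret (h : Transcript) : ℝ :=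
  ⨆ σ : unitInterval → unitInterval, (h.map fun x => x.2.toFun x.1 - x.2.toFun (σ x.1)).sum

/-- The law of the transcript after `n` rounds. In each round the learner chooses a distribution
from the past transcript, the adversary chooses a loss from the past transcript (the learner's
strategy being fixed, the transcript determines the learner's current distribution), and the
prediction is drawn from the learner's distribution. -/
def play (learner : Transcript → PMF unitInterval) (adversary : Transcript → Loss) : ℕ → PMF Transcript
  | 0 => PMF.pure []
  | n + 1 => (play learner adversary n).bind fun h =>
      (learner h).map fun p => (p, adversary h) :: h

/-! ### V-shaped decomposition -/

/-- `φ` is a distribution on `[0,1]` with `ℓ(p) = E_{v ∼ φ} |p - v| + (ℓ(0) + ℓ(1) - 1) / 2`. -/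
def IsVShape (ℓ : Loss) (φ : MeasureTheory.ProbabilityMeasure unitInterval) : Prop :=
  ∀ p : unitInterval, ℓ.toFun p =
    (∫ v : unitInterval, |(p : ℝ) - (v : ℝ)| ∂(φ : MeasureTheory.Measure unitInterval))
      + (ℓ.toFun 0 + ℓ.toFun 1 - 1) / 2

/-- The distribution corresponding to `ℓ` (it exists and is unique). -/
def vDist (ℓ : Loss) : MeasureTheory.ProbabilityMeasure unitInterval :=
  @Classical.epsilon _ ⟨⟨MeasureTheory.Measure.dirac 0, inferInstance⟩⟩ (IsVShape ℓ)

/-! ### Scales, bins and constraints -/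

/-- `γ = √((ln T)(ln(1/δ))/T)`, capped at `1`. -/
def gammaParam (T : ℕ) (δ : ℝ) : ℝ :=
  min 1 (Real.sqrt (Real.log T * Real.log (1 / δ) / T))

/-- The scales `{γ, 2γ, 4γ, …} ∩ [0,1]`. -/
def scales (γ : ℝ) : Finset ℝ :=
  ((Finset.range (⌊1 / γ⌋₊ + 1)).image fun i : ℕ => 2 ^ i * γ).filter fun r => r ≤ 1

/-- The bins `{0, r, 2r, …} ∩ [0,1]`. -/
def bins (r : ℝ) : Finset ℝ :=
  ((Finset.range (⌊1 / r⌋₊ + 1)).image fun k : ℕ => (k : ℝ) * r).filter fun b => b ≤ 1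

/-- The set `Θ` of pairs `(r, b)` of a scale and a bin at that scale. -/
def Theta (γ : ℝ) : Finset (ℝ × ℝ) :=
  (scales γ).biUnion fun r => (bins r).image fun b => (r, b)

theorem mem_scales {γ r : ℝ} (hγ : 0 < γ) :
    r ∈ scales γ ↔ (∃ i : ℕ, r = 2 ^ i * γ) ∧ r ≤ 1 := by
  simp only [scales, Finset.mem_filter, Finset.mem_image, Finset.mem_range]
  constructor
  · rintro ⟨⟨i, -, rfl⟩, h⟩
    exact ⟨⟨i, rfl⟩, h⟩
  · rintro ⟨⟨i, rfl⟩, h⟩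
    refine ⟨⟨i, ?_, rfl⟩, h⟩
    have h1 : ((2 ^ i : ℕ) : ℝ) ≤ 1 / γ := by
      rw [le_div_iff₀ hγ]; push_cast; exact h
    have h2 := Nat.le_floor h1
    have h3 : i < 2 ^ i := Nat.lt_two_pow_self
    omega

theorem mem_bins {r b : ℝ} (hr : 0 < r) :
    b ∈ bins r ↔ (∃ k : ℕ, b = k * r) ∧ b ≤ 1 := by
  simp only [bins, Finset.mem_filter, Finset.mem_image, Finset.mem_range]
  constructor
  · rintro ⟨⟨i, -, rfl⟩, h⟩
    exact ⟨⟨i, rfl⟩, h⟩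
  · rintro ⟨⟨i, rfl⟩, h⟩
    refine ⟨⟨i, ?_, rfl⟩, h⟩
    have h1 : (i : ℝ) ≤ 1 / r := by
      rw [le_div_iff₀ hr]; exact h
    have h2 := Nat.le_floor h1
    omega

theorem mem_Theta {γ r b : ℝ} : (r, b) ∈ Theta γ ↔ r ∈ scales γ ∧ b ∈ bins r := by
  simp only [Theta, Finset.mem_biUnion, Finset.mem_image, Prod.mk.injEq]
  constructor
  · rintro ⟨r', hr', b', hb', rfl, rfl⟩
    exact ⟨hr', hb'⟩
  · rintro ⟨h1, h2⟩
    exact ⟨r, h1, b, h2, rfl, rfl⟩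

/-- The labels `ξ = +2, -2, +1, -1` of the four constraints of a pair. -/
inductive Xi where
  | pos2 | neg2 | pos1 | neg1
  deriving DecidableEq

instance : Fintype Xi where
  elems := {Xi.pos2, Xi.neg2, Xi.pos1, Xi.neg1}
  complete := by intro x; cases x <;> decide

/-- The experts `(r, b, ξ)`. -/
abbrev Expert (γ : ℝ) := ↥(Theta γ) × Xi

open Classical in
/-- The constraint function `h_{r,b,ξ}(r', b', v)` with `e = (r, b, ξ)` and `θ' = (r', b')`. -/
def constraint (γ : ℝ) (e : Expert γ) (θ' : Theta γ) (v : unitInterval) : ℝ :=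
  let r := e.1.1.1
  let b := e.1.1.2
  if θ' = e.1 then
    match e.2 with
    | Xi.pos2 => (if b + 2 * r < (v : ℝ) then 1 else 0) - (1 / 2 - γ / (4 * r))
    | Xi.neg2 => (if (v : ℝ) < b - 2 * r then 1 else 0) - (1 / 2 - γ / (4 * r))
    | Xi.pos1 => (1 / 2 - γ / (2 * r)) - (if b ≤ (v : ℝ) then 1 else 0)
    | Xi.neg1 => (1 / 2 - γ / (2 * r)) - (if (v : ℝ) ≤ b then 1 else 0)
  else 0

/-- The mixture `∑ w_{r,b,ξ} h_{r,b,ξ}`. -/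
def mixture (γ : ℝ) (w : Expert γ → ℝ) (θ' : Theta γ) (v : unitInterval) : ℝ :=
  ∑ e : Expert γ, w e * constraint γ e θ' v

/-- The reward `E_{(r',b') ∼ κ} E_{v ∼ φ} h_{r,b,ξ}(r',b',v)`, where `φ` corresponds to `ℓ`. -/
def reward (γ : ℝ) (κ : PMF (Theta γ)) (ℓ : Loss) (e : Expert γ) : ℝ :=
  ∑ θ' : Theta γ, (κ θ').toReal *
    ∫ v : unitInterval, constraint γ e θ' v ∂(vDist ℓ : MeasureTheory.Measure unitInterval)

/-! ### The expert algorithm MsMwC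

Histories are lists of loss vectors, most recent first. -/

section MsMwC

variable {ι : Type} [Fintype ι]

/-- Bregman divergence of the weighted negative entropy `∑ i, (1 / η i) x_i ln x_i`. -/
def bregman (η x y : ι → ℝ) : ℝ :=
  ∑ i, (1 / η i) * (x i * Real.log (x i / y i) - x i + y i)

/-- The minimizer over the simplex of `⟨x, g⟩ + D(x, y)` (unique for positive `η`, `y`). -/
def mirrorStep (η g y : ι → ℝ) : ι → ℝ :=
  @Classical.epsilon _ ⟨y⟩ fun x => x ∈ stdSimplex ℝ ι ∧
    IsMinOn (fun z => ∑ i, z i * g i + bregman η z y) (stdSimplex ℝ ι) x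

/-- Multi-scale multiplicative weights with correction: mirror descent on the simplex with learning
rates `η`, initial point `y`, hints `0` and correction terms `32 η_i ℓ_i²`. -/
def msmwc (η y : ι → ℝ) : List (ι → ℝ) → ι → ℝ
  | [] => y
  | ℓ :: L => mirrorStep η (fun i => ℓ i + 32 * η i * ℓ i ^ 2) (msmwc η y L)

/-- Learning rates `η_k = 1 / (32 · 2^k)` for `k = 1, …, K`. -/
def rate {K : ℕ} (k : Fin K) : ℝ := 1 / (32 * 2 ^ (k.val + 1))

/-- The `k`-th base algorithm: uniform initial point and all learning rates `2 η_k`. -/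
def baseWeights {K : ℕ} (k : Fin K) (L : List (ι → ℝ)) : ι → ℝ :=
  msmwc (fun _ => 2 * rate k) (fun _ => 1 / (Fintype.card ι : ℝ)) L

/-- The loss vectors of the master: the losses of the base algorithms. -/
def masterLosses (K : ℕ) : List (ι → ℝ) → List (Fin K → ℝ)
  | [] => []
  | ℓ :: L => (fun k => ∑ i, baseWeights k L i * ℓ i) :: masterLosses K L

/-- The master: learning rates `η_k` and initial point proportional to `η_k²`. -/
def masterWeights (K : ℕ) (L : List (ι → ℝ)) : Fin K → ℝ :=
  msmwc rate (fun k => rate k ^ 2 / ∑ j : Fin K, rate j ^ 2) (masterLosses K L)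

/-- The weights of the expert algorithm for horizon `T`, with `⌈log₂ T⌉` base algorithms. -/
def expertWeights (T : ℕ) (L : List (ι → ℝ)) (i : ι) : ℝ :=
  ∑ k : Fin (Nat.clog 2 T), masterWeights (Nat.clog 2 T) L k * baseWeights k L i

end MsMwC

/-! ### The prediction algorithm -/

/-- The weights and the distribution over `Θ` used in a round, as functions of the past losses
(most recent first). -/
structure Predictor (γ : ℝ) where
  weights : List Loss → Expert γ → ℝ
  dist : List Loss → PMF (Theta γ)

/-- The reward vectors that the past losses produce, most recent first. -/
def Predictor.rewards {γ : ℝ} (P : Predictor γ) : List Loss → List (Expert γ → ℝ)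
  | [] => []
  | ℓ :: H => reward γ (P.dist H) ℓ :: P.rewards H

/-- `P` follows the prediction algorithm for `T` rounds: in every round its weights are those of
the expert algorithm run on the past rewards (as negated losses), up to an `ℓ¹` error `ε`, and its
distribution `κ` solves the linear program `E_{(r',b') ∼ κ} h̄(r',b',v) ≤ 0` for all `v ∈ [0,1]`,
`h̄` being the mixture with these weights. For `ε = 0` this is the algorithm in exact arithmetic. -/
def Predictor.Follows {γ : ℝ} (P : Predictor γ) (T : ℕ) (ε : ℝ) : Prop :=
  ∀ H : List Loss, H.length < T →
    P.weights H ∈ stdSimplex ℝ (Expert γ) ∧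
    ∑ e, |P.weights H e - expertWeights T ((P.rewards H).map fun u => -u) e| ≤ ε ∧
    ∀ v : unitInterval, ∑ θ' : Theta γ, (P.dist H θ').toReal * mixture γ (P.weights H) θ' v ≤ 0

/-- The strategy in the prediction problem: draw `(r, b)` from the distribution and predict `b`
(which lies in `[0,1]`, so that the projection does not change it). -/
def Predictor.strategy {γ : ℝ} (P : Predictor γ) (h : Transcript) : PMF unitInterval :=
  (P.dist (h.map Prod.snd)).map fun θ => Set.projIcc 0 1 (zero_le_one' ℝ) θ.1.2

/-! ### Machine model

A real random access machine: natural-number registers (constants, addition, truncated subtraction,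
comparison), two-dimensional arrays of reals addressed by natural numbers (rational constants,
field operations, `exp`, `log`, comparison), structured control flow, and first-order queries to
the loss just revealed. Every operation has unit cost; there is no conversion from reals to
naturals. -/

/-- First-order queries to a loss: value, left derivative, right derivative. -/
inductive Query where
  | value | left | right

/-- The answers for `ℓ`. At a point where the requested one-sided derivative is not determined by
`ℓ` on `[0,1]`, the answer is `0`. -/
def Loss.answer (ℓ : Loss) : Query → ℝ → ℝ
  | Query.value, x => Set.IccExtend (zero_le_one' ℝ) ℓ.toFun x
  | Query.left, x => derivWithin (Set.IccExtend (zero_le_one' ℝ) ℓ.toFun) (Set.Iio x) x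
  | Query.right, x => derivWithin (Set.IccExtend (zero_le_one' ℝ) ℓ.toFun) (Set.Ioi x) x

/-- Memory: natural registers, and real arrays `real a i j`. -/
structure State where
  nat : ℕ → ℕ
  real : ℕ → ℕ → ℕ → ℝ

def State.setNat (s : State) (x n : ℕ) : State :=
  { s with nat := Function.update s.nat x n }

def State.setReal (s : State) (a i j : ℕ) (z : ℝ) : State :=
  { s with real := fun a' i' j' => if a' = a ∧ i' = i ∧ j' = j then z else s.real a' i' j' }

inductive NExp where
  | const (n : ℕ)
  | var (x : ℕ)
  | add (e f : NExp)
  | sub (e f : NExp)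

def NExp.eval (s : State) : NExp → ℕ
  | const n => n
  | var x => s.nat x
  | add e f => e.eval s + f.eval s
  | sub e f => e.eval s - f.eval s

def NExp.cost : NExp → ℕ
  | const _ => 1
  | var _ => 1
  | add e f => e.cost + f.cost + 1
  | sub e f => e.cost + f.cost + 1

inductive RExp where
  | const (q : ℚ)
  | ofNat (e : NExp)
  | cell (a : ℕ) (i j : NExp)
  | add (e f : RExp)
  | sub (e f : RExp)
  | mul (e f : RExp)
  | div (e f : RExp)
  | exp (e : RExp)
  | log (e : RExp)

def RExp.eval (s : State) : RExp → ℝ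
  | const q => q
  | ofNat e => e.eval s
  | cell a i j => s.real a (i.eval s) (j.eval s)
  | add e f => e.eval s + f.eval s
  | sub e f => e.eval s - f.eval s
  | mul e f => e.eval s * f.eval s
  | div e f => e.eval s / f.eval s
  | exp e => Real.exp (e.eval s)
  | log e => Real.log (e.eval s)

def RExp.cost : RExp → ℕ
  | const _ => 1
  | ofNat e => e.cost + 1
  | cell _ i j => i.cost + j.cost + 1
  | add e f => e.cost + f.cost + 1
  | sub e f => e.cost + f.cost + 1
  | mul e f => e.cost + f.cost + 1
  | div e f => e.cost + f.cost + 1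
  | exp e => e.cost + 1
  | log e => e.cost + 1

inductive Cond where
  | natLt (e f : NExp)
  | realLt (e f : RExp)
  | not (c : Cond)

def Cond.Holds (s : State) : Cond → Prop
  | natLt e f => e.eval s < f.eval s
  | realLt e f => e.eval s < f.eval s
  | not c => ¬ c.Holds s

def Cond.cost : Cond → ℕ
  | natLt e f => e.cost + f.cost + 1
  | realLt e f => e.cost + f.cost + 1
  | not c => c.cost + 1

inductive Cmd where
  | skip
  | setNat (x : ℕ) (e : NExp)
  | setReal (a : ℕ) (i j : NExp) (e : RExp)
  | ask (a : ℕ) (i j : NExp) (q : Query) (e : RExp)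
  | seq (c d : Cmd)
  | ite (b : Cond) (c d : Cmd)
  | loop (b : Cond) (c : Cmd)

/-- `Exec O c s s' n`: with queries answered by `O`, the command `c` started in state `s` halts in
state `s'` after `n` steps. -/
inductive Exec (O : Query → ℝ → ℝ) : Cmd → State → State → ℕ → Prop
  | skip (s : State) : Exec O Cmd.skip s s 1
  | setNat (s : State) (x : ℕ) (e : NExp) :
      Exec O (Cmd.setNat x e) s (s.setNat x (e.eval s)) (e.cost + 1)
  | setReal (s : State) (a : ℕ) (i j : NExp) (e : RExp) :
      Exec O (Cmd.setReal a i j e) s (s.setReal a (i.eval s) (j.eval s) (e.eval s))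
        (i.cost + j.cost + e.cost + 1)
  | ask (s : State) (a : ℕ) (i j : NExp) (q : Query) (e : RExp) :
      Exec O (Cmd.ask a i j q e) s (s.setReal a (i.eval s) (j.eval s) (O q (e.eval s)))
        (i.cost + j.cost + e.cost + 1)
  | seq {c d : Cmd} {s s' s'' : State} {m n : ℕ} :
      Exec O c s s' m → Exec O d s' s'' n → Exec O (Cmd.seq c d) s s'' (m + n + 1)
  | ite_true {b : Cond} {c d : Cmd} {s s' : State} {n : ℕ} :
      b.Holds s → Exec O c s s' n → Exec O (Cmd.ite b c d) s s' (b.cost + n + 1)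
  | ite_false {b : Cond} {c d : Cmd} {s s' : State} {n : ℕ} :
      ¬ b.Holds s → Exec O d s s' n → Exec O (Cmd.ite b c d) s s' (b.cost + n + 1)
  | loop_true {b : Cond} {c : Cmd} {s s' s'' : State} {m n : ℕ} :
      b.Holds s → Exec O c s s' m → Exec O (Cmd.loop b c) s' s'' n →
      Exec O (Cmd.loop b c) s s'' (b.cost + m + n + 1)
  | loop_false {b : Cond} {c : Cmd} {s : State} :
      ¬ b.Holds s → Exec O (Cmd.loop b c) s s (b.cost + 1)

/-- A program for the prediction problem: `first` prepares the first prediction, `next` is run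
after each revealed loss and prepares the next prediction. -/
structure Machine where
  first : Cmd
  next : Cmd

/-- The initial memory: register `0` holds `T`, cell `(0,0,0)` holds `δ`, all else is `0`. -/
def inputState (T : ℕ) (δ : ℝ) : State where
  nat := fun x => if x = 0 then T else 0
  real := fun a i j => if a = 0 ∧ i = 0 ∧ j = 0 then δ else 0

/-- `M.Run T δ H s n`: on input `(T, δ)`, after the losses `H` (most recent first) have been
revealed one per round, `M` has prepared its next prediction in state `s`, having used `n` steps in
all rounds together. -/
inductive Machine.Run (M : Machine) (T : ℕ) (δ : ℝ) : List Loss → State → ℕ → Prop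
  | first {s : State} {n : ℕ} :
      Exec (fun _ _ => 0) M.first (inputState T δ) s n → Machine.Run M T δ [] s n
  | next {H : List Loss} {ℓ : Loss} {s s' : State} {m n : ℕ} :
      Machine.Run M T δ H s m → Exec ℓ.answer M.next s s' n →
      Machine.Run M T δ (ℓ :: H) s' (m + n)

open Classical in
/-- The distribution `κ` is written out in the state `s`: register `1` holds a number `N`, and the
first `N` entries of the arrays `1`, `2`, `3` list pairs `(r, b) ∈ Θ` with their probabilities. -/
def State.Lists {γ : ℝ} (s : State) (κ : PMF (Theta γ)) : Prop :=
  (∀ j < s.nat 1, (s.real 1 j 0, s.real 2 j 0) ∈ Theta γ) ∧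
  ∀ θ : Theta γ, (κ θ).toReal =
    ∑ j ∈ Finset.range (s.nat 1),
      if (s.real 1 j 0, s.real 2 j 0) = (θ : ℝ × ℝ) then s.real 3 j 0 else 0

end SwapRegret

end

/-! A loss and its distribution are linked by differentiation: after extending the loss with slopes
`-1` and `1`, the distribution function of `φ_ℓ` is `(1 + ℓ')/2` (`Loss.exists_isVShape`). Loss
differences are therefore means of `|p - v| - |q - v|`, and one-sided derivatives of the loss are
tail masses.

Feasibility. By a minimax argument (`exists_simplex_sum_nonpos`) the linear program is solvable once
every finite nonnegative combination of outcomes admits a pair whose four constraints all hold on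
average. `exists_good_pair` finds it by a search over scales: if every pair failed, an approximate
median on the grid of width `r` would produce a better one on the grid of width `2r`, without end,
although all scales are at most `1`. Finitely many outcomes suffice because the constraints only
compare `v` with multiples of `γ` (`exists_testPoint`).

Regret. `expert_regret` bounds the regret of the expert algorithm against an expert `e` by a
logarithm over `η` plus `η ∑ c_e²`, for every rate `η` of the grid. The linear program makes the
learner's own reward nonpositive, so the cumulative reward of a constraint of the pair `(r, b)` is
itself at most `log / η + η n`, with `n` the sum over the rounds of the probabilities of drawing the
pair; the useful rate is of order `γ / r`. Exponential supermartingales (`tsum_exp_le_one`) pass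
from probabilities to actual draws. A deviation from `b` to `q` is split at distance `2r` from `b`
(`Loss.exists_sub_le`). The near part costs about `γ` per draw, since its length is at most `2r`.
The far part has a drift of `-γ / (2r)` per draw, built into the constraints `±2`, which cancels the
term `η n`. A pair thus costs `O(γ n + γ n' + D r / γ)`, with `n'` the number of its draws and `D =
log (1/δ)`. The scales of all pairs sum to `O(log T)` (`sum_scale_le`), so the total is `O(γ T + D
log T / γ)`, which the choice of `γ` balances.

Running time. A small language of array programs is compiled to the machine. The base weights have a
closed form (`msmwc_uniform`). The normalizing multiplier of the master is found by scanning
(`scan_mem_Icc`), and the linear program is solved up to `1 / (32 T^4)` by Blackwell approachability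
(`approach_orthant`). The remaining error is removed on paper only: mixing a weight `1 / (4T)` of
two suitable constraints per pair into the weights creates enough slack for the computed
distribution to solve exactly the program of the perturbed weights (`Solved.lp_perturb`). This is
the reason for allowing `ε`-accurate executions. -/

namespace SwapRegret

open MeasureTheory Set Filter Topology

/-! ### The V-shaped decomposition of a convex Lipschitz loss. -/

section VShape

/-- The mean absolute deviation from `p`. -/
noncomputable def meanAbs (μ : Measure unitInterval) (p : ℝ) : ℝ := ∫ v : unitInterval, |p - (v : ℝ)| ∂μ

variable (μ : Measure unitInterval) [IsProbabilityMeasure μ]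

theorem integrable_abs_sub (p : ℝ) : Integrable (fun v : unitInterval => |p - (v : ℝ)|) μ :=
  (by fun_prop : Continuous fun v : unitInterval => |p - (v : ℝ)|).integrable_of_hasCompactSupport
    (HasCompactSupport.of_compactSpace _)

/-- Dominated convergence: near `p` within `s`, the slope of `|x - v|` is `-1` for `v ∈ A` and `1`
otherwise, and all slopes are bounded by `1`. The two one-sided derivatives differ only in whether
an atom at `p` belongs to `A`. -/
theorem hasDerivWithinAt_meanAbs {p : ℝ} {s : Set ℝ} (hs : p ∉ s) {A : Set unitInterval}
    (hA : MeasurableSet A)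
    (h : ∀ v : unitInterval, ∀ᶠ x in 𝓝[s] p,
      slope (fun x => |x - (v : ℝ)|) p x = 1 - 2 * A.indicator (fun _ => (1 : ℝ)) v) :
    HasDerivWithinAt (meanAbs μ) (1 - 2 * μ.real A) s p := by
  rw [hasDerivWithinAt_iff_tendsto_slope' hs]
  have hlim : (1 - 2 * μ.real A) = ∫ v, (1 - 2 * A.indicator (fun _ => (1 : ℝ)) v) ∂μ := by
    rw [integral_sub (integrable_const _)
      (((integrable_const _).indicator hA).const_mul _), integral_const_mul,
      integral_indicator_const _ hA]
    simp
  have hsl : slope (meanAbs μ) p = fun x => ∫ v : unitInterval, slope (fun x => |x - (v : ℝ)|) p x ∂μ := by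
    funext x
    simp only [slope_def_field, meanAbs]
    rw [integral_div, integral_sub (integrable_abs_sub μ x) (integrable_abs_sub μ p)]
  rw [hlim, hsl]
  refine tendsto_integral_filter_of_dominated_convergence (fun _ => 1) ?_ ?_ (integrable_const _) ?_
  · refine Eventually.of_forall fun x => ?_
    simp only [slope_def_field]
    exact (by fun_prop : Continuous fun v : unitInterval =>
      (|x - (v : ℝ)| - |p - (v : ℝ)|) / (x - p)).aestronglyMeasurable
  · refine Eventually.of_forall fun x => Eventually.of_forall fun v => ?_
    simp only [slope_def_field, Real.norm_eq_abs, abs_div]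
    refine div_le_one_of_le₀ ?_ (abs_nonneg _)
    have := abs_abs_sub_abs_le_abs_sub (x - (v : ℝ)) (p - v)
    simpa using this
  · refine Eventually.of_forall fun v => ?_
    exact tendsto_nhds_of_eventually_eq (h v)

theorem hasDerivWithinAt_meanAbs_Ioi (p : ℝ) :
    HasDerivWithinAt (meanAbs μ) (1 - 2 * μ.real {v : unitInterval | p < v}) (Ioi p) p := by
  refine hasDerivWithinAt_meanAbs μ self_notMem_Ioi
    (measurableSet_lt measurable_const measurable_subtype_coe) fun v => ?_
  by_cases hv : p < v
  · filter_upwards [Ioo_mem_nhdsGT hv] with x hx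
    have h1 : x - p ≠ 0 := (sub_pos.2 hx.1).ne'
    simp only [slope_def_field, indicator, mem_ofPred_eq, hv, if_true]
    rw [abs_of_neg (sub_neg.2 hx.2), abs_of_neg (sub_neg.2 hv)]
    field_simp; ring
  · filter_upwards [self_mem_nhdsWithin] with x hx
    have h1 : x - p ≠ 0 := (sub_pos.2 hx).ne'
    simp only [slope_def_field, indicator, mem_ofPred_eq, hv, if_false]
    rw [abs_of_nonneg (sub_nonneg.2 ((not_lt.1 hv).trans (le_of_lt hx))),
      abs_of_nonneg (sub_nonneg.2 (not_lt.1 hv))]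
    field_simp; ring

theorem hasDerivWithinAt_meanAbs_Iio (p : ℝ) :
    HasDerivWithinAt (meanAbs μ) (1 - 2 * μ.real {v : unitInterval | p ≤ v}) (Iio p) p := by
  refine hasDerivWithinAt_meanAbs μ self_notMem_Iio
    (measurableSet_le measurable_const measurable_subtype_coe) fun v => ?_
  by_cases hv : p ≤ v
  · filter_upwards [self_mem_nhdsWithin] with x hx
    have h1 : x - p ≠ 0 := (sub_neg.2 hx).ne
    simp only [slope_def_field, indicator, mem_ofPred_eq, hv, if_true]
    rw [abs_of_nonpos (sub_nonpos.2 ((le_of_lt hx).trans hv)), abs_of_nonpos (sub_nonpos.2 hv)]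
    field_simp; ring
  · filter_upwards [Ioo_mem_nhdsLT (not_le.1 hv)] with x hx
    have h1 : x - p ≠ 0 := (sub_neg.2 hx.2).ne
    simp only [slope_def_field, indicator, mem_ofPred_eq, hv, if_false]
    rw [abs_of_pos (sub_pos.2 hx.1), abs_of_pos (sub_pos.2 (not_le.1 hv))]
    field_simp; ring

theorem lipschitz_meanAbs : LipschitzWith 1 (meanAbs μ) := by
  refine LipschitzWith.of_le_add fun x y => ?_
  have h : meanAbs μ x ≤ ∫ v : unitInterval, (|y - (v : ℝ)| + dist x y) ∂μ := by
    refine integral_mono (integrable_abs_sub μ x)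
      ((integrable_abs_sub μ y).add (integrable_const _)) fun v => ?_
    have := abs_sub_le x y (v : ℝ)
    simp only [Real.dist_eq]
    linarith
  rw [integral_add (integrable_abs_sub μ y) (integrable_const _)] at h
  simpa [meanAbs] using h

/-- The extension of a loss to the real line with slopes `-1` and `1` outside `[0,1]`. -/
noncomputable def Loss.extend (ℓ : Loss) (x : ℝ) : ℝ :=
  ℓ.toFun (projIcc 0 1 (zero_le_one' ℝ) x) + |x - (projIcc 0 1 (zero_le_one' ℝ) x : ℝ)|

theorem Loss.extend_coe (ℓ : Loss) (p : unitInterval) : ℓ.extend p = ℓ.toFun p := by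
  simp [Loss.extend]

theorem Loss.abs_sub_le (ℓ : Loss) (p q : unitInterval) :
    |ℓ.toFun p - ℓ.toFun q| ≤ |(p : ℝ) - q| := by
  have := ℓ.lipschitz.dist_le_mul p q
  simpa [Real.dist_eq, Subtype.dist_eq] using this

/-- The projection of `x` lies between `x` and `w`, so the two distances add up. Consequently the
extension is the infimal convolution of the loss with `|·|`, and this inequality yields both its
convexity and its Lipschitz bound. -/
theorem Loss.extend_le (ℓ : Loss) (x : ℝ) (w : unitInterval) :
    ℓ.extend x ≤ ℓ.toFun w + |x - w| := by
  have h := le_of_abs_le (ℓ.abs_sub_le (projIcc 0 1 (zero_le_one' ℝ) x) w)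
  have h0 := w.2.1
  have h1 := w.2.2
  suffices |x - (projIcc 0 1 (zero_le_one' ℝ) x : ℝ)| + |(projIcc 0 1 (zero_le_one' ℝ) x : ℝ) - w|
      = |x - w| by unfold Loss.extend; linarith
  rcases le_total x 0 with hx | hx
  · rw [projIcc_of_le_left _ hx]
    simp only [sub_zero, zero_sub, abs_neg]
    rw [abs_of_nonpos hx, abs_of_nonneg h0, abs_of_nonpos (by linarith)]; ring
  rcases le_total x 1 with hx' | hx'
  · rw [projIcc_of_mem _ ⟨hx, hx'⟩]; simp
  · rw [projIcc_of_right_le _ hx']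
    simp only
    rw [abs_of_nonneg (by linarith), abs_of_nonneg (by linarith), abs_of_nonneg (by linarith)]; ring

theorem Loss.convexOn_extend (ℓ : Loss) : ConvexOn ℝ univ ℓ.extend := by
  refine ⟨convex_univ, fun x _ y _ a b ha hb hab => ?_⟩
  set px := projIcc 0 1 (zero_le_one' ℝ) x with hpx
  set py := projIcc 0 1 (zero_le_one' ℝ) y with hpy
  have hw : a * (px : ℝ) + b * py ∈ Icc (0 : ℝ) 1 := by
    have := (convex_Icc (0 : ℝ) 1) px.2 py.2 ha hb hab
    simpa using this
  have h1 := ℓ.extend_le (a • x + b • y) ⟨_, hw⟩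
  have h2 := ℓ.convex.2 px.2 py.2 ha hb hab
  simp only [smul_eq_mul] at h1 h2 ⊢
  rw [IccExtend_of_mem _ _ hw, IccExtend_of_mem _ _ px.2, IccExtend_of_mem _ _ py.2] at h2
  have h3 : |a * x + b * y - (a * (px : ℝ) + b * py)| ≤ a * |x - px| + b * |y - py| := by
    rw [show a * x + b * y - (a * (px : ℝ) + b * py) = a * (x - px) + b * (y - py) by ring]
    refine (abs_add_le _ _).trans ?_
    rw [abs_mul, abs_mul, abs_of_nonneg ha, abs_of_nonneg hb]
  simp only [Loss.extend, ← hpx, ← hpy] at h1 ⊢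
  simp only [Subtype.coe_eta] at h2
  linarith

theorem Loss.lipschitz_extend (ℓ : Loss) : LipschitzWith 1 ℓ.extend := by
  refine LipschitzWith.of_le_add fun x y => ?_
  have h := ℓ.extend_le x (projIcc 0 1 (zero_le_one' ℝ) y)
  have h2 := _root_.abs_sub_le x y (projIcc 0 1 (zero_le_one' ℝ) y : ℝ)
  rw [Real.dist_eq]
  unfold Loss.extend at h ⊢
  linarith

/-- The right derivative of a convex function on the real line is right-continuous. -/
theorem rightDeriv_continuousWithinAt {f : ℝ → ℝ} (hf : ConvexOn ℝ univ f) (hc : Continuous f)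
    (x : ℝ) : ContinuousWithinAt (fun x => derivWithin f (Ioi x) x) (Ici x) x := by
  have hintg : ∀ y : ℝ, y ∈ interior (univ : Set ℝ) := by simp
  have hmono : Monotone fun x => derivWithin f (Ioi x) x := by
    have := hf.monotoneOn_rightDeriv
    rwa [interior_univ, monotoneOn_univ] at this
  rw [← continuousWithinAt_Ioi_iff_Ici]
  refine tendsto_order.2 ⟨fun a ha => ?_, fun a ha => ?_⟩
  · filter_upwards [self_mem_nhdsWithin] with y hy
    exact ha.trans_le (hmono (le_of_lt hy))
  · have h1 := hf.hasDerivWithinAt_rightDeriv_of_mem_interior (hintg x)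
    rw [hasDerivWithinAt_iff_tendsto_slope' self_notMem_Ioi] at h1
    obtain ⟨z, hz, hxz⟩ := ((h1.eventually (gt_mem_nhds ha)).and self_mem_nhdsWithin).exists
    have hxz : x < z := hxz
    have h2 : ContinuousAt (fun y => slope f y z) x := by
      simp only [slope_def_field]
      exact ContinuousAt.div (by fun_prop) (by fun_prop) (sub_pos.2 hxz).ne'
    filter_upwards [(h2.eventually (gt_mem_nhds hz)).filter_mono nhdsWithin_le_nhds,
      Ioo_mem_nhdsGT hxz] with y hy hyz
    exact (hf.rightDeriv_le_slope_of_mem_interior (hintg y) (mem_univ _) hyz.2).trans_lt hy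

theorem Loss.extend_of_neg (ℓ : Loss) {x : ℝ} (hx : x ≤ 0) : ℓ.extend x = ℓ.toFun 0 - x := by
  rw [Loss.extend, projIcc_of_le_left _ hx]
  simp only [sub_zero]
  rw [abs_of_nonpos hx]; rfl

theorem Loss.extend_of_one_le (ℓ : Loss) {x : ℝ} (hx : 1 ≤ x) :
    ℓ.extend x = ℓ.toFun 1 + (x - 1) := by
  rw [Loss.extend, projIcc_of_right_le _ hx]
  simp only
  rw [abs_of_nonneg (sub_nonneg.2 hx)]; rfl

theorem Loss.rightDeriv_extend_of_neg (ℓ : Loss) {x : ℝ} (hx : x < 0) :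
    derivWithin ℓ.extend (Ioi x) x = -1 := by
  have h : HasDerivWithinAt (fun y => ℓ.toFun 0 - y) (-1) (Ioi x) x := by
    simpa using (hasDerivWithinAt_id x (Ioi x)).const_sub (ℓ.toFun 0)
  refine (h.congr_of_eventuallyEq ?_ (ℓ.extend_of_neg hx.le)).derivWithin
    (uniqueDiffWithinAt_Ioi x)
  filter_upwards [Ioo_mem_nhdsGT hx] with y hy using ℓ.extend_of_neg hy.2.le

theorem Loss.rightDeriv_extend_of_one_le (ℓ : Loss) {x : ℝ} (hx : 1 ≤ x) :
    derivWithin ℓ.extend (Ioi x) x = 1 := by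
  have h : HasDerivWithinAt (fun y => ℓ.toFun 1 + (y - 1)) 1 (Ioi x) x := by
    simpa using ((hasDerivWithinAt_id x (Ioi x)).sub_const 1).const_add (ℓ.toFun 1)
  refine (h.congr_of_eventuallyEq ?_ (ℓ.extend_of_one_le hx)).derivWithin
    (uniqueDiffWithinAt_Ioi x)
  filter_upwards [self_mem_nhdsWithin] with y hy using ℓ.extend_of_one_le (hx.trans (le_of_lt hy))

/-- The distribution function of the distribution corresponding to a loss. -/
noncomputable def Loss.stieltjes (ℓ : Loss) : StieltjesFunction ℝ where
  toFun x := (1 + derivWithin ℓ.extend (Ioi x) x) / 2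
  mono' := by
    have := ℓ.convexOn_extend.monotoneOn_rightDeriv
    rw [interior_univ, monotoneOn_univ] at this
    intro x y hxy
    have := this hxy
    simp only at this ⊢
    linarith
  right_continuous' x := by
    have := rightDeriv_continuousWithinAt ℓ.convexOn_extend ℓ.lipschitz_extend.continuous x
    exact (this.const_add 1).div_const 2

/-- The Stieltjes measure of `(1 + ℓ')/2` is pushed forward to the unit interval. Its mean absolute
deviation then has the same right derivative as the loss on `[0,1)`, so the two functions differ by
a constant on `[0,1]`. -/
theorem Loss.exists_isVShape (ℓ : Loss) : ∃ φ, IsVShape ℓ φ := by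
  have hbot : Tendsto ℓ.stieltjes atBot (𝓝 0) := by
    refine tendsto_nhds_of_eventually_eq ?_
    filter_upwards [Iio_mem_atBot (0 : ℝ)] with x hx
    simp [Loss.stieltjes, ℓ.rightDeriv_extend_of_neg hx]
  have htop : Tendsto ℓ.stieltjes atTop (𝓝 1) := by
    refine tendsto_nhds_of_eventually_eq ?_
    filter_upwards [Ici_mem_atTop (1 : ℝ)] with x hx
    simp [Loss.stieltjes, ℓ.rightDeriv_extend_of_one_le hx]
  have hprob := ℓ.stieltjes.isProbabilityMeasure hbot htop
  have hmeas : Measurable (projIcc (0 : ℝ) 1 zero_le_one) := continuous_projIcc.measurable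
  set μ : Measure unitInterval := ℓ.stieltjes.measure.map (projIcc (0 : ℝ) 1 zero_le_one) with hμ
  have hμp : IsProbabilityMeasure μ := Measure.isProbabilityMeasure_map hmeas.aemeasurable
  have hderiv : ∀ x ∈ Ico (0 : ℝ) 1,
      HasDerivWithinAt (meanAbs μ) (derivWithin ℓ.extend (Ioi x) x) (Ioi x) x := by
    intro x hx
    convert hasDerivWithinAt_meanAbs_Ioi μ x using 1
    have hset : (projIcc (0 : ℝ) 1 zero_le_one) ⁻¹' {v : unitInterval | x < v} = Ioi x := by
      ext y
      simp only [mem_preimage, mem_ofPred_eq, mem_Ioi, coe_projIcc, lt_max_iff, lt_min_iff]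
      constructor
      · rintro (h | h)
        · exact absurd h hx.1.not_gt
        · exact h.2
      · exact fun h => Or.inr ⟨hx.2, h⟩
    have h1 : μ.real {v : unitInterval | x < v} = 1 - ℓ.stieltjes x := by
      rw [hμ, map_measureReal_apply hmeas
        (measurableSet_lt measurable_const measurable_subtype_coe), hset, measureReal_def,
        ℓ.stieltjes.measure_Ioi htop, ENNReal.toReal_ofReal]
      exact sub_nonneg.2 (ℓ.stieltjes.mono.ge_of_tendsto htop x)
    rw [h1]
    simp only [Loss.stieltjes]
    ring
  have hconst : ∀ x ∈ Icc (0 : ℝ) 1,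
      ℓ.extend x - meanAbs μ x = ℓ.extend 0 - meanAbs μ 0 := by
    refine constant_of_has_deriv_right_zero (f := fun x => ℓ.extend x - meanAbs μ x)
      (ℓ.lipschitz_extend.continuous.sub (lipschitz_meanAbs μ).continuous).continuousOn ?_
    intro x hx
    have h1 := ℓ.convexOn_extend.hasDerivWithinAt_rightDeriv_of_mem_interior
      (x := x) (by simp)
    have := (h1.sub (hderiv x hx))
    rw [sub_self] at this
    exact this.Ici_of_Ioi
  -- This identity determines the additive constant as `(ℓ(0) + ℓ(1) - 1) / 2`.
  have hsum : meanAbs μ 0 + meanAbs μ 1 = 1 := by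
    rw [meanAbs, meanAbs, ← integral_add (integrable_abs_sub μ 0) (integrable_abs_sub μ 1)]
    have : ∀ v : unitInterval, |0 - (v : ℝ)| + |1 - (v : ℝ)| = 1 := fun v => by
      rw [abs_of_nonpos (by linarith [v.2.1]), abs_of_nonneg (by linarith [v.2.2])]; ring
    simp_rw [this]
    simp
  refine ⟨⟨μ, hμp⟩, fun p => ?_⟩
  have h1 := hconst p p.2
  have h2 := hconst 1 (by simp)
  have e0 : ℓ.extend 0 = ℓ.toFun 0 := ℓ.extend_coe 0
  have e1 : ℓ.extend 1 = ℓ.toFun 1 := ℓ.extend_coe 1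
  rw [ℓ.extend_coe] at h1
  rw [e0] at h1 h2
  rw [e1] at h2
  change ℓ.toFun p = meanAbs μ p + _
  linarith

theorem isVShape_vDist (ℓ : Loss) : IsVShape ℓ (vDist ℓ) := by
  unfold vDist
  exact Classical.epsilon_spec ℓ.exists_isVShape

/-- The mass that the distribution of a loss gives to a set. -/
noncomputable def Loss.mass (ℓ : Loss) (A : Set unitInterval) : ℝ :=
  (vDist ℓ : Measure unitInterval).real A

theorem Loss.toFun_eq (ℓ : Loss) (p : unitInterval) :
    ℓ.toFun p = meanAbs (vDist ℓ) p + (ℓ.toFun 0 + ℓ.toFun 1 - 1) / 2 := isVShape_vDist ℓ p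

/-- This identity and the next let a program read off means of constraints. The point `1` is
excluded here, and `0` in the next, because queries differentiate the clamped extension, which is
constant outside `[0,1]`. -/
theorem Loss.answer_right (ℓ : Loss) {x : ℝ} (h0 : 0 ≤ x) (h1 : x < 1) :
    ℓ.answer Query.right x = 1 - 2 * ℓ.mass {v | x < v} := by
  have h := (hasDerivWithinAt_meanAbs_Ioi (vDist ℓ) x).add_const
    ((ℓ.toFun 0 + ℓ.toFun 1 - 1) / 2)
  refine (h.congr_of_eventuallyEq ?_ ?_).derivWithin (uniqueDiffWithinAt_Ioi x)
  · filter_upwards [Ioo_mem_nhdsGT h1] with y hy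
    rw [IccExtend_of_mem _ _ ⟨h0.trans hy.1.le, hy.2.le⟩]
    exact ℓ.toFun_eq _
  · rw [IccExtend_of_mem _ _ ⟨h0, h1.le⟩]
    exact ℓ.toFun_eq _

theorem Loss.answer_left (ℓ : Loss) {x : ℝ} (h0 : 0 < x) (h1 : x ≤ 1) :
    ℓ.answer Query.left x = 1 - 2 * ℓ.mass {v | x ≤ v} := by
  have h := (hasDerivWithinAt_meanAbs_Iio (vDist ℓ) x).add_const
    ((ℓ.toFun 0 + ℓ.toFun 1 - 1) / 2)
  refine (h.congr_of_eventuallyEq ?_ ?_).derivWithin (uniqueDiffWithinAt_Iio x)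
  · filter_upwards [Ioo_mem_nhdsLT h0] with y hy
    rw [IccExtend_of_mem _ _ ⟨hy.1.le, hy.2.le.trans h1⟩]
    exact ℓ.toFun_eq _
  · rw [IccExtend_of_mem _ _ ⟨h0.le, h1⟩]
    exact ℓ.toFun_eq _

end VShape

end SwapRegret

namespace SwapRegret

/-! ### Entropic mirror descent on the simplex: closed form and second-order regret. -/

section MirrorDescent

variable {ι : Type} [Fintype ι]

theorem entropy_term_nonneg {x y : ℝ} (hx : 0 ≤ x) (hy : 0 < y) :
    0 ≤ x * Real.log (x / y) - x + y := by
  have h := mul_nonneg hy.le (InformationTheory.klFun_nonneg (div_nonneg hx hy.le))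
  have e : y * InformationTheory.klFun (x / y) = x * Real.log (x / y) - x + y := by
    unfold InformationTheory.klFun; field_simp; ring
  rwa [e] at h

theorem eq_of_entropy_term_eq_zero {x y : ℝ} (hx : 0 ≤ x) (hy : 0 < y)
    (h : x * Real.log (x / y) - x + y = 0) : x = y := by
  have e : y * InformationTheory.klFun (x / y) = x * Real.log (x / y) - x + y := by
    unfold InformationTheory.klFun; field_simp; ring
  rw [← e, mul_eq_zero, or_iff_right hy.ne',
    InformationTheory.klFun_eq_zero_iff (div_nonneg hx hy.le)] at h
  field_simp at h
  exact h

theorem bregman_nonneg {η x y : ι → ℝ} (hη : ∀ i, 0 < η i) (hx : ∀ i, 0 ≤ x i)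
    (hy : ∀ i, 0 < y i) : 0 ≤ bregman η x y :=
  Finset.sum_nonneg fun i _ =>
    mul_nonneg (one_div_nonneg.2 (hη i).le) (entropy_term_nonneg (hx i) (hy i))

theorem eq_of_bregman_nonpos {η x y : ι → ℝ} (hη : ∀ i, 0 < η i) (hx : ∀ i, 0 ≤ x i)
    (hy : ∀ i, 0 < y i) (h : bregman η x y ≤ 0) : x = y := by
  have h0 : bregman η x y = 0 := le_antisymm h (bregman_nonneg hη hx hy)
  unfold bregman at h0
  rw [Finset.sum_eq_zero_iff_of_nonneg fun i _ =>
    mul_nonneg (one_div_nonneg.2 (hη i).le) (entropy_term_nonneg (hx i) (hy i))] at h0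
  funext i
  have := h0 i (Finset.mem_univ i)
  rw [mul_eq_zero, or_iff_right (one_div_pos.2 (hη i)).ne'] at this
  exact eq_of_entropy_term_eq_zero (hx i) (hy i) this

/-- The point `y_i exp(-η_i (G_i + Λ))`. -/
noncomputable def tilt (η y G : ι → ℝ) (Λ : ℝ) (i : ι) : ℝ := y i * Real.exp (-(η i * (G i + Λ)))

theorem tilt_pos {κ : Type} {η y G : κ → ℝ} (hy : ∀ i, 0 < y i) (Λ : ℝ) (i : κ) : 0 < tilt η y G Λ i :=
  mul_pos (hy i) (Real.exp_pos _)

/-- Intermediate values: at `Λ = M` every exponent is nonpositive, at `Λ = -M` every exponent is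
nonnegative. The range of `Λ` also bounds the numerical search for it. -/
theorem exists_sum_tilt_eq_one {η y G : ι → ℝ} (hη : ∀ i, 0 < η i) (hy : y ∈ stdSimplex ℝ ι)
    {M : ℝ} (hM0 : 0 ≤ M) (hM : ∀ i, |G i| ≤ M) :
    ∃ Λ ∈ Set.Icc (-M) M, ∑ i, tilt η y G Λ i = 1 := by
  have hcont : ContinuousOn (fun Λ => ∑ i, tilt η y G Λ i) (Set.Icc (-M) M) := by
    unfold tilt; fun_prop
  have h1 : ∑ i, tilt η y G M i ≤ 1 := by
    rw [← hy.2]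
    refine Finset.sum_le_sum fun i _ => mul_le_of_le_one_right (hy.1 i) ?_
    rw [Real.exp_le_one_iff, neg_nonpos]
    exact mul_nonneg (hη i).le (by linarith [neg_le_of_abs_le (hM i)])
  have h2 : 1 ≤ ∑ i, tilt η y G (-M) i := by
    rw [← hy.2]
    refine Finset.sum_le_sum fun i _ => le_mul_of_one_le_right (hy.1 i) ?_
    rw [Real.one_le_exp_iff, neg_nonneg]
    exact mul_nonpos_of_nonneg_of_nonpos (hη i).le (by linarith [le_of_abs_le (hM i)])
  obtain ⟨Λ, hΛ, h⟩ := intermediate_value_Icc' (by linarith) hcont ⟨h1, h2⟩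
  exact ⟨Λ, hΛ, h⟩

theorem sum_tilt_strictAnti [Nonempty ι] {η y G : ι → ℝ} (hη : ∀ i, 0 < η i) (hy : ∀ i, 0 < y i) :
    StrictAnti fun Λ => ∑ i, tilt η y G Λ i := by
  intro Λ Λ' h
  refine Finset.sum_lt_sum_of_nonempty Finset.univ_nonempty fun i _ => ?_
  refine mul_lt_mul_of_pos_left (Real.exp_lt_exp.2 (neg_lt_neg ?_)) (hy i)
  exact mul_lt_mul_of_pos_left (by linarith) (hη i)

/-- The three-point identity holds with equality because the gradient of the objective at the tilted
point is the constant vector `-Λ`, which is invisible on the simplex. It gives existence and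
uniqueness of the minimizer and also drives the regret bound. -/
theorem mirror_identity {η g y : ι → ℝ} {Λ : ℝ} (hη : ∀ i, 0 < η i) (hy : ∀ i, 0 < y i)
    (hΛ : ∑ i, tilt η y g Λ i = 1) {z : ι → ℝ} (hz : z ∈ stdSimplex ℝ ι) :
    ∑ i, z i * g i + bregman η z y =
      ∑ i, tilt η y g Λ i * g i + bregman η (tilt η y g Λ) y + bregman η z (tilt η y g Λ) := by
  -- The logarithm of the tilted point turns the linear term into a change of base point.
  -- Coordinates with `u i = 0` are separate because the logarithm of a quotient does not split
  -- there.
  have key : ∀ u : ι → ℝ, ∑ i, u i = 1 → (∀ i, 0 ≤ u i) → ∑ i, u i * g i + bregman η u y =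
      bregman η u (tilt η y g Λ) - Λ + ∑ i, (1 / η i) * (y i - tilt η y g Λ i) := by
    intro u hu hu0
    have : -Λ = ∑ i, -Λ * u i := by rw [← Finset.mul_sum, hu, mul_one]
    rw [sub_eq_add_neg, this, bregman, bregman, ← Finset.sum_add_distrib, ← Finset.sum_add_distrib,
      ← Finset.sum_add_distrib]
    refine Finset.sum_congr rfl fun i _ => ?_
    have hηi := (hη i).ne'
    rcases (hu0 i).eq_or_lt with h0 | h0
    · rw [← h0]; simp; ring
    · have e : Real.log (u i / tilt η y g Λ i) = Real.log (u i / y i) + η i * (g i + Λ) := by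
        rw [Real.log_div h0.ne' (tilt_pos hy Λ i).ne', Real.log_div h0.ne' (hy i).ne', tilt,
          Real.log_mul (hy i).ne' (Real.exp_ne_zero _), Real.log_exp]
        ring
      rw [e]
      field_simp
      ring
  have hself : bregman η (tilt η y g Λ) (tilt η y g Λ) = 0 := by
    refine Finset.sum_eq_zero fun i _ => ?_
    rw [div_self (tilt_pos hy Λ i).ne', Real.log_one]; ring
  rw [key z hz.2 hz.1, key _ hΛ fun i => (tilt_pos hy Λ i).le, hself]
  ring

theorem mirrorStep_eq {η g y : ι → ℝ} {Λ : ℝ} (hη : ∀ i, 0 < η i) (hy : ∀ i, 0 < y i)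
    (hΛ : ∑ i, tilt η y g Λ i = 1) : mirrorStep η g y = tilt η y g Λ := by
  have hx : tilt η y g Λ ∈ stdSimplex ℝ ι := ⟨fun i => (tilt_pos hy Λ i).le, hΛ⟩
  have hex : ∃ x, x ∈ stdSimplex ℝ ι ∧
      IsMinOn (fun z => ∑ i, z i * g i + bregman η z y) (stdSimplex ℝ ι) x := by
    refine ⟨_, hx, isMinOn_iff.2 fun z hz => ?_⟩
    rw [mirror_identity hη hy hΛ hz]
    linarith [bregman_nonneg hη hz.1 (tilt_pos (η := η) (G := g) hy Λ)]
  obtain ⟨h1, h2⟩ := Classical.epsilon_spec hex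
  change mirrorStep η g y ∈ _ at h1
  have h3 := isMinOn_iff.1 h2 _ hx
  change ∑ i, mirrorStep η g y i * g i + bregman η (mirrorStep η g y) y ≤ _ at h3
  rw [mirror_identity hη hy hΛ h1] at h3
  exact eq_of_bregman_nonpos hη h1.1 (tilt_pos hy Λ) (by linarith)

/-- Cumulative corrected losses. -/
noncomputable def cumLoss (η : ι → ℝ) (L : List (ι → ℝ)) (i : ι) : ℝ :=
  (L.map fun c => c i + 32 * η i * c i ^ 2).sum

theorem tilt_tilt {κ : Type} (η y G g : κ → ℝ) (Λ Λ' : ℝ) :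
    tilt η (tilt η y G Λ) g Λ' = tilt η y (fun i => g i + G i) (Λ' + Λ) := by
  funext i
  simp only [tilt]
  rw [mul_assoc, ← Real.exp_add]
  congr 2
  ring

/-- Tilts compose, so the current point depends on the history only through the cumulative corrected
losses and one normalizing multiplier. An implementation can therefore keep sums instead of
iterates. -/
theorem exists_msmwc_eq_tilt [Nonempty ι] {η y : ι → ℝ} (hη : ∀ i, 0 < η i) (hy : ∀ i, 0 < y i)
    (hy1 : ∑ i, y i = 1) (L : List (ι → ℝ)) :
    ∃ Λ, msmwc η y L = tilt η y (cumLoss η L) Λ ∧ ∑ i, msmwc η y L i = 1 := by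
  induction L with
  | nil =>
    refine ⟨0, ?_, hy1⟩
    funext i
    simp [msmwc, tilt, cumLoss]
  | cons c L ih =>
    obtain ⟨Λ, h, h1⟩ := ih
    have hpos : ∀ i, 0 < msmwc η y L i := fun i => by rw [h]; exact tilt_pos hy Λ i
    obtain ⟨Λ', -, h'⟩ := exists_sum_tilt_eq_one (G := fun i => c i + 32 * η i * c i ^ 2) hη
      (⟨fun i => (hpos i).le, h1⟩ : msmwc η y L ∈ stdSimplex ℝ ι)
      (Finset.sum_nonneg fun i _ => abs_nonneg _)
      (fun i => Finset.single_le_sum (f := fun i => |c i + 32 * η i * c i ^ 2|)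
        (fun i _ => abs_nonneg _) (Finset.mem_univ i))
    have h2 : msmwc η y (c :: L) = tilt η (msmwc η y L) (fun i => c i + 32 * η i * c i ^ 2) Λ' :=
      mirrorStep_eq hη hpos h'
    refine ⟨Λ' + Λ, ?_, by rw [h2]; exact h'⟩
    rw [h2, h, tilt_tilt]
    rfl

theorem msmwc_pos [Nonempty ι] {η y : ι → ℝ} (hη : ∀ i, 0 < η i) (hy : ∀ i, 0 < y i)
    (hy1 : ∑ i, y i = 1) (L : List (ι → ℝ)) (i : ι) : 0 < msmwc η y L i := by
  obtain ⟨Λ, h, -⟩ := exists_msmwc_eq_tilt hη hy hy1 L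
  rw [h]; exact tilt_pos hy Λ i

theorem sum_msmwc [Nonempty ι] {η y : ι → ℝ} (hη : ∀ i, 0 < η i) (hy : ∀ i, 0 < y i)
    (hy1 : ∑ i, y i = 1) (L : List (ι → ℝ)) : ∑ i, msmwc η y L i = 1 :=
  (exists_msmwc_eq_tilt hη hy hy1 L).choose_spec.2

theorem msmwc_eq_tilt [Nonempty ι] {η y : ι → ℝ} (hη : ∀ i, 0 < η i) (hy : ∀ i, 0 < y i)
    (hy1 : ∑ i, y i = 1) (L : List (ι → ℝ)) {Λ : ℝ}
    (hΛ : ∑ i, tilt η y (cumLoss η L) Λ i = 1) : msmwc η y L = tilt η y (cumLoss η L) Λ := by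
  obtain ⟨Λ', h, h1⟩ := exists_msmwc_eq_tilt hη hy hy1 L
  rw [h] at h1
  rw [h, (sum_tilt_strictAnti hη hy).injective (h1.trans hΛ.symm)]

/-- With a common learning rate the weights are proportional to `exp(-η G_i)`. -/
theorem msmwc_uniform [Nonempty ι] {η : ℝ} (hη : 0 < η) (L : List (ι → ℝ)) (i : ι) :
    msmwc (fun _ => η) (fun _ => 1 / (Fintype.card ι : ℝ)) L i =
      Real.exp (-(η * cumLoss (fun _ => η) L i)) /
        ∑ j, Real.exp (-(η * cumLoss (fun _ => η) L j)) := by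
  have hc : (0 : ℝ) < Fintype.card ι := by exact_mod_cast Fintype.card_pos
  set S := ∑ j, Real.exp (-(η * cumLoss (fun _ => η) L j)) with hS
  have hSpos : 0 < S := Finset.sum_pos (fun j _ => Real.exp_pos _) Finset.univ_nonempty
  have e : ∀ j, tilt (fun _ => η) (fun _ => 1 / (Fintype.card ι : ℝ)) (cumLoss (fun _ => η) L)
      (Real.log (S / Fintype.card ι) / η) j = Real.exp (-(η * cumLoss (fun _ => η) L j)) / S := by
    intro j
    simp only [tilt]
    rw [mul_add, mul_div_cancel₀ _ hη.ne', neg_add, Real.exp_add, Real.exp_neg (Real.log _),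
      Real.exp_log (by positivity)]
    field_simp
  rw [msmwc_eq_tilt (fun _ => hη) (fun _ => by positivity) (by simp) L, e]
  simp_rw [e]
  rw [← Finset.sum_div, div_self hSpos.ne']

/-- Sum over the rounds of a history, each round seeing the earlier ones. -/
noncomputable def pathSum {α : Type*} (F : List α → α → ℝ) : List α → ℝ
  | [] => 0
  | c :: L => F L c + pathSum F L

theorem pathSum_le_pathSum {α : Type*} {F F' : List α → α → ℝ} :
    ∀ L : List α, (∀ c L', (c :: L') <:+ L → F L' c ≤ F' L' c) → pathSum F L ≤ pathSum F' L
  | [], _ => le_rfl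
  | c :: L, h => add_le_add (h c L (List.suffix_refl _))
      (pathSum_le_pathSum L fun c' L' h' => h c' L' (h'.trans (List.suffix_cons _ _)))

theorem pathSum_congr {α : Type*} {F F' : List α → α → ℝ} (L : List α)
    (h : ∀ c L', (c :: L') <:+ L → F L' c = F' L' c) : pathSum F L = pathSum F' L :=
  le_antisymm (pathSum_le_pathSum L fun c L' h' => (h c L' h').le)
    (pathSum_le_pathSum L fun c L' h' => (h c L' h').ge)

theorem pathSum_add {α : Type*} (F F' : List α → α → ℝ) (L : List α) :
    pathSum (fun L c => F L c + F' L c) L = pathSum F L + pathSum F' L := by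
  induction L with
  | nil => simp [pathSum]
  | cons c L ih => simp only [pathSum, ih]; ring

theorem pathSum_sub {α : Type*} (F F' : List α → α → ℝ) (L : List α) :
    pathSum (fun L c => F L c - F' L c) L = pathSum F L - pathSum F' L := by
  induction L with
  | nil => simp [pathSum]
  | cons c L ih => simp only [pathSum, ih]; ring

theorem pathSum_const_mul {α : Type*} (a : ℝ) (F : List α → α → ℝ) (L : List α) :
    pathSum (fun L c => a * F L c) L = a * pathSum F L := by
  induction L with
  | nil => simp [pathSum]
  | cons c L ih => simp only [pathSum, ih]; ring

theorem pathSum_const {α : Type*} (a : ℝ) (L : List α) :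
    pathSum (fun _ _ => a) L = L.length * a := by
  induction L with
  | nil => simp [pathSum]
  | cons c L ih => simp only [pathSum, ih, List.length_cons]; push_cast; ring

theorem pathSum_finset_sum {α β : Type*} (s : Finset β) (F : β → List α → α → ℝ) (L : List α) :
    pathSum (fun L c => ∑ b ∈ s, F b L c) L = ∑ b ∈ s, pathSum (F b) L := by
  induction L with
  | nil => simp [pathSum]
  | cons c L ih => simp only [pathSum, ih, Finset.sum_add_distrib]

/-- The per-round inequality of mirror descent with correction terms. -/
theorem mirror_stability {η c y x : ℝ} (hη : 0 < η) (hy : 0 < y) (hx : 0 ≤ x)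
    (hc : 32 * η * |c| ≤ 1) :
    (y - x) * (c + 32 * η * c ^ 2) - (1 / η) * (x * Real.log (x / y) - x + y) ≤
      4 * (y * η * c ^ 2) := by
  set g := c + 32 * η * c ^ 2 with hg
  have hexp : 0 < Real.exp (-(η * g)) := Real.exp_pos _
  -- The left side is maximized over `x` at `y exp(-η g)`. Nonnegativity of the entropy term based
  -- at that point bounds it by `(y/η)(exp(-η g) - 1 + η g)`, and the rest is a quadratic bound on
  -- the exponential with `|1 + 32 η c| ≤ 2`.
  have h1 := entropy_term_nonneg hx (mul_pos hy hexp)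
  have h2 : x * Real.log (x / (y * Real.exp (-(η * g)))) = x * Real.log (x / y) + x * (η * g) := by
    rcases hx.eq_or_lt with h0 | h0
    · rw [← h0]; simp
    · rw [Real.log_div h0.ne' (mul_pos hy hexp).ne', Real.log_mul hy.ne' hexp.ne', Real.log_exp,
        Real.log_div h0.ne' hy.ne']
      ring
  have habs : |32 * η * c| ≤ 1 := by rwa [abs_mul, abs_of_pos (by positivity)]
  have hfac : |1 + 32 * η * c| ≤ 2 := (abs_add_le _ _).trans (by rw [abs_one]; linarith)
  have hηg : η * g = (η * c) * (1 + 32 * η * c) := by rw [hg]; ring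
  have hsq : (η * g) ^ 2 ≤ 4 * (η * c) ^ 2 := by
    rw [hηg, mul_pow]
    have : (1 + 32 * η * c) ^ 2 ≤ 4 := by
      rw [← sq_abs]; nlinarith [abs_nonneg (1 + 32 * η * c)]
    nlinarith [sq_nonneg (η * c)]
  have hsmall : |-(η * g)| ≤ 1 := by
    rw [abs_neg, hηg, abs_mul]
    have : |η * c| ≤ 1 / 32 := by
      rw [show 32 * η * c = 32 * (η * c) by ring, abs_mul, abs_of_pos (by norm_num : (0:ℝ) < 32)]
        at habs
      linarith
    nlinarith [abs_nonneg (η * c), abs_nonneg (1 + 32 * η * c)]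
  have h3 := le_of_abs_le (Real.abs_exp_sub_one_sub_id_le hsmall)
  rw [neg_sq] at h3
  have h4 : y * Real.exp (-(η * g)) ≤ y * (1 - η * g + 4 * (η * c) ^ 2) :=
    mul_le_mul_of_nonneg_left (by linarith) hy.le
  rw [h2] at h1
  have h5 : η * ((y - x) * g) - (x * Real.log (x / y) - x + y) ≤ η * (4 * (y * η * c ^ 2)) := by
    nlinarith
  have h6 : (y - x) * g - (1 / η) * (x * Real.log (x / y) - x + y) =
      (1 / η) * (η * ((y - x) * g) - (x * Real.log (x / y) - x + y)) := by field_simp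
  rw [h6]
  calc _ ≤ (1 / η) * (η * (4 * (y * η * c ^ 2))) :=
        mul_le_mul_of_nonneg_left h5 (by positivity)
    _ = _ := by field_simp

/-- The divergence to the comparator `u` telescopes. The correction charges `32 η c²` to both sides:
the comparator pays it in full, while the learner needs only `4` for stability and keeps a surplus
of `28`. This surplus makes it possible to combine algorithms. -/
theorem msmwc_regret [Nonempty ι] {η y : ι → ℝ} (hη : ∀ i, 0 < η i) (hy : ∀ i, 0 < y i)
    (hy1 : ∑ i, y i = 1) {u : ι → ℝ} (hu : u ∈ stdSimplex ℝ ι) :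
    ∀ L : List (ι → ℝ), (∀ c ∈ L, ∀ i, 32 * η i * |c i| ≤ 1) →
    pathSum (fun L c => ∑ i, (msmwc η y L i - u i) * c i - 32 * ∑ i, u i * η i * c i ^ 2
      + 28 * ∑ i, msmwc η y L i * η i * c i ^ 2) L + bregman η u (msmwc η y L) ≤ bregman η u y
  | [], _ => by simp [pathSum, msmwc]
  | c :: L, hL => by
    have ih := msmwc_regret hη hy hy1 hu L fun c' hc' => hL c' (List.mem_cons_of_mem _ hc')
    have hpos := msmwc_pos hη hy hy1 L
    have h1 := sum_msmwc hη hy hy1 L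
    obtain ⟨Λ', -, h'⟩ := exists_sum_tilt_eq_one (G := fun i => c i + 32 * η i * c i ^ 2) hη
      (⟨fun i => (hpos i).le, h1⟩ : msmwc η y L ∈ stdSimplex ℝ ι)
      (Finset.sum_nonneg fun i _ => abs_nonneg _)
      (fun i => Finset.single_le_sum (f := fun i => |c i + 32 * η i * c i ^ 2|)
        (fun i _ => abs_nonneg _) (Finset.mem_univ i))
    have h2 : msmwc η y (c :: L) = tilt η (msmwc η y L) (fun i => c i + 32 * η i * c i ^ 2) Λ' :=
      mirrorStep_eq hη hpos h'
    have h3 := mirror_identity hη hpos h' hu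
    rw [← h2] at h3
    have hpos' := msmwc_pos hη hy hy1 (c :: L)
    have h4 : ∑ i, ((msmwc η y L i - msmwc η y (c :: L) i) * (c i + 32 * η i * c i ^ 2)
        - (1 / η i) * (msmwc η y (c :: L) i * Real.log (msmwc η y (c :: L) i / msmwc η y L i)
          - msmwc η y (c :: L) i + msmwc η y L i)) ≤
        ∑ i, 4 * (msmwc η y L i * η i * c i ^ 2) :=
      Finset.sum_le_sum fun i _ => mirror_stability (hη i) (hpos i) (hpos' i).le
        (hL c List.mem_cons_self i)
    rw [Finset.sum_sub_distrib, ← Finset.mul_sum] at h4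
    change _ - bregman η (msmwc η y (c :: L)) (msmwc η y L) ≤ _ at h4
    simp only [pathSum]
    simp only [sub_mul, mul_add, Finset.sum_sub_distrib, Finset.sum_add_distrib] at h3 h4 ⊢
    have e1 : ∀ z : ι → ℝ, ∑ i, z i * (32 * η i * c i ^ 2) = 32 * ∑ i, z i * η i * c i ^ 2 := by
      intro z; rw [Finset.mul_sum]; exact Finset.sum_congr rfl fun i _ => by ring
    simp only [e1] at h3 h4
    simp only [sub_mul, Finset.sum_sub_distrib] at ih
    linarith

end MirrorDescent

end SwapRegret

namespace SwapRegret

/-! ### Regret of the two-level expert algorithm. -/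

section ExpertRegret

variable {ι : Type} [Fintype ι]

theorem rate_pos {K : ℕ} (k : Fin K) : 0 < rate k := by unfold rate; positivity

theorem rate_le {K : ℕ} (k : Fin K) : rate k ≤ 1 / 64 := by
  unfold rate
  refine one_div_le_one_div_of_le (by norm_num) ?_
  have : (1 : ℝ) ≤ 2 ^ k.val := one_le_pow₀ (by norm_num)
  rw [pow_succ]; linarith

theorem sum_rate_le (K : ℕ) : ∑ j : Fin K, rate j ≤ 1 / 32 := by
  have h : ∀ K : ℕ, ∑ j ∈ Finset.range K, 1 / (32 * (2 : ℝ) ^ (j + 1)) = 1 / 32 * (1 - 1 / 2 ^ K) := by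
    intro K
    induction K with
    | zero => simp
    | succ K ih => rw [Finset.sum_range_succ, ih, pow_succ]; field_simp; ring
  unfold rate
  rw [Fin.sum_univ_eq_sum_range (fun j => 1 / (32 * (2 : ℝ) ^ (j + 1))), h]
  have : (0 : ℝ) < 1 / 2 ^ K := by positivity
  linarith

theorem bregman_single [DecidableEq ι] {η y : ι → ℝ} (k : ι) :
    bregman η (Pi.single k 1) y = 1 / η k * (Real.log (1 / y k) - 1) + ∑ j, y j / η j := by
  have : ∀ j, 1 / η j * ((Pi.single k 1 : ι → ℝ) j * Real.log ((Pi.single k 1 : ι → ℝ) j / y j)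
      - (Pi.single k 1 : ι → ℝ) j + y j) =
      (if j = k then 1 / η k * (Real.log (1 / y k) - 1) else 0) + y j / η j := by
    intro j
    by_cases h : j = k
    · subst h; simp; ring
    · simp [h]; ring
  unfold bregman
  rw [Finset.sum_congr rfl fun j _ => this j, Finset.sum_add_distrib]
  simp

theorem baseWeights_pos [Nonempty ι] {K : ℕ} (k : Fin K) (L : List (ι → ℝ)) (i : ι) :
    0 < baseWeights k L i :=
  msmwc_pos (fun _ => by have := rate_pos k; positivity)
    (fun _ => by have : 0 < Fintype.card ι := Fintype.card_pos
                 positivity) (by simp) L i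

theorem sum_baseWeights [Nonempty ι] {K : ℕ} (k : Fin K) (L : List (ι → ℝ)) :
    ∑ i, baseWeights k L i = 1 :=
  sum_msmwc (fun _ => by have := rate_pos k; positivity)
    (fun _ => by have : 0 < Fintype.card ι := Fintype.card_pos
                 positivity) (by simp) L

/-- The comparator is the vertex `e` and the learning rate is `2 η_k`, so the surplus `28` and the
charge `32` are doubled. -/
theorem base_regret [Nonempty ι] {K : ℕ} (k : Fin K) (e : ι) (L : List (ι → ℝ))
    (hL : ∀ c ∈ L, ∀ i, |c i| ≤ 1) :
    pathSum (fun L c => ∑ i, baseWeights k L i * c i - c e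
      + 56 * rate k * ∑ i, baseWeights k L i * c i ^ 2) L ≤
      Real.log (Fintype.card ι) / (2 * rate k) + 64 * rate k * pathSum (fun _ c => c e ^ 2) L := by
  classical
  have hr := rate_pos k
  have hr' := rate_le k
  have hη : ∀ _ : ι, 0 < 2 * rate k := fun _ => by positivity
  have hc : (0 : ℝ) < Fintype.card ι := by exact_mod_cast Fintype.card_pos
  have hy : ∀ _ : ι, 0 < 1 / (Fintype.card ι : ℝ) := fun _ => by positivity
  have h := msmwc_regret hη hy (by simp) (single_mem_stdSimplex ℝ e) L fun c hc i => by
    have := hL c hc i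
    nlinarith [abs_nonneg (c i)]
  rw [bregman_single (y := fun _ => 1 / (Fintype.card ι : ℝ))] at h
  have h0 := bregman_nonneg hη (single_mem_stdSimplex ℝ e).1 (msmwc_pos hη hy (by simp) L)
  have e1 : pathSum (fun L c => ∑ i, (msmwc (fun _ => 2 * rate k) (fun _ => 1 / (Fintype.card ι : ℝ)) L i - (Pi.single e 1 : ι → ℝ) i) * c i - 32 * ∑ i, (Pi.single e 1 : ι → ℝ) i * (2 * rate k) * c i ^ 2
      + 28 * ∑ i, msmwc (fun _ => 2 * rate k) (fun _ => 1 / (Fintype.card ι : ℝ)) L i * (2 * rate k) * c i ^ 2) L =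
      pathSum (fun L c => ∑ i, baseWeights k L i * c i - c e
      + 56 * rate k * ∑ i, baseWeights k L i * c i ^ 2) L + (-(64 * rate k)) * pathSum (fun _ c => c e ^ 2) L := by
    rw [← pathSum_const_mul, ← pathSum_add]
    refine pathSum_congr _ fun c L _ => ?_
    have e2 : ∑ i, (Pi.single e 1 : ι → ℝ) i * c i = c e := by
      simp [Pi.single_apply]
    have e3 : ∑ i, (Pi.single e 1 : ι → ℝ) i * (2 * rate k) * c i ^ 2 = 2 * rate k * c e ^ 2 := by
      simp [Pi.single_apply]
    have e4 : ∑ i, baseWeights k L i * (2 * rate k) * c i ^ 2 =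
        2 * rate k * ∑ i, baseWeights k L i * c i ^ 2 := by
      rw [Finset.mul_sum]; exact Finset.sum_congr rfl fun i _ => by ring
    change ∑ i, (baseWeights k L i - (Pi.single e 1 : ι → ℝ) i) * c i - _ + 28 * ∑ i, baseWeights k L i * (2 * rate k) * c i ^ 2 = _
    rw [e3, e4]
    simp only [sub_mul, Finset.sum_sub_distrib, e2]
    ring
  rw [e1] at h
  have e5 : 1 / (2 * rate k) * (Real.log (1 / (1 / (Fintype.card ι : ℝ))) - 1)
      + ∑ _j : ι, 1 / (Fintype.card ι : ℝ) / (2 * rate k) = Real.log (Fintype.card ι) / (2 * rate k) := by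
    rw [one_div_one_div, Finset.sum_const, Finset.card_univ, nsmul_eq_mul]
    field_simp
    ring
  rw [e5] at h
  linarith

theorem pathSum_masterLosses {K : ℕ} (F : List (Fin K → ℝ) → (Fin K → ℝ) → ℝ) (L : List (ι → ℝ)) :
    pathSum F (masterLosses K L) = pathSum (fun L c => F (masterLosses K L)
      fun k => ∑ i, baseWeights k L i * c i) L := by
  induction L with
  | nil => rfl
  | cons c L ih => simp only [masterLosses, pathSum, ih]

theorem abs_sum_mul_le {w c : ι → ℝ} (hw : w ∈ stdSimplex ℝ ι) (hc : ∀ i, |c i| ≤ 1) :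
    |∑ i, w i * c i| ≤ 1 := by
  refine (Finset.abs_sum_le_sum_abs _ _).trans ?_
  rw [← hw.2]
  refine Finset.sum_le_sum fun i _ => ?_
  rw [abs_mul, abs_of_nonneg (hw.1 i)]
  exact mul_le_of_le_one_right (hw.1 i) (hc i)

theorem masterLosses_bound [Nonempty ι] {K : ℕ} : ∀ L : List (ι → ℝ), (∀ c ∈ L, ∀ i, |c i| ≤ 1) →
    ∀ m ∈ masterLosses K L, ∀ k, |m k| ≤ 1
  | [], _ => by simp [masterLosses]
  | c :: L, hL => by
    intro m hm k
    rcases List.mem_cons.1 hm with rfl | hm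
    · exact abs_sum_mul_le ⟨fun i => (baseWeights_pos k L i).le, sum_baseWeights k L⟩
        (hL c List.mem_cons_self)
    · exact masterLosses_bound L (fun c' hc' => hL c' (List.mem_cons_of_mem _ hc')) m hm k

/-- The initial point of the master. -/
noncomputable def masterInit (K : ℕ) (k : Fin K) : ℝ := rate k ^ 2 / ∑ j : Fin K, rate j ^ 2

theorem sum_rate_sq_pos {K : ℕ} (k : Fin K) : 0 < ∑ j : Fin K, rate j ^ 2 :=
  Finset.sum_pos (fun j _ => pow_pos (rate_pos j) 2) ⟨k, Finset.mem_univ k⟩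

theorem masterInit_pos {K : ℕ} (k : Fin K) : 0 < masterInit K k :=
  div_pos (pow_pos (rate_pos k) 2) (sum_rate_sq_pos k)

theorem sum_masterInit {K : ℕ} (hK : 0 < K) : ∑ k, masterInit K k = 1 := by
  unfold masterInit
  rw [← Finset.sum_div, div_self (sum_rate_sq_pos ⟨0, hK⟩).ne']

theorem masterWeights_pos {K : ℕ} (hK : 0 < K) (L : List (ι → ℝ)) (k : Fin K) :
    0 < masterWeights K L k :=
  have : Nonempty (Fin K) := ⟨⟨0, hK⟩⟩
  msmwc_pos rate_pos masterInit_pos (sum_masterInit hK) _ k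

theorem sum_masterWeights {K : ℕ} (hK : 0 < K) (L : List (ι → ℝ)) :
    ∑ k, masterWeights K L k = 1 :=
  have : Nonempty (Fin K) := ⟨⟨0, hK⟩⟩
  sum_msmwc rate_pos masterInit_pos (sum_masterInit hK) _

theorem expertWeights_mem_stdSimplex [Nonempty ι] {T : ℕ} (hT : 1 < T) (L : List (ι → ℝ)) :
    expertWeights T L ∈ stdSimplex ℝ ι := by
  have hK : 0 < Nat.clog 2 T := Nat.clog_pos (by norm_num) hT
  refine ⟨fun i => Finset.sum_nonneg fun k _ =>
    mul_nonneg (masterWeights_pos hK L k).le (baseWeights_pos k L i).le, ?_⟩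
  unfold expertWeights
  rw [Finset.sum_comm]
  simp_rw [← Finset.mul_sum, sum_baseWeights, mul_one]
  exact sum_masterWeights hK L

/-- Initial weights proportional to `η²` keep `∑ y_j / η_j = ∑ η_j / ∑ η_j²` bounded, by `(1/32) ·
64² = 128`, at the price of only `2 log (1/η_k)` in the logarithm. -/
theorem bregman_masterInit_le {K : ℕ} (hK : 0 < K) (k : Fin K) :
    bregman rate (Pi.single k 1) (masterInit K) ≤ 2 * Real.log (1 / rate k) / rate k + 128 := by
  have hr := rate_pos k
  have hS := sum_rate_sq_pos k
  have hS1 : ∑ j : Fin K, rate j ^ 2 ≤ 1 := by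
    refine le_trans (Finset.sum_le_sum fun j _ => ?_) ((sum_rate_le K).trans (by norm_num))
    nlinarith [rate_pos j, rate_le j]
  have hS2 : (1 / 64) ^ 2 ≤ ∑ j : Fin K, rate j ^ 2 := by
    have := Finset.single_le_sum (f := fun j : Fin K => rate j ^ 2)
      (fun j _ => sq_nonneg _) (Finset.mem_univ ⟨0, hK⟩)
    refine le_trans (le_of_eq ?_) this
    norm_num [rate]
  rw [bregman_single]
  have h1 : ∑ j, masterInit K j / rate j ≤ 128 := by
    have : ∀ j : Fin K, masterInit K j / rate j = rate j / ∑ j : Fin K, rate j ^ 2 := fun j => by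
      have := (rate_pos j).ne'
      unfold masterInit; field_simp
    simp_rw [this]
    rw [← Finset.sum_div, div_le_iff₀ hS]
    linarith [sum_rate_le K]
  have h2 : Real.log (1 / masterInit K k) ≤ 2 * Real.log (1 / rate k) := by
    rw [show (2 : ℝ) * Real.log (1 / rate k) = Real.log ((1 / rate k) ^ 2) by
      rw [Real.log_pow]; norm_num]
    refine Real.log_le_log (one_div_pos.2 (masterInit_pos k)) ?_
    unfold masterInit
    rw [one_div_div, one_div_pow]
    exact div_le_div_of_nonneg_right hS1 (by positivity)
  have h3 : 1 / rate k * (Real.log (1 / masterInit K k) - 1) ≤ 2 * Real.log (1 / rate k) / rate k := by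
    rw [one_div_mul_eq_div]
    exact div_le_div_of_nonneg_right (by linarith) hr.le
  linarith

theorem sq_sum_mul_le {w c : ι → ℝ} (hw : w ∈ stdSimplex ℝ ι) :
    (∑ i, w i * c i) ^ 2 ≤ ∑ i, w i * c i ^ 2 := by
  set m := ∑ i, w i * c i with hm
  have h : 0 ≤ ∑ i, w i * (c i - m) ^ 2 := Finset.sum_nonneg fun i _ => mul_nonneg (hw.1 i) (sq_nonneg _)
  have e : ∑ i, w i * (c i - m) ^ 2 = ∑ i, w i * c i ^ 2 - 2 * m * ∑ i, w i * c i + m ^ 2 * ∑ i, w i := by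
    simp_rw [Finset.mul_sum, ← Finset.sum_sub_distrib, ← Finset.sum_add_distrib]
    exact Finset.sum_congr rfl fun i _ => by ring
  rw [e, ← hm, hw.2] at h
  nlinarith

/-- Regret of the master against base algorithm `k` plus regret of that algorithm against `e`. What
the master's comparator is charged is paid by the surplus of the base algorithm, so the second-order
term involves the losses of `e` alone. -/
theorem expert_regret [Nonempty ι] {T : ℕ} (hT : 1 < T) (k : Fin (Nat.clog 2 T)) (e : ι)
    (L : List (ι → ℝ)) (hL : ∀ c ∈ L, ∀ i, |c i| ≤ 1) :
    pathSum (fun L c => ∑ i, expertWeights T L i * c i - c e) L ≤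
      (Real.log (Fintype.card ι) / 2 + 2 * Real.log (1 / rate k)) / rate k + 128
        + 64 * rate k * pathSum (fun _ c => c e ^ 2) L := by
  classical
  have hK : 0 < Nat.clog 2 T := Nat.clog_pos (by norm_num) hT
  have : Nonempty (Fin (Nat.clog 2 T)) := ⟨⟨0, hK⟩⟩
  have hr := rate_pos k
  have hb := base_regret k e L hL
  have hm := msmwc_regret rate_pos masterInit_pos (sum_masterInit hK) (single_mem_stdSimplex ℝ k)
    (masterLosses (Nat.clog 2 T) L) fun m hm j => by
      have := masterLosses_bound L hL m hm j
      nlinarith [abs_nonneg (m j), rate_le j, rate_pos j]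
  have h0 := bregman_nonneg rate_pos (single_mem_stdSimplex ℝ k).1
    (msmwc_pos rate_pos masterInit_pos (sum_masterInit hK) (masterLosses (Nat.clog 2 T) L))
  have hi := bregman_masterInit_le hK k
  rw [pathSum_masterLosses] at hm
  have h1 : pathSum (fun L c => ∑ i, expertWeights T L i * c i - c e) L ≤
      pathSum (fun L c => (∑ i, baseWeights k L i * c i - c e
      + 56 * rate k * ∑ i, baseWeights k L i * c i ^ 2)) L +
      pathSum (fun L c => ∑ j, (msmwc rate (masterInit (Nat.clog 2 T)) (masterLosses (Nat.clog 2 T) L) j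
          - (Pi.single k 1 : Fin (Nat.clog 2 T) → ℝ) j) * (∑ i, baseWeights j L i * c i)
        - 32 * ∑ j, (Pi.single k 1 : Fin (Nat.clog 2 T) → ℝ) j * rate j
          * (∑ i, baseWeights j L i * c i) ^ 2
        + 28 * ∑ j, msmwc rate (masterInit (Nat.clog 2 T)) (masterLosses (Nat.clog 2 T) L) j * rate j
          * (∑ i, baseWeights j L i * c i) ^ 2) L := by
    rw [← pathSum_add]
    refine pathSum_le_pathSum _ fun c L _ => ?_
    have e2 : ∑ j, (Pi.single k 1 : Fin (Nat.clog 2 T) → ℝ) j * (∑ i, baseWeights j L i * c i) =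
        ∑ i, baseWeights k L i * c i := by simp [Pi.single_apply]
    have e3 : ∑ j, (Pi.single k 1 : Fin (Nat.clog 2 T) → ℝ) j * rate j
          * (∑ i, baseWeights j L i * c i) ^ 2 = rate k * (∑ i, baseWeights k L i * c i) ^ 2 := by
      simp [Pi.single_apply]
    have e4 : ∑ i, expertWeights T L i * c i =
        ∑ j, msmwc rate (masterInit (Nat.clog 2 T)) (masterLosses (Nat.clog 2 T) L) j * ∑ i, baseWeights j L i * c i := by
      unfold expertWeights
      simp_rw [Finset.sum_mul, Finset.mul_sum]
      rw [Finset.sum_comm]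
      exact Finset.sum_congr rfl fun j _ => Finset.sum_congr rfl fun i _ => mul_assoc _ _ _
    have h5 : 0 ≤ ∑ j, msmwc rate (masterInit (Nat.clog 2 T)) (masterLosses (Nat.clog 2 T) L) j * rate j
          * (∑ i, baseWeights j L i * c i) ^ 2 := Finset.sum_nonneg fun j _ =>
      mul_nonneg (mul_nonneg (masterWeights_pos hK L j).le (rate_pos j).le) (sq_nonneg _)
    -- By Jensen the charge `32 η_k (∑ w c)²` is at most `32 η_k ∑ w c²`, which the base surplus
    -- with factor `56` covers.
    have h6 := sq_sum_mul_le (c := c)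
      ⟨fun i => (baseWeights_pos k L i).le, sum_baseWeights k L⟩
    have h7 : 0 ≤ (∑ i, baseWeights k L i * c i) ^ 2 := sq_nonneg _
    simp only [sub_mul, Finset.sum_sub_distrib, e2, e3, e4]
    nlinarith
  have e6 : (Real.log (Fintype.card ι) / 2 + 2 * Real.log (1 / rate k)) / rate k =
      Real.log (Fintype.card ι) / (2 * rate k) + 2 * Real.log (1 / rate k) / rate k := by
    field_simp
  rw [e6]
  linarith

end ExpertRegret

end SwapRegret

namespace SwapRegret

/-! ### Feasibility of the linear program. -/

section Feasibility

open Classical in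
/-- The value of the constraint `ξ` of the pair `(r, b)` at the outcome `v`. -/
noncomputable def hval (γ : ℝ) (ξ : Xi) (r b v : ℝ) : ℝ :=
  match ξ with
  | Xi.pos2 => (if b + 2 * r < v then 1 else 0) - (1 / 2 - γ / (4 * r))
  | Xi.neg2 => (if v < b - 2 * r then 1 else 0) - (1 / 2 - γ / (4 * r))
  | Xi.pos1 => (1 / 2 - γ / (2 * r)) - (if b ≤ v then 1 else 0)
  | Xi.neg1 => (1 / 2 - γ / (2 * r)) - (if v ≤ b then 1 else 0)

theorem constraint_eq (γ : ℝ) (e : Expert γ) (θ : Theta γ) (v : unitInterval) [Decidable (θ = e.1)] :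
    constraint γ e θ v = if θ = e.1 then hval γ e.2 e.1.1.1 e.1.1.2 v else 0 := by
  obtain ⟨θ', ξ⟩ := e
  unfold constraint hval
  by_cases h : θ = θ'
  · subst h; cases ξ <;> simp
  · simp [h]

theorem sum_Xi (f : Xi → ℝ) : ∑ ξ, f ξ = f Xi.pos2 + f Xi.neg2 + f Xi.pos1 + f Xi.neg1 := by
  have : (Finset.univ : Finset Xi) = {Xi.pos2, Xi.neg2, Xi.pos1, Xi.neg1} := rfl
  rw [this, Finset.sum_insert (by decide), Finset.sum_insert (by decide),
    Finset.sum_insert (by decide), Finset.sum_singleton]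
  ring

theorem card_Xi : Fintype.card Xi = 4 := rfl

theorem mixture_eq (γ : ℝ) (w : Expert γ → ℝ) (θ : Theta γ) (v : unitInterval) :
    mixture γ w θ v = ∑ ξ, w (θ, ξ) * hval γ ξ θ.1.1 θ.1.2 v := by
  classical
  unfold mixture
  rw [Fintype.sum_prod_type, Finset.sum_eq_single θ]
  · simp [constraint_eq]
  · intro θ' _ h
    simp [constraint_eq, h.symm]
  · simp

theorem scale_mem {γ : ℝ} (hγ : 0 < γ) {r : ℝ} (hr : r ∈ scales γ) : γ ≤ r ∧ r ≤ 1 := by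
  obtain ⟨⟨i, rfl⟩, h1⟩ := (mem_scales hγ).1 hr
  exact ⟨le_mul_of_one_le_left hγ.le (one_le_pow₀ (by norm_num)), h1⟩

theorem bin_mem {r : ℝ} (hr : 0 < r) {b : ℝ} (hb : b ∈ bins r) : 0 ≤ b ∧ b ≤ 1 := by
  obtain ⟨⟨k, rfl⟩, h1⟩ := (mem_bins hr).1 hb
  exact ⟨by positivity, h1⟩

theorem abs_hval_le {γ r : ℝ} (hγ : 0 < γ) (hr : γ ≤ r) (ξ : Xi) (b v : ℝ) :
    |hval γ ξ r b v| ≤ 1 := by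
  have hr0 : 0 < r := hγ.trans_le hr
  have h1 : γ / (4 * r) ≤ 1 / 4 := by rw [div_le_div_iff₀ (by positivity) (by norm_num)]; linarith
  have h2 : γ / (2 * r) ≤ 1 / 2 := by rw [div_le_div_iff₀ (by positivity) (by norm_num)]; linarith
  have h3 : 0 < γ / (4 * r) := by positivity
  have h4 : 0 < γ / (2 * r) := by positivity
  rw [abs_le]
  cases ξ <;> simp only [hval] <;> split_ifs <;> constructor <;> linarith

/-- The sum of two of the constraints is bounded away from zero. -/
theorem hval_pos2_add_pos1 {γ r b v : ℝ} (hr : 0 < r) :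
    hval γ Xi.pos2 r b v + hval γ Xi.pos1 r b v ≤ -(γ / (4 * r)) := by
  have h : γ / (2 * r) = γ / (4 * r) + γ / (4 * r) := by field_simp; ring
  simp only [hval, h]
  by_cases h1 : b + 2 * r < v
  · have h2 : b ≤ v := by linarith
    simp only [h1, h2, if_true]; linarith
  · simp only [h1, if_false]
    split_ifs <;> linarith

variable {α : Type*} [Fintype α]

open Classical in
/-- The weight of the points with property `p`. -/
noncomputable def wt (φ x : α → ℝ) (p : ℝ → Prop) : ℝ := ∑ a, φ a * if p (x a) then 1 else 0

theorem wt_mono {φ x : α → ℝ} (hφ : ∀ a, 0 ≤ φ a) {p q : ℝ → Prop}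
    (h : ∀ a, p (x a) → q (x a)) : wt φ x p ≤ wt φ x q := by
  refine Finset.sum_le_sum fun a _ => mul_le_mul_of_nonneg_left ?_ (hφ a)
  by_cases hp : p (x a)
  · simp [hp, h a hp]
  · simp only [hp, if_false]; split_ifs <;> norm_num

theorem exists_of_wt_pos {φ x : α → ℝ} {p : ℝ → Prop} (h : 0 < wt φ x p) : ∃ a, p (x a) := by
  by_contra! hn
  simp [wt, hn] at h

/-- If every pair fails, then at every scale some bin has nearly half of the weight on each side,
with a deficit that halves from scale to scale; since scales are at most `1`, this cannot continue.
Outcomes slightly above `1` are allowed because test points may exceed `1` by less than `γ`. -/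
theorem exists_good_pair {γ : ℝ} (hγ : 0 < γ) (hγ1 : γ ≤ 1) {φ x : α → ℝ} (hφ : ∀ a, 0 ≤ φ a)
    (hx0 : ∀ a, 0 ≤ x a) (hx1 : ∀ a, x a < 1 + γ) :
    ∃ θ : Theta γ, ∀ ξ, ∑ a, φ a * hval γ ξ θ.1.1 θ.1.2 (x a) ≤ 0 := by
  classical
  set Φ := ∑ a, φ a with hΦ
  have hΦ0 : 0 ≤ Φ := Finset.sum_nonneg fun a _ => hφ a
  by_contra! hbad
  -- At `r = 2 ^ i γ` the constraints `±1` have threshold `thr i`, and the constraints `±2` have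
  -- threshold `thr (i + 1)`, which is the `±1` threshold of the next scale. This match makes the
  -- induction on the scale work.
  set thr : ℕ → ℝ := fun i => 1 / 2 - 1 / (2 * 2 ^ i) with hthr
  have hthr0 : ∀ i, 0 ≤ thr i := fun i => by
    have : 1 / (2 * (2 : ℝ) ^ i) ≤ 1 / 2 :=
      one_div_le_one_div_of_le (by norm_num)
        (by have : (1 : ℝ) ≤ 2 ^ i := one_le_pow₀ (by norm_num)
            linarith)
    simp only [hthr]; linarith
  have hthrmono : ∀ i, thr i ≤ thr (i + 1) := fun i => by
    simp only [hthr]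
    have : 1 / (2 * (2 : ℝ) ^ (i + 1)) ≤ 1 / (2 * 2 ^ i) :=
      one_div_le_one_div_of_le (by positivity) (by rw [pow_succ]; nlinarith [pow_pos (two_pos : (0:ℝ) < 2) i])
    linarith
  have e4 : ∀ i : ℕ, 1 / 2 - γ / (4 * (2 ^ i * γ)) = thr (i + 1) := fun i => by
    simp only [hthr, pow_succ]; field_simp; ring
  have e2 : ∀ i : ℕ, 1 / 2 - γ / (2 * (2 ^ i * γ)) = thr i := fun i => by
    simp only [hthr]; field_simp
  have split : ∀ (p : ℝ → Prop) (c : ℝ), ∑ a, φ a * ((if p (x a) then 1 else 0) - c) =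
      wt φ x p - c * Φ := fun p c => by
    simp only [mul_sub, Finset.sum_sub_distrib, wt, hΦ, Finset.mul_sum]
    congr 1
    exact Finset.sum_congr rfl fun a _ => mul_comm _ _
  have split' : ∀ (p : ℝ → Prop) (c : ℝ), ∑ a, φ a * (c - (if p (x a) then 1 else 0)) =
      c * Φ - wt φ x p := fun p c => by
    simp only [mul_sub, Finset.sum_sub_distrib, wt, hΦ, Finset.mul_sum]
    congr 1
    exact Finset.sum_congr rfl fun a _ => mul_comm _ _
  set mid : ℕ → ℝ → Prop := fun i b => thr i * Φ ≤ wt φ x (fun v => b ≤ v) ∧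
    thr i * Φ ≤ wt φ x (fun v => v ≤ b) with hmid
  have main : ∀ i : ℕ, 2 ^ i * γ ≤ 1 ∧ ∃ b ∈ bins (2 ^ i * γ), mid i b := by
    intro i
    induction i with
    | zero =>
      refine ⟨by simpa using hγ1, 0, (mem_bins (by positivity)).2 ⟨⟨0, by simp⟩, by norm_num⟩, ?_⟩
      have : thr 0 = 0 := by simp [hthr]
      have hw : ∀ p, 0 ≤ wt φ x p := fun p => Finset.sum_nonneg fun a _ =>
        mul_nonneg (hφ a) (by split_ifs <;> norm_num)
      exact ⟨by simpa [this] using hw _, by simpa [this] using hw _⟩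
    | succ i ih =>
      obtain ⟨hr1, b0, hb0, hm0⟩ := ih
      set r : ℝ := 2 ^ i * γ with hr
      have hrpos : 0 < r := by positivity
      have hrγ : γ ≤ r := le_mul_of_one_le_left hγ.le (one_le_pow₀ (by norm_num))
      have fail : ∀ b ∈ bins r, mid i b → thr (i + 1) * Φ < wt φ x (fun v => b + 2 * r < v) ∨
          thr (i + 1) * Φ < wt φ x (fun v => v < b - 2 * r) := by
        intro b hb hm
        by_contra! hno
        obtain ⟨ξ, hξ⟩ := hbad ⟨(r, b), mem_Theta.2 ⟨(mem_scales hγ).2 ⟨⟨i, rfl⟩, hr1⟩, hb⟩⟩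
        have e4' : 1 / 2 - γ / (4 * r) = thr (i + 1) := e4 i
        have e2' : 1 / 2 - γ / (2 * r) = thr i := e2 i
        cases ξ
        · have e := split (fun v => b + 2 * r < v) (thr (i + 1))
          simp only [hval, e4', e] at hξ
          linarith [hno.1]
        · have e := split (fun v => v < b - 2 * r) (thr (i + 1))
          simp only [hval, e4', e] at hξ
          linarith [hno.2]
        · have e := split' (fun v => b ≤ v) (thr i)
          simp only [hval, e2', e] at hξ
          linarith [hm.1]
        · have e := split' (fun v => v ≤ b) (thr i)
          simp only [hval, e2', e] at hξ
          linarith [hm.2]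
      have right : ∀ b ∈ bins r, mid i b → thr (i + 1) * Φ < wt φ x (fun v => b + 2 * r < v) →
          b + r ∈ bins r ∧ mid i (b + r) := by
        intro b hb hm hf
        obtain ⟨a, ha⟩ := exists_of_wt_pos ((mul_nonneg (hthr0 _) hΦ0).trans_lt hf)
        obtain ⟨⟨k, hk⟩, -⟩ := (mem_bins hrpos).1 hb
        refine ⟨(mem_bins hrpos).2 ⟨⟨k + 1, by rw [hk]; push_cast; ring⟩, ?_⟩, ?_, ?_⟩
        · linarith [hx1 a]
        · exact ((mul_le_mul_of_nonneg_right (hthrmono i) hΦ0).trans hf.le).trans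
            (wt_mono hφ fun a h => by linarith)
        · exact hm.2.trans (wt_mono hφ fun a h => by linarith)
      have left : ∀ b ∈ bins r, mid i b → thr (i + 1) * Φ < wt φ x (fun v => v < b - 2 * r) →
          b - r ∈ bins r ∧ mid i (b - r) := by
        intro b hb hm hf
        obtain ⟨a, ha⟩ := exists_of_wt_pos ((mul_nonneg (hthr0 _) hΦ0).trans_lt hf)
        obtain ⟨⟨k, hk⟩, hb1⟩ := (mem_bins hrpos).1 hb
        have hk0 : k ≠ 0 := by
          rintro rfl
          have := hx0 a
          simp at hk
          linarith
        obtain ⟨k, rfl⟩ := Nat.exists_eq_succ_of_ne_zero hk0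
        refine ⟨(mem_bins hrpos).2 ⟨⟨k, by rw [hk]; push_cast; ring⟩, by linarith⟩, ?_, ?_⟩
        · exact hm.1.trans (wt_mono hφ fun a h => by linarith)
        · exact ((mul_le_mul_of_nonneg_right (hthrmono i) hΦ0).trans hf.le).trans
            (wt_mono hφ fun a h => by linarith)
      -- A bin failing to the right could be moved one step right and would stay admissible, so the
      -- rightmost admissible bin fails to the left.
      obtain ⟨b1, hb1, hmax⟩ := ((bins r).filter (mid i)).exists_max_image id
        ⟨b0, Finset.mem_filter.2 ⟨hb0, hm0⟩⟩
      rw [Finset.mem_filter] at hb1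
      have hleft1 : thr (i + 1) * Φ < wt φ x (fun v => v < b1 - 2 * r) := by
        refine (fail b1 hb1.1 hb1.2).resolve_left fun h => ?_
        have := hmax (b1 + r) (Finset.mem_filter.2 (right b1 hb1.1 hb1.2 h))
        simp only [id] at this
        linarith
      -- The leftmost bin failing to the left has an admissible left neighbour, which by minimality
      -- fails to the right. Hence much weight lies below `b2 - 2r` and much above `b2 + r`.
      obtain ⟨b2, hb2, hmin⟩ := (((bins r).filter (mid i)).filter
        fun b => thr (i + 1) * Φ < wt φ x (fun v => v < b - 2 * r)).exists_min_image id
        ⟨b1, Finset.mem_filter.2 ⟨Finset.mem_filter.2 hb1, hleft1⟩⟩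
      rw [Finset.mem_filter, Finset.mem_filter] at hb2
      obtain ⟨hb3, hm3⟩ := left b2 hb2.1.1 hb2.1.2 hb2.2
      have hright3 : thr (i + 1) * Φ < wt φ x (fun v => b2 - r + 2 * r < v) := by
        refine (fail _ hb3 hm3).resolve_right fun h => ?_
        have := hmin (b2 - r) (Finset.mem_filter.2 ⟨Finset.mem_filter.2 ⟨hb3, hm3⟩, h⟩)
        simp only [id] at this
        linarith
      obtain ⟨a, ha⟩ := exists_of_wt_pos ((mul_nonneg (hthr0 _) hΦ0).trans_lt hright3)
      obtain ⟨a', ha'⟩ := exists_of_wt_pos ((mul_nonneg (hthr0 _) hΦ0).trans_lt hb2.2)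
      have h2r : 2 ^ (i + 1) * γ = 2 * r := by rw [hr, pow_succ]; ring
      -- There are outcomes more than `3r` apart, while all lie in `[0, 1 + γ)` and `γ ≤ r`.
      have h2r1 : 2 * r ≤ 1 := by linarith [hx1 a, hx0 a']
      rw [h2r]
      refine ⟨h2r1, ?_⟩
      have hmidx : ∀ y, b2 - r ≤ y → y ≤ b2 → mid (i + 1) y := fun y h1 h2 =>
        ⟨hright3.le.trans (wt_mono hφ fun a h => by linarith),
          hb2.2.le.trans (wt_mono hφ fun a h => by linarith)⟩
      obtain ⟨⟨k, hk⟩, hb31⟩ := (mem_bins hrpos).1 hb3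
      obtain ⟨-, hb21⟩ := (mem_bins hrpos).1 hb2.1.1
      -- One of the consecutive multiples `b2 - r`, `b2` of `r` is a bin of the scale `2r`, and both
      -- are admissible there.
      rcases Nat.even_or_odd' k with ⟨j, rfl | rfl⟩
      · refine ⟨b2 - r, (mem_bins (by positivity)).2 ⟨⟨j, by rw [hk]; push_cast; ring⟩, hb31⟩,
          hmidx _ le_rfl (by linarith)⟩
      · refine ⟨b2, (mem_bins (by positivity)).2 ⟨⟨j + 1, ?_⟩, hb21⟩,
          hmidx _ (by linarith) le_rfl⟩
        push_cast at hk ⊢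
        linarith
  obtain ⟨i, hi⟩ := pow_unbounded_of_one_lt (1 / γ) (one_lt_two : (1 : ℝ) < 2)
  have := (main i).1
  rw [div_lt_iff₀ hγ] at hi
  linarith

/-- A convex combination of rows is nonpositive if every nonnegative combination of columns has a
nonpositive entry. -/
theorem exists_simplex_sum_nonpos {β : Type*} [Fintype β] [Nonempty β] (A : β → α → ℝ)
    (h : ∀ φ : α → ℝ, (∀ a, 0 ≤ φ a) → ∃ b, ∑ a, φ a * A b a ≤ 0) :
    ∃ κ ∈ stdSimplex ℝ β, ∀ a, ∑ b, κ b * A b a ≤ 0 := by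
  classical
  set f : (β → ℝ) → ℝ := fun κ => ∑ a, (max 0 (∑ b, κ b * A b a)) ^ 2 with hf
  obtain ⟨κ, hκ, hmin⟩ := (isCompact_stdSimplex ℝ β).exists_isMinOn
    ⟨_, single_mem_stdSimplex ℝ (Classical.arbitrary β)⟩ (f := f) (by simp only [hf]; fun_prop)
  refine ⟨κ, hκ, ?_⟩
  set φ : α → ℝ := fun a => max 0 (∑ b, κ b * A b a) with hφ
  obtain ⟨b0, hb0⟩ := h φ fun a => le_max_left _ _
  -- `κ` minimizes the sum of squared positive parts. Testing against a step of length `s` toward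
  -- the vertex `b0`, the cross term is nonpositive by the choice of `b0`, leaving only a term of
  -- order `s²`.
  have hle : ∀ s ∈ Set.Icc (0 : ℝ) 1,
      f κ ≤ (1 - s) ^ 2 * f κ + s ^ 2 * ∑ a, A b0 a ^ 2 := by
    intro s hs
    have hmem : (1 - s) • κ + s • (Pi.single b0 1 : β → ℝ) ∈ stdSimplex ℝ β :=
      (convex_stdSimplex ℝ β) hκ (single_mem_stdSimplex ℝ b0) (by linarith [hs.2]) hs.1 (by ring)
    refine (isMinOn_iff.1 hmin _ hmem).trans ?_
    have h1 : ∀ a, (max 0 (∑ b, ((1 - s) • κ + s • (Pi.single b0 1 : β → ℝ)) b * A b a)) ^ 2 ≤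
        ((1 - s) * φ a + s * A b0 a) ^ 2 := by
      intro a
      have e : ∑ b, ((1 - s) • κ + s • (Pi.single b0 1 : β → ℝ)) b * A b a =
          (1 - s) * (∑ b, κ b * A b a) + s * A b0 a := by
        simp only [Pi.add_apply, Pi.smul_apply, smul_eq_mul, add_mul, Finset.sum_add_distrib,
          Finset.mul_sum, mul_assoc]
        congr 1
        simp [Pi.single_apply]
      rw [e]
      have h2 : (1 - s) * (∑ b, κ b * A b a) ≤ (1 - s) * φ a :=
        mul_le_mul_of_nonneg_left (le_max_right _ _) (by linarith [hs.2])
      rcases le_total ((1 - s) * (∑ b, κ b * A b a) + s * A b0 a) 0 with h3 | h3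
      · rw [max_eq_left h3]; nlinarith [sq_nonneg ((1 - s) * φ a + s * A b0 a)]
      · rw [max_eq_right h3]; exact pow_le_pow_left₀ h3 (by linarith) 2
    refine (Finset.sum_le_sum fun a _ => h1 a).trans ?_
    have e : ∑ a, ((1 - s) * φ a + s * A b0 a) ^ 2 = (1 - s) ^ 2 * ∑ a, φ a ^ 2
        + 2 * s * (1 - s) * ∑ a, φ a * A b0 a + s ^ 2 * ∑ a, A b0 a ^ 2 := by
      simp only [Finset.mul_sum, ← Finset.sum_add_distrib]
      exact Finset.sum_congr rfl fun a _ => by ring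
    rw [e]
    have : 2 * s * (1 - s) * ∑ a, φ a * A b0 a ≤ 0 :=
      mul_nonpos_of_nonneg_of_nonpos (by nlinarith [hs.1, hs.2]) hb0
    linarith
  have hf0 : 0 ≤ f κ := Finset.sum_nonneg fun a _ => sq_nonneg _
  set B := ∑ a, A b0 a ^ 2 with hB
  have hB0 : 0 ≤ B := Finset.sum_nonneg fun a _ => sq_nonneg _
  have hfz : f κ ≤ 0 := by
    by_contra! hpos
    -- This is the minimizer of `(1 - s)² f κ + s² B`; its value is below `f κ` if `f κ > 0`.
    set s := f κ / (f κ + B) with hs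
    have hd : 0 < f κ + B := by linarith
    have hs0 : 0 < s := div_pos hpos hd
    have hs1 : s ≤ 1 := div_le_one_of_le₀ (by linarith) hd.le
    have := hle s ⟨hs0.le, hs1⟩
    have e : s * (f κ + B) = f κ := div_mul_cancel₀ _ hd.ne'
    nlinarith [mul_pos hs0 hpos]
  intro a
  have h1 := (Finset.sum_eq_zero_iff_of_nonneg fun a _ => sq_nonneg _).1
    (le_antisymm hfz hf0) a (Finset.mem_univ a)
  have h2 : max 0 (∑ b, κ b * A b a) = 0 := by simpa using h1
  exact max_eq_left_iff.1 h2

/-- The test point with index `c`: a multiple of `γ`, or the midpoint between two multiples. -/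
noncomputable def testPoint (γ : ℝ) (x y : ℕ) : ℝ := y * γ + x * γ / 2

/-- All thresholds `b` and `b ± 2r` are integer multiples of `γ`, so only the position of `v`
relative to these multiples matters: on one of them, or strictly between two. -/
theorem exists_testPoint {γ : ℝ} (hγ : 0 < γ) {v : ℝ} (hv0 : 0 ≤ v) :
    ∃ x < 2, ∃ y : ℕ, y * γ ≤ v ∧ ∀ r b, (r, b) ∈ Theta γ → ∀ ξ,
      hval γ ξ r b v = hval γ ξ r b (testPoint γ x y) := by
  have hy := Nat.floor_le (div_nonneg hv0 hγ.le)
  have hy' := Nat.lt_floor_add_one (v / γ)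
  set y := ⌊v / γ⌋₊
  rw [le_div_iff₀ hγ] at hy
  rw [div_lt_iff₀ hγ] at hy'
  obtain ⟨x, hx2, hcmp⟩ : ∃ x < 2, ∀ j : ℤ, ((j : ℝ) * γ < v ↔ (j : ℝ) * γ < testPoint γ x y) ∧
      (v < (j : ℝ) * γ ↔ testPoint γ x y < (j : ℝ) * γ) := by
    rcases hy.eq_or_lt with h | h
    · refine ⟨0, by norm_num, fun j => ?_⟩
      have : testPoint γ 0 y = v := by simp [testPoint, h]
      rw [this]
      simp
    · refine ⟨1, by norm_num, fun j => ?_⟩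
      have e : testPoint γ 1 y = y * γ + γ / 2 := by simp [testPoint]
      rw [e]
      rcases le_or_gt j y with hj | hj
      · have hj' : (j : ℝ) * γ ≤ y * γ := mul_le_mul_of_nonneg_right (by exact_mod_cast hj) hγ.le
        constructor <;> constructor <;> intro h' <;> linarith
      · have hj' : ((y : ℝ) + 1) * γ ≤ j * γ :=
          mul_le_mul_of_nonneg_right (by exact_mod_cast hj) hγ.le
        have hj'' : (y : ℝ) * γ + γ ≤ j * γ := by linarith
        constructor <;> constructor <;> intro h' <;> linarith
  refine ⟨x, hx2, y, hy, fun r b hθ ξ => ?_⟩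
  obtain ⟨hr, hb⟩ := mem_Theta.1 hθ
  obtain ⟨⟨i, rfl⟩, -⟩ := (mem_scales hγ).1 hr
  obtain ⟨⟨k, rfl⟩, -⟩ := (mem_bins (by positivity)).1 hb
  have e1 : (k : ℝ) * (2 ^ i * γ) + 2 * (2 ^ i * γ) = ((k * 2 ^ i + 2 * 2 ^ i : ℤ) : ℝ) * γ := by
    push_cast; ring
  have e2 : (k : ℝ) * (2 ^ i * γ) - 2 * (2 ^ i * γ) = ((k * 2 ^ i - 2 * 2 ^ i : ℤ) : ℝ) * γ := by
    push_cast; ring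
  have e3 : (k : ℝ) * (2 ^ i * γ) = ((k * 2 ^ i : ℤ) : ℝ) * γ := by push_cast; ring
  cases ξ
  · simp only [hval, e1, (hcmp _).1]
  · simp only [hval, e2, (hcmp _).2]
  · simp only [hval, ← not_lt, e3, (hcmp _).2]
  · simp only [hval, ← not_lt, e3, (hcmp _).1]

end Feasibility

end SwapRegret

namespace SwapRegret

open MeasureTheory

/-! ### Elementary bounds on `γ`. -/

section Parameters

variable {T : ℕ} {δ : ℝ}

theorem one_lt_log_natCast (hT : 2 < T) : 1 < Real.log T := by
  rw [Real.lt_log_iff_exp_lt (by positivity)]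
  have h1 := Real.exp_one_lt_three
  have h2 : (3 : ℝ) ≤ T := by exact_mod_cast hT
  linarith

theorem log_natCast_le_log_inv (hT : 2 < T) (hδ : 0 < δ) (hδT : δ ≤ 1 / T) :
    Real.log T ≤ Real.log (1 / δ) := by
  have hT0 : (0 : ℝ) < T := by positivity
  refine Real.log_le_log hT0 ?_
  rw [le_div_iff₀ hδ]
  rw [le_div_iff₀ hT0] at hδT
  linarith

theorem gammaParam_le_one (T : ℕ) (δ : ℝ) : gammaParam T δ ≤ 1 := min_le_left _ _

theorem one_le_gammaParam_sq_mul (hT : 2 < T) (hδ : 0 < δ) (hδT : δ ≤ 1 / T) :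
    1 ≤ gammaParam T δ ^ 2 * T := by
  have h1 := one_lt_log_natCast hT
  have h2 := log_natCast_le_log_inv hT hδ hδT
  have hT1 : (1 : ℝ) ≤ T := by exact_mod_cast (by omega : 1 ≤ T)
  unfold gammaParam
  rcases min_choice 1 (Real.sqrt (Real.log T * Real.log (1 / δ) / T)) with h | h
  · rw [h]; linarith
  · have hnn : 0 ≤ Real.log T * Real.log (1 / δ) / T := by
      have : 0 ≤ Real.log (1 / δ) := by linarith
      positivity
    rw [h, Real.sq_sqrt hnn, div_mul_cancel₀ _ (by positivity)]
    nlinarith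

theorem gammaParam_pos (hT : 2 < T) (hδ : 0 < δ) (hδT : δ ≤ 1 / T) : 0 < gammaParam T δ := by
  have h := one_le_gammaParam_sq_mul hT hδ hδT
  have h0 : 0 ≤ gammaParam T δ := le_min zero_le_one (Real.sqrt_nonneg _)
  rcases h0.eq_or_lt with h1 | h1
  · rw [← h1] at h; norm_num at h
  · exact h1

/-- With this bound all scale and bin indices are below `T`, so that `T × T` arrays can hold every
pair and every test point. -/
theorem one_lt_gammaParam_mul (hT : 2 < T) (hδ : 0 < δ) (hδT : δ ≤ 1 / T) :
    1 < gammaParam T δ * T := by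
  have h := one_le_gammaParam_sq_mul hT hδ hδT
  have h0 := gammaParam_pos hT hδ hδT
  have hT1 : (2 : ℝ) < T := by exact_mod_cast hT
  by_contra! hc
  have h3 : gammaParam T δ ^ 2 * T ≤ gammaParam T δ := by nlinarith
  have h4 := gammaParam_le_one T δ
  have h5 : gammaParam T δ = 1 := le_antisymm h4 (by linarith)
  rw [h5] at hc
  linarith

end Parameters

/-! ### The algorithm in exact arithmetic. -/

section Exact

variable {γ : ℝ}

theorem Theta_nonempty (hγ : 0 < γ) (hγ1 : γ ≤ 1) : Nonempty (Theta γ) :=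
  ⟨⟨(γ, 0), mem_Theta.2 ⟨(mem_scales hγ).2 ⟨⟨0, by simp⟩, hγ1⟩,
    (mem_bins hγ).2 ⟨⟨0, by simp⟩, zero_le_one⟩⟩⟩⟩

/-- The probability mass function with the given real probabilities. -/
noncomputable def pmfOfSimplex {β : Type*} [Fintype β] (κ : β → ℝ) (h : κ ∈ stdSimplex ℝ β) : PMF β :=
  PMF.ofFintype (fun b => ENNReal.ofReal (κ b)) (by
    rw [← ENNReal.ofReal_sum_of_nonneg fun b _ => h.1 b, h.2, ENNReal.ofReal_one])

theorem pmfOfSimplex_toReal {β : Type*} [Fintype β] (κ : β → ℝ) (h : κ ∈ stdSimplex ℝ β) (b : β) :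
    (pmfOfSimplex κ h b).toReal = κ b := by
  simp [pmfOfSimplex, ENNReal.toReal_ofReal (h.1 b)]

theorem sum_toReal_pmf {β : Type*} [Fintype β] (κ : PMF β) : ∑ b, (κ b).toReal = 1 := by
  rw [← ENNReal.toReal_sum fun b _ => κ.apply_ne_top b]
  have := κ.tsum_coe
  rw [tsum_fintype] at this
  rw [this, ENNReal.toReal_one]

/-- The mixture of the constraints of a pair at a real outcome. -/
noncomputable def hmix (γ : ℝ) (w : Expert γ → ℝ) (θ : Theta γ) (v : ℝ) : ℝ :=
  ∑ ξ, w (θ, ξ) * hval γ ξ θ.1.1 θ.1.2 v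

theorem exists_hmix_nonpos {α : Type*} [Fintype α] (hγ : 0 < γ) (hγ1 : γ ≤ 1)
    {w : Expert γ → ℝ} (hw : ∀ e, 0 ≤ w e) {φ x : α → ℝ} (hφ : ∀ a, 0 ≤ φ a)
    (hx0 : ∀ a, 0 ≤ x a) (hx1 : ∀ a, x a < 1 + γ) :
    ∃ θ : Theta γ, ∑ a, φ a * hmix γ w θ (x a) ≤ 0 := by
  obtain ⟨θ, hθ⟩ := exists_good_pair hγ hγ1 hφ hx0 hx1
  refine ⟨θ, ?_⟩
  have : ∑ a, φ a * hmix γ w θ (x a) =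
      ∑ ξ, w (θ, ξ) * ∑ a, φ a * hval γ ξ θ.1.1 θ.1.2 (x a) := by
    simp only [hmix, Finset.mul_sum]
    rw [Finset.sum_comm]
    exact Finset.sum_congr rfl fun ξ _ => Finset.sum_congr rfl fun a _ => by ring
  rw [this]
  exact Finset.sum_nonpos fun ξ _ => mul_nonpos_of_nonneg_of_nonpos (hw _) (hθ ξ)

theorem testPoint_nonneg (hγ : 0 < γ) (x y : ℕ) : 0 ≤ testPoint γ x y := by
  unfold testPoint; positivity

theorem testPoint_lt (hγ : 0 < γ) {x y : ℕ} (hx : x < 2) (hy : y * γ ≤ 1) :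
    testPoint γ x y < 1 + γ := by
  have : (x : ℝ) ≤ 1 := by exact_mod_cast (by omega : x ≤ 1)
  unfold testPoint
  nlinarith

/-- The linear program is feasible. -/
theorem exists_lp_solution (hγ : 0 < γ) (hγ1 : γ ≤ 1) {w : Expert γ → ℝ} (hw : ∀ e, 0 ≤ w e) :
    ∃ κ : PMF (Theta γ), ∀ v : unitInterval, ∑ θ, (κ θ).toReal * mixture γ w θ v ≤ 0 := by
  have := Theta_nonempty hγ hγ1
  obtain ⟨κ, hκ, h⟩ := exists_simplex_sum_nonpos (α := Fin 2 × Fin (⌊1 / γ⌋₊ + 1))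
    (fun θ a => hmix γ w θ (testPoint γ a.1 a.2)) fun φ hφ =>
      exists_hmix_nonpos hγ hγ1 hw hφ (fun a => testPoint_nonneg hγ _ _) fun a => by
        refine testPoint_lt hγ a.1.2 ?_
        rw [← le_div_iff₀ hγ]
        exact (Nat.cast_le.2 (Nat.lt_succ_iff.1 a.2.2)).trans (Nat.floor_le (by positivity))
  refine ⟨pmfOfSimplex κ hκ, fun v => ?_⟩
  obtain ⟨x, hx, y, hy, hxy⟩ := exists_testPoint hγ v.2.1
  have hy1 : y < ⌊1 / γ⌋₊ + 1 := by
    rw [Nat.lt_succ_iff]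
    refine Nat.le_floor ?_
    rw [le_div_iff₀ hγ]
    exact hy.trans v.2.2
  refine le_trans (le_of_eq (Finset.sum_congr rfl fun θ _ => ?_)) (h (⟨x, hx⟩, ⟨y, hy1⟩))
  rw [pmfOfSimplex_toReal, mixture_eq, hmix]
  congr 1
  exact Finset.sum_congr rfl fun ξ _ => by rw [hxy _ _ θ.2]

open Classical in
/-- A solution of the linear program. -/
noncomputable def lpSolution [Nonempty (Theta γ)] (w : Expert γ → ℝ) : PMF (Theta γ) :=
  if h : ∃ κ : PMF (Theta γ), ∀ v : unitInterval, ∑ θ, (κ θ).toReal * mixture γ w θ v ≤ 0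
    then h.choose else PMF.pure (Classical.arbitrary _)

/-- The rewards of the algorithm in exact arithmetic. -/
noncomputable def exactRewards [Nonempty (Theta γ)] (T : ℕ) : List Loss → List (Expert γ → ℝ)
  | [] => []
  | ℓ :: H => reward γ (lpSolution (expertWeights T ((exactRewards T H).map fun u => -u))) ℓ
      :: exactRewards T H

/-- Weights depend on earlier rewards and rewards on the chosen distributions. The recursion
`exactRewards` unties this circle before the predictor is defined. -/
theorem exists_follows_zero (hγ : 0 < γ) (hγ1 : γ ≤ 1) {T : ℕ} (hT : 1 < T) :
    ∃ P : Predictor γ, P.Follows T 0 := by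
  have := Theta_nonempty hγ hγ1
  have : Nonempty (Expert γ) := ⟨(Classical.arbitrary _, Xi.pos1)⟩
  let P : Predictor γ :=
    { weights := fun H => expertWeights T ((exactRewards T H).map fun u => -u)
      dist := fun H => lpSolution (expertWeights T ((exactRewards T H).map fun u => -u)) }
  have hP : ∀ H, P.rewards H = exactRewards T H := by
    intro H
    induction H with
    | nil => rfl
    | cons ℓ H ih => simp only [Predictor.rewards, exactRewards, ih, P]
  refine ⟨P, fun H _ => ⟨expertWeights_mem_stdSimplex hT _, ?_, ?_⟩⟩
  · rw [hP]; simp [P]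
  · have h := exists_lp_solution hγ hγ1 (w := P.weights H)
      (expertWeights_mem_stdSimplex hT _).1
    intro v
    change ∑ θ, (lpSolution (P.weights H) θ).toReal * _ ≤ 0
    rw [lpSolution, dif_pos h]
    exact h.choose_spec v

end Exact

/-! ### Cumulative rewards of the constraints. -/

section Rewards

variable {γ : ℝ}

theorem measurable_hval (γ : ℝ) (ξ : Xi) (r b : ℝ) :
    Measurable fun v : unitInterval => hval γ ξ r b v := by
  have hc : Measurable fun v : unitInterval => (v : ℝ) := measurable_subtype_coe
  cases ξ <;> simp only [hval]
  · exact (Measurable.ite (measurableSet_lt measurable_const hc) measurable_const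
      measurable_const).sub measurable_const
  · exact (Measurable.ite (measurableSet_lt hc measurable_const) measurable_const
      measurable_const).sub measurable_const
  · exact measurable_const.sub (Measurable.ite (measurableSet_le measurable_const hc)
      measurable_const measurable_const)
  · exact measurable_const.sub (Measurable.ite (measurableSet_le hc measurable_const)
      measurable_const measurable_const)

theorem integrable_hval (hγ : 0 < γ) {r : ℝ} (hr : γ ≤ r) (ξ : Xi) (b : ℝ) (ℓ : Loss) :
    Integrable (fun v : unitInterval => hval γ ξ r b v) (vDist ℓ : Measure unitInterval) :=
  Integrable.of_bound (measurable_hval γ ξ r b).aestronglyMeasurable 1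
    (Filter.Eventually.of_forall fun v => abs_hval_le hγ hr ξ b v)

/-- The mean of the constraint `ξ` of the pair `(r, b)` under the distribution of a loss. -/
noncomputable def hmean (γ : ℝ) (ξ : Xi) (r b : ℝ) (ℓ : Loss) : ℝ :=
  ∫ v : unitInterval, hval γ ξ r b v ∂(vDist ℓ : Measure unitInterval)

theorem abs_hmean_le (hγ : 0 < γ) {r : ℝ} (hr : γ ≤ r) (ξ : Xi) (b : ℝ) (ℓ : Loss) :
    |hmean γ ξ r b ℓ| ≤ 1 := by
  have := norm_integral_le_of_norm_le_const (μ := (vDist ℓ : Measure unitInterval)) (C := 1)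
    (f := fun v : unitInterval => hval γ ξ r b v)
    (Filter.Eventually.of_forall fun v : unitInterval => abs_hval_le hγ hr ξ b v)
  simpa [hmean] using this

theorem reward_eq (κ : PMF (Theta γ)) (ℓ : Loss) (e : Expert γ) :
    reward γ κ ℓ e = (κ e.1).toReal * hmean γ e.2 e.1.1.1 e.1.1.2 ℓ := by
  classical
  unfold reward
  rw [Finset.sum_eq_single e.1]
  · simp only [constraint_eq, if_true]; rfl
  · intro θ _ h
    simp [constraint_eq, h]
  · simp

theorem Theta_scale_ge (hγ : 0 < γ) (θ : Theta γ) : γ ≤ θ.1.1 :=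
  (scale_mem hγ (mem_Theta.1 θ.2).1).1

theorem toReal_pmf_le_one {β : Type*} (κ : PMF β) (b : β) : (κ b).toReal ≤ 1 :=
  ENNReal.toReal_le_of_le_ofReal zero_le_one (by simpa using κ.coe_le_one b)

theorem abs_reward_le (hγ : 0 < γ) (κ : PMF (Theta γ)) (ℓ : Loss) (e : Expert γ) :
    |reward γ κ ℓ e| ≤ (κ e.1).toReal := by
  rw [reward_eq, abs_mul, abs_of_nonneg ENNReal.toReal_nonneg]
  exact mul_le_of_le_one_right ENNReal.toReal_nonneg (abs_hmean_le hγ (Theta_scale_ge hγ _) _ _ _)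

/-- The linear program holds for each outcome `v`, hence on average over the distribution of
whatever loss the adversary reveals. -/
theorem sum_weights_mul_reward_nonpos (hγ : 0 < γ) {w : Expert γ → ℝ} {κ : PMF (Theta γ)}
    (h : ∀ v : unitInterval, ∑ θ, (κ θ).toReal * mixture γ w θ v ≤ 0) (ℓ : Loss) :
    ∑ e, w e * reward γ κ ℓ e ≤ 0 := by
  have h1 : ∑ e, w e * reward γ κ ℓ e = ∫ v : unitInterval,
      ∑ θ, (κ θ).toReal * mixture γ w θ v ∂(vDist ℓ : Measure unitInterval) := by
    simp only [reward_eq, mixture_eq, hmean]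
    rw [integral_finsetSum]
    · rw [Fintype.sum_prod_type]
      refine Finset.sum_congr rfl fun θ _ => ?_
      rw [integral_const_mul, integral_finsetSum, Finset.mul_sum]
      · refine Finset.sum_congr rfl fun ξ _ => ?_
        rw [integral_const_mul]; ring
      · exact fun ξ _ => (integrable_hval hγ (Theta_scale_ge hγ θ) _ _ _).const_mul _
    · exact fun θ _ => (integrable_finsetSum _ fun ξ _ =>
        (integrable_hval hγ (Theta_scale_ge hγ θ) _ _ _).const_mul _).const_mul _
  rw [h1]
  exact integral_nonpos h

theorem pathSum_rewards (P : Predictor γ) (F : List (Expert γ → ℝ) → (Expert γ → ℝ) → ℝ)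
    (H : List Loss) :
    pathSum F ((P.rewards H).map fun u => -u) =
      pathSum (fun H ℓ => F ((P.rewards H).map fun u => -u) (-reward γ (P.dist H) ℓ)) H := by
  induction H with
  | nil => rfl
  | cons ℓ H ih => simp only [Predictor.rewards, List.map_cons, pathSum, ih]

theorem mem_rewards (P : Predictor γ) (H : List Loss) {u : Expert γ → ℝ} (hu : u ∈ P.rewards H) :
    ∃ H' ℓ, u = reward γ (P.dist H') ℓ := by
  induction H with
  | nil => simp [Predictor.rewards] at hu
  | cons ℓ H ih =>
    rcases List.mem_cons.1 hu with rfl | h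
    · exact ⟨H, ℓ, rfl⟩
    · exact ih h

/-- The cumulative reward of an expert is small. -/
theorem sum_reward_le (hγ : 0 < γ) (hγ1 : γ ≤ 1) {T : ℕ} (hT : 1 < T) {ε : ℝ}
    (hε : ε ≤ 1 / T) {P : Predictor γ} (hP : P.Follows T ε) (k : Fin (Nat.clog 2 T))
    (e : Expert γ) (H : List Loss) (hH : H.length ≤ T) :
    pathSum (fun H ℓ => reward γ (P.dist H) ℓ e) H ≤
      (Real.log (Fintype.card (Expert γ)) / 2 + 2 * Real.log (1 / rate k)) / rate k + 129
        + 64 * rate k * pathSum (fun H _ => (P.dist H e.1).toReal) H := by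
  have := Theta_nonempty hγ hγ1
  have : Nonempty (Expert γ) := ⟨(Classical.arbitrary _, Xi.pos1)⟩
  have hreg := expert_regret hT k e ((P.rewards H).map fun u => -u) fun c hc i => by
    obtain ⟨u, hu, rfl⟩ := List.mem_map.1 hc
    obtain ⟨H', ℓ, rfl⟩ := mem_rewards P H hu
    rw [Pi.neg_apply, abs_neg]
    exact (abs_reward_le hγ _ _ _).trans (toReal_pmf_le_one _ _)
  rw [pathSum_rewards, pathSum_rewards] at hreg
  have h1 : pathSum (fun H ℓ => reward γ (P.dist H) ℓ e) H ≤
      pathSum (fun H ℓ => (∑ i, expertWeights T ((P.rewards H).map fun u => -u) i *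
        (-reward γ (P.dist H) ℓ) i - (-reward γ (P.dist H) ℓ) e) + ε) H := by
    refine pathSum_le_pathSum _ fun ℓ H' hs => ?_
    have hlen : H'.length < T := by
      have := hs.length_le
      simp only [List.length_cons] at this
      omega
    obtain ⟨-, h2, h3⟩ := hP H' hlen
    have h4 := sum_weights_mul_reward_nonpos hγ h3 ℓ
    have h5 : ∑ i, expertWeights T ((P.rewards H').map fun u => -u) i * reward γ (P.dist H') ℓ i
        ≤ ∑ i, P.weights H' i * reward γ (P.dist H') ℓ i + ε := by
      rw [← sub_le_iff_le_add', ← Finset.sum_sub_distrib]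
      refine le_trans (Finset.sum_le_sum fun i _ => ?_) h2
      rw [← sub_mul]
      refine (le_abs_self _).trans ?_
      rw [abs_mul, abs_sub_comm]
      exact mul_le_of_le_one_right (abs_nonneg _)
        ((abs_reward_le hγ _ _ _).trans (toReal_pmf_le_one _ _))
    simp only [Pi.neg_apply, mul_neg, Finset.sum_neg_distrib]
    linarith
  rw [pathSum_add, pathSum_const] at h1
  -- The inaccuracy of the weights costs at most `ε ≤ 1/T` per round, which accounts for `129`
  -- instead of `128`.
  have h6 : (H.length : ℝ) * ε ≤ 1 := by
    have hT0 : (0 : ℝ) < T := by positivity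
    calc (H.length : ℝ) * ε ≤ H.length * (1 / T) := by gcongr
      _ ≤ T * (1 / T) := by gcongr
      _ = 1 := by field_simp
  -- A reward is at most the probability of its pair in absolute value, so its square is too. The
  -- second-order term is thus controlled by the expected number of draws of the pair.
  have h7 : pathSum (fun H ℓ => (-reward γ (P.dist H) ℓ) e ^ 2) H ≤
      pathSum (fun H _ => (P.dist H e.1).toReal) H := by
    refine pathSum_le_pathSum _ fun ℓ H' _ => ?_
    have h8 := abs_reward_le hγ (P.dist H') ℓ e
    have h9 := toReal_pmf_le_one (P.dist H') e.1
    rw [Pi.neg_apply, neg_sq, ← sq_abs]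
    nlinarith [abs_nonneg (reward γ (P.dist H') ℓ e)]
  have h8 : 64 * rate k * pathSum (fun H ℓ => (-reward γ (P.dist H) ℓ) e ^ 2) H ≤
      64 * rate k * pathSum (fun H _ => (P.dist H e.1).toReal) H :=
    mul_le_mul_of_nonneg_left h7 (by have := rate_pos k; positivity)
  linarith

end Rewards

end SwapRegret

namespace SwapRegret

open MeasureTheory

/-! ### Random play and exponential supermartingales. -/

section Play

variable {γ : ℝ}

/-- The prediction of a pair, paired with the loss. -/
noncomputable def forget (x : Theta γ × Loss) : unitInterval × Loss :=
  (Set.projIcc 0 1 (zero_le_one' ℝ) x.1.1.2, x.2)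

/-- The law of the transcript of pairs `(r, b)` and losses. -/
noncomputable def playTheta (P : Predictor γ) (adversary : Transcript → Loss) :
    ℕ → PMF (List (Theta γ × Loss))
  | 0 => PMF.pure []
  | n + 1 => (playTheta P adversary n).bind fun h =>
      (P.dist (h.map Prod.snd)).map fun θ => (θ, adversary (h.map forget)) :: h

/-- The same prediction can arise from pairs at different scales. The analysis is done on
transcripts that remember the pair, and transferred by this identity. -/
theorem play_eq_map (P : Predictor γ) (adversary : Transcript → Loss) (n : ℕ) :
    play P.strategy adversary n = (playTheta P adversary n).map (List.map forget) := by
  induction n with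
  | zero => simp [play, playTheta, PMF.pure_map]
  | succ n ih =>
    rw [play, playTheta, ih, PMF.bind_map, PMF.map_bind]
    congr 1
    funext h
    have : (h.map forget).map Prod.snd = h.map Prod.snd := by simp [forget]
    simp only [Function.comp_apply, Predictor.strategy, this, PMF.map_comp]
    rfl

theorem length_of_mem_support (P : Predictor γ) (adversary : Transcript → Loss) (n : ℕ) :
    ∀ h ∈ (playTheta P adversary n).support, h.length = n := by
  induction n with
  | zero => intro h hh; simp [playTheta] at hh; simp [hh]
  | succ n ih =>
    intro h hh
    simp only [playTheta, PMF.mem_support_bind_iff, PMF.mem_support_map_iff] at hh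
    obtain ⟨h', hh', θ, -, rfl⟩ := hh
    simp [ih h' hh']

theorem tsum_bind_mul {α β : Type*} (p : PMF α) (f : α → PMF β) (g : β → ENNReal) :
    ∑' b, p.bind f b * g b = ∑' a, p a * ∑' b, f a b * g b := by
  simp_rw [PMF.bind_apply, ← ENNReal.tsum_mul_right, ← ENNReal.tsum_mul_left]
  rw [ENNReal.tsum_comm]
  simp_rw [mul_assoc]

theorem tsum_map_mul {α β : Type*} (p : PMF α) (f : α → β) (g : β → ENNReal) :
    ∑' b, p.map f b * g b = ∑' a, p a * g (f a) := by
  classical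
  rw [← PMF.bind_pure_comp, tsum_bind_mul]
  congr 1
  funext a
  congr 1
  rw [tsum_eq_single (f a)]
  · simp
  · intro b hb
    simp [hb]

/-- A Bernstein-type bound for one Bernoulli draw of mean `κ`: use `exp x ≤ 1 + x + x²` for `|x| ≤
1`, then `1 + z ≤ exp z`. The compensator is proportional to `κ` and not to a constant per round,
which rarely drawn pairs need. -/
theorem exp_mul_step_le {κ l a : ℝ} (hκ0 : 0 ≤ κ) (hl0 : 0 ≤ l) (hl1 : l ≤ 1)
    (ha : |a| ≤ 1) :
    κ * Real.exp (l * (1 - κ) * a - l ^ 2 * κ) + (1 - κ) * Real.exp (l * (0 - κ) * a - l ^ 2 * κ)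
      ≤ 1 := by
  have hla : |l * a| ≤ 1 := by
    rw [abs_mul, abs_of_nonneg hl0]; nlinarith [abs_nonneg a]
  have h1 := le_of_abs_le (Real.abs_exp_sub_one_sub_id_le hla)
  have h2 : (l * a) ^ 2 ≤ l ^ 2 := by
    rw [mul_pow, ← sq_abs a]
    exact mul_le_of_le_one_right (sq_nonneg _) (pow_le_one₀ (abs_nonneg _) ha)
  have e1 : l * (1 - κ) * a - l ^ 2 * κ = -(κ * (l * a + l ^ 2)) + l * a := by ring
  have e2 : l * (0 - κ) * a - l ^ 2 * κ = -(κ * (l * a + l ^ 2)) := by ring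
  rw [e1, e2, Real.exp_add]
  have h3 : κ * Real.exp (l * a) + (1 - κ) ≤ Real.exp (κ * (l * a + l ^ 2)) := by
    have := Real.add_one_le_exp (κ * (l * a + l ^ 2))
    nlinarith
  calc κ * (Real.exp (-(κ * (l * a + l ^ 2))) * Real.exp (l * a))
        + (1 - κ) * Real.exp (-(κ * (l * a + l ^ 2)))
      = Real.exp (-(κ * (l * a + l ^ 2))) * (κ * Real.exp (l * a) + (1 - κ)) := by ring
    _ ≤ Real.exp (-(κ * (l * a + l ^ 2))) * Real.exp (κ * (l * a + l ^ 2)) :=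
        mul_le_mul_of_nonneg_left h3 (Real.exp_pos _).le
    _ = 1 := by rw [← Real.exp_add]; simp

open Classical in
/-- The indicator of the event that `x` uses the pair `θ`. -/
noncomputable def hit (θ : Theta γ) (x : Theta γ × Loss) : ℝ := if x.1 = θ then 1 else 0

/-- The probability that the predictor gives to a pair after a transcript. -/
noncomputable def prob (P : Predictor γ) (θ : Theta γ) (h : List (Theta γ × Loss)) : ℝ :=
  (P.dist (h.map Prod.snd) θ).toReal

theorem sum_pmf_exp_le_one (κ : PMF (Theta γ)) (θ : Theta γ) {l a : ℝ} (hl0 : 0 ≤ l) (hl1 : l ≤ 1)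
    (ha : |a| ≤ 1) (ℓ : Loss) :
    ∑ θ', (κ θ').toReal *
      Real.exp (l * (hit θ (θ', ℓ) - (κ θ).toReal) * a - l ^ 2 * (κ θ).toReal) ≤ 1 := by
  classical
  have h1 := sum_toReal_pmf κ
  rw [← Finset.add_sum_erase _ _ (Finset.mem_univ θ)] at h1 ⊢
  have h2 : ∀ θ' ∈ Finset.univ.erase θ, (κ θ').toReal *
      Real.exp (l * (hit θ (θ', ℓ) - (κ θ).toReal) * a - l ^ 2 * (κ θ).toReal) =
      (κ θ').toReal * Real.exp (l * (0 - (κ θ).toReal) * a - l ^ 2 * (κ θ).toReal) := by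
    intro θ' hθ'
    simp [hit, Finset.ne_of_mem_erase hθ']
  rw [Finset.sum_congr rfl h2, ← Finset.sum_mul]
  have h3 : ∑ θ' ∈ Finset.univ.erase θ, (κ θ').toReal = 1 - (κ θ).toReal := by linarith
  rw [h3]
  have := exp_mul_step_le (κ := (κ θ).toReal) ENNReal.toReal_nonneg hl0 hl1 ha
  simpa [hit] using this

/-- An exponential supermartingale. -/
theorem tsum_exp_le_one (P : Predictor γ) (adversary : Transcript → Loss) (θ : Theta γ) {l : ℝ}
    (hl0 : 0 ≤ l) (hl1 : l ≤ 1) {a : Loss → ℝ} (ha : ∀ ℓ, |a ℓ| ≤ 1) (n : ℕ) :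
    ∑' h, playTheta P adversary n h * ENNReal.ofReal (Real.exp (pathSum (fun h x =>
      l * (hit θ x - prob P θ h) * a x.2 - l ^ 2 * prob P θ h) h)) ≤ 1 := by
  induction n with
  | zero =>
    simp only [playTheta]
    rw [tsum_eq_single []]
    · simp [pathSum]
    · intro b hb; simp [hb]
  | succ n ih =>
    rw [playTheta, tsum_bind_mul]
    refine le_trans (ENNReal.tsum_le_tsum fun h => ?_) ih
    refine mul_le_mul_right ?_ _
    rw [tsum_map_mul, tsum_fintype]
    simp only [pathSum, Real.exp_add]
    have := sum_pmf_exp_le_one (P.dist (h.map Prod.snd)) θ hl0 hl1 (ha (adversary (h.map forget)))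
      (adversary (h.map forget))
    set E := Real.exp (pathSum (fun h x =>
      l * (hit θ x - prob P θ h) * a x.2 - l ^ 2 * prob P θ h) h) with hE
    calc _ = ENNReal.ofReal (∑ θ', (P.dist (h.map Prod.snd) θ').toReal *
          (Real.exp (l * (hit θ (θ', adversary (h.map forget)) - prob P θ h)
            * a (adversary (h.map forget)) - l ^ 2 * prob P θ h) * E)) := by
          rw [ENNReal.ofReal_sum_of_nonneg fun θ' _ => by positivity]
          refine Finset.sum_congr rfl fun θ' _ => ?_
          rw [ENNReal.ofReal_mul ENNReal.toReal_nonneg,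
            ENNReal.ofReal_toReal (PMF.apply_ne_top _ _)]
      _ ≤ ENNReal.ofReal E := by
          refine ENNReal.ofReal_le_ofReal ?_
          simp_rw [← mul_assoc]
          rw [← Finset.sum_mul]
          exact mul_le_of_le_one_left (Real.exp_pos _).le this

theorem pathSum_map {α β : Type*} (f : α → β) (F : List β → β → ℝ) (h : List α) :
    pathSum F (h.map f) = pathSum (fun h x => F (h.map f) (f x)) h := by
  induction h with
  | nil => rfl
  | cons x h ih => simp only [List.map_cons, pathSum, ih]

theorem sum_map_eq_pathSum {α : Type*} (f : α → ℝ) (h : List α) :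
    (h.map f).sum = pathSum (fun _ x => f x) h := by
  induction h with
  | nil => rfl
  | cons x h ih => simp only [List.map_cons, List.sum_cons, pathSum, ih]

theorem pathSum_nonneg {α : Type*} {F : List α → α → ℝ} (hF : ∀ L c, 0 ≤ F L c) (L : List α) :
    0 ≤ pathSum F L := by
  induction L with
  | nil => exact le_rfl
  | cons c L ih => exact add_nonneg (hF _ _) ih

theorem sum_hit (x : Theta γ × Loss) : ∑ θ, hit θ x = 1 := by
  classical
  simp [hit]

theorem sum_pathSum_hit (h : List (Theta γ × Loss)) :
    ∑ θ, pathSum (fun _ x => hit θ x) h = h.length := by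
  rw [← pathSum_finset_sum]
  simp only [sum_hit]
  rw [pathSum_const, mul_one]

theorem sum_pathSum_prob (P : Predictor γ) (h : List (Theta γ × Loss)) :
    ∑ θ, pathSum (fun h _ => prob P θ h) h = h.length := by
  rw [← pathSum_finset_sum]
  simp only [prob, sum_toReal_pmf]
  rw [pathSum_const, mul_one]

theorem Loss.sub_le_one (ℓ : Loss) (p q : unitInterval) : ℓ.toFun p - ℓ.toFun q ≤ 1 := by
  refine (le_abs_self _).trans ((ℓ.abs_sub_le p q).trans ?_)
  rw [abs_le]
  constructor <;> linarith [p.2.1, p.2.2, q.2.1, q.2.2]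

theorem swapRegret_le_length (h : Transcript) : swapRegret h ≤ h.length := by
  refine ciSup_le fun σ => ?_
  rw [sum_map_eq_pathSum]
  refine (pathSum_le_pathSum (F' := fun _ _ => (1 : ℝ)) h fun c L _ => ?_).trans
    (by rw [pathSum_const, mul_one])
  exact c.2.sub_le_one _ _

end Play

/-! ### Deviations expressed through the constraints. -/

section Pointwise

/-- Split `[b, q]` at `b + 2r` and, by convexity of `|· - v|`, bound the decrease on each piece
through the right derivative at its left end. The brackets are exactly `1 - 2·1[v ≤ b]` and `2·1[v >
b + 2r] - 1`: the offsets of the constraints become a loss `γ/r` on the near piece and a gain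
`γ/(2r)` on the far piece. -/
theorem abs_sub_abs_le_right (γ : ℝ) {r b q v : ℝ} (hr : 0 < r) (hq : b ≤ q) :
    |b - v| - |q - v| ≤ min (q - b) (2 * r) * (2 * hval γ Xi.neg1 r b v + γ / r)
      + max (q - b - 2 * r) 0 * (2 * hval γ Xi.pos2 r b v - γ / (2 * r)) := by
  have e1 : γ / (2 * r) = γ / r / 2 := by field_simp
  have e2 : γ / (4 * r) = γ / r / 4 := by field_simp
  simp only [hval, e1, e2]
  generalize γ / r = g
  rcases le_total (q - b) (2 * r) with h | h
  · rw [min_eq_left h, max_eq_right (by linarith)]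
    by_cases hv : v ≤ b
    · simp only [hv, if_true]
      rw [abs_of_nonneg (by linarith), abs_of_nonneg (by linarith)]
      linarith
    · simp only [hv, if_false]
      have := abs_abs_sub_abs_le_abs_sub (b - v) (q - v)
      have h2 := le_of_abs_le this
      rw [show b - v - (q - v) = -(q - b) by ring, abs_neg, abs_of_nonneg (sub_nonneg.2 hq)] at h2
      linarith
  · rw [min_eq_right h, max_eq_left (by linarith)]
    by_cases hv : v ≤ b
    · have hv2 : ¬ b + 2 * r < v := by linarith
      simp only [hv, hv2, if_true, if_false]
      rw [abs_of_nonneg (by linarith), abs_of_nonneg (by linarith)]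
      linarith
    · by_cases hv2 : b + 2 * r < v
      · simp only [hv, hv2, if_true, if_false]
        have := abs_abs_sub_abs_le_abs_sub (b - v) (q - v)
        have h2 := le_of_abs_le this
        rw [show b - v - (q - v) = -(q - b) by ring, abs_neg, abs_of_nonneg (sub_nonneg.2 hq)] at h2
        linarith
      · simp only [hv, hv2, if_false]
        rw [abs_of_nonpos (by linarith), abs_of_nonneg (by linarith)]
        linarith

theorem abs_sub_abs_le_left (γ : ℝ) {r b q v : ℝ} (hr : 0 < r) (hq : q ≤ b) :
    |b - v| - |q - v| ≤ min (b - q) (2 * r) * (2 * hval γ Xi.pos1 r b v + γ / r)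
      + max (b - q - 2 * r) 0 * (2 * hval γ Xi.neg2 r b v - γ / (2 * r)) := by
  have h := abs_sub_abs_le_right γ (r := r) (b := -b) (q := -q) (v := -v) hr (by linarith)
  have e1 : hval γ Xi.neg1 r (-b) (-v) = hval γ Xi.pos1 r b v := by
    simp only [hval, neg_le_neg_iff]
  have e2 : hval γ Xi.pos2 r (-b) (-v) = hval γ Xi.neg2 r b v := by
    have : -b + 2 * r < -v ↔ v < b - 2 * r := by constructor <;> intro h <;> linarith
    simp only [hval, this]
  rw [e1, e2, show -b - -v = -(b - v) by ring, show -q - -v = -(q - v) by ring, abs_neg, abs_neg,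
    show -q - -b = b - q by ring] at h
  exact h

variable {γ : ℝ}

theorem Loss.sub_eq_integral (ℓ : Loss) (p q : unitInterval) : ℓ.toFun p - ℓ.toFun q =
    ∫ v : unitInterval, (|(p : ℝ) - v| - |(q : ℝ) - v|) ∂(vDist ℓ : Measure unitInterval) := by
  rw [integral_sub (integrable_abs_sub _ _) (integrable_abs_sub _ _), ℓ.toFun_eq p, ℓ.toFun_eq q]
  simp only [meanAbs]
  ring

theorem integral_affine_hval (hγ : 0 < γ) {r : ℝ} (hr : γ ≤ r) (ξ ξ' : Xi) (b s e c d : ℝ)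
    (ℓ : Loss) :
    ∫ v : unitInterval, (s * (2 * hval γ ξ r b v + c) + e * (2 * hval γ ξ' r b v - d))
      ∂(vDist ℓ : Measure unitInterval) =
      s * (2 * hmean γ ξ r b ℓ + c) + e * (2 * hmean γ ξ' r b ℓ - d) := by
  have h1 := (integrable_hval hγ hr ξ b ℓ).const_mul 2
  have h2 := (integrable_hval hγ hr ξ' b ℓ).const_mul 2
  have h1' : Integrable (fun v : unitInterval => s * (2 * hval γ ξ r b v + c))
      (vDist ℓ : Measure unitInterval) := (h1.add (integrable_const _)).const_mul _
  have h2' : Integrable (fun v : unitInterval => e * (2 * hval γ ξ' r b v - d))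
      (vDist ℓ : Measure unitInterval) := (h2.sub (integrable_const _)).const_mul _
  rw [integral_add h1' h2', integral_const_mul, integral_const_mul,
    integral_add h1 (integrable_const _), integral_sub h2 (integrable_const _),
    integral_const_mul, integral_const_mul]
  simp [hmean]

theorem integrable_affine_hval (hγ : 0 < γ) {r : ℝ} (hr : γ ≤ r) (ξ ξ' : Xi) (b s e c d : ℝ)
    (ℓ : Loss) :
    Integrable (fun v : unitInterval =>
      s * (2 * hval γ ξ r b v + c) + e * (2 * hval γ ξ' r b v - d))
      (vDist ℓ : Measure unitInterval) :=
  ((((integrable_hval hγ hr ξ b ℓ).const_mul 2).add (integrable_const _)).const_mul _).add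
    ((((integrable_hval hγ hr ξ' b ℓ).const_mul 2).sub (integrable_const _)).const_mul _)

/-- The loss difference of two predictions in terms of the constraints. -/
theorem Loss.exists_sub_le (hγ : 0 < γ) {r : ℝ} (hr : γ ≤ r) (b q : unitInterval) :
    ∃ ξ ξ' : Xi, ∃ s e : ℝ, 0 ≤ s ∧ s ≤ 2 * r ∧ 0 ≤ e ∧ e ≤ 1 ∧ ∀ ℓ : Loss,
      ℓ.toFun b - ℓ.toFun q ≤ s * (2 * hmean γ ξ r b ℓ + γ / r)
        + e * (2 * hmean γ ξ' r b ℓ - γ / (2 * r)) := by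
  have hr0 : 0 < r := hγ.trans_le hr
  have hb0 := b.2.1
  have hb1 := b.2.2
  have hq0 := q.2.1
  have hq1 := q.2.2
  rcases le_total (b : ℝ) q with h | h
  · refine ⟨Xi.neg1, Xi.pos2, min ((q : ℝ) - b) (2 * r), max ((q : ℝ) - b - 2 * r) 0,
      le_min (by linarith) (by linarith), min_le_right _ _, le_max_right _ _,
      max_le (by linarith) zero_le_one, fun ℓ => ?_⟩
    rw [ℓ.sub_eq_integral, ← integral_affine_hval hγ hr]
    exact integral_mono ((integrable_abs_sub _ _).sub (integrable_abs_sub _ _))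
      (integrable_affine_hval hγ hr _ _ _ _ _ _ _ _) fun v => abs_sub_abs_le_right γ hr0 h
  · refine ⟨Xi.pos1, Xi.neg2, min ((b : ℝ) - q) (2 * r), max ((b : ℝ) - q - 2 * r) 0,
      le_min (by linarith) (by linarith), min_le_right _ _, le_max_right _ _,
      max_le (by linarith) zero_le_one, fun ℓ => ?_⟩
    rw [ℓ.sub_eq_integral, ← integral_affine_hval hγ hr]
    exact integral_mono ((integrable_abs_sub _ _).sub (integrable_abs_sub _ _))
      (integrable_affine_hval hγ hr _ _ _ _ _ _ _ _) fun v => abs_sub_abs_le_left γ hr0 h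

end Pointwise

end SwapRegret

namespace SwapRegret

open MeasureTheory

/-! ### Counting scales, bins and pairs. -/

section Counting

variable {γ : ℝ} {T : ℕ}

theorem pow_lt_of_scale (hγ : 0 < γ) {m : ℕ} (hm : (m : ℝ) < γ * T) {i : ℕ}
    (hi : 2 ^ i * γ ≤ 1) : m * 2 ^ i < T := by
  have h : (m * 2 ^ i : ℝ) * γ < T * γ := by
    calc (m * 2 ^ i : ℝ) * γ = m * (2 ^ i * γ) := by ring
      _ ≤ m * 1 := by gcongr
      _ < T * γ := by linarith
  exact_mod_cast lt_of_mul_lt_mul_right h hγ.le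

theorem scale_index_lt (hγ : 0 < γ) (hγT : 1 < γ * T) {i : ℕ} (hi : 2 ^ i * γ ≤ 1) : i < T := by
  have := pow_lt_of_scale (m := 1) hγ (by simpa using hγT) hi
  have h2 : i < 2 ^ i := Nat.lt_two_pow_self
  omega

theorem bin_index_lt (hγ : 0 < γ) (hγT : 1 < γ * T) {i k : ℕ} (hk : k * (2 ^ i * γ) ≤ 1) :
    k < T := by
  have h : (k : ℝ) * γ < T * γ := by
    calc (k : ℝ) * γ ≤ k * (2 ^ i * γ) := by
          gcongr; exact le_mul_of_one_le_left hγ.le (one_le_pow₀ (by norm_num))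
      _ < T * γ := by linarith
  exact_mod_cast lt_of_mul_lt_mul_right h hγ.le

theorem card_Theta_le (hγ : 0 < γ) (hγT : 1 < γ * T) : (Theta γ).card ≤ T ^ 2 := by
  have hsub : Theta γ ⊆ (Finset.range T ×ˢ Finset.range T).image
      fun p : ℕ × ℕ => ((2 : ℝ) ^ p.1 * γ, (p.2 : ℝ) * (2 ^ p.1 * γ)) := by
    rintro ⟨r, b⟩ h
    obtain ⟨hr, hb⟩ := mem_Theta.1 h
    obtain ⟨⟨i, rfl⟩, hi⟩ := (mem_scales hγ).1 hr
    obtain ⟨⟨k, rfl⟩, hk⟩ := (mem_bins (by positivity)).1 hb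
    exact Finset.mem_image.2 ⟨(i, k), Finset.mem_product.2
      ⟨Finset.mem_range.2 (scale_index_lt hγ hγT hi),
        Finset.mem_range.2 (bin_index_lt hγ hγT hk)⟩, rfl⟩
  refine (Finset.card_le_card hsub).trans (Finset.card_image_le.trans ?_)
  simp [sq]

theorem card_scales_le (hγ : 0 < γ) (hγT : 1 < γ * T) (hT : 2 < T) :
    ((scales γ).card : ℝ) ≤ 3 * Real.log T := by
  have hsub : scales γ ⊆ (Finset.range (Nat.log 2 T + 1)).image fun i : ℕ => (2 : ℝ) ^ i * γ := by
    intro r hr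
    obtain ⟨⟨i, rfl⟩, hi⟩ := (mem_scales hγ).1 hr
    refine Finset.mem_image.2 ⟨i, Finset.mem_range.2 (Nat.lt_succ_of_le ?_), rfl⟩
    have := pow_lt_of_scale (m := 1) hγ (by simpa using hγT) hi
    exact Nat.le_log_of_pow_le (by norm_num) (by omega)
  have h1 : (scales γ).card ≤ Nat.log 2 T + 1 :=
    (Finset.card_le_card hsub).trans (Finset.card_image_le.trans (by simp))
  have h2 : ((scales γ).card : ℝ) ≤ Nat.log 2 T + 1 := by exact_mod_cast h1
  have h3 : (Nat.log 2 T : ℝ) * Real.log 2 ≤ Real.log T := by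
    rw [← Real.log_pow]
    refine Real.log_le_log (by positivity) ?_
    exact_mod_cast Nat.pow_log_le_self 2 (by omega)
  have h4 := Real.log_two_gt_d9
  have h5 := one_lt_log_natCast hT
  have h6 : (0 : ℝ) ≤ Nat.log 2 T := by positivity
  nlinarith

/-- The at most `1/r + 1` bins of the scale `r` contribute at most `1 + r ≤ 2`, so each of the
`O(log T)` scales costs the same. This is why pair errors proportional to `r` are affordable. -/
theorem sum_scale_le (hγ : 0 < γ) (hγT : 1 < γ * T) (hT : 2 < T) :
    ∑ θ : Theta γ, θ.1.1 ≤ 6 * Real.log T := by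
  rw [Finset.sum_coe_sort (Theta γ) fun θ => θ.1, Theta, Finset.sum_biUnion]
  · have h : ∀ r ∈ scales γ, ∑ θ ∈ (bins r).image (fun b => (r, b)), θ.1 ≤ 2 := by
      intro r hr
      have hr0 := hγ.trans_le (scale_mem hγ hr).1
      rw [Finset.sum_image (by intro a _ b _ h; exact (Prod.mk.inj h).2)]
      simp only [Finset.sum_const, nsmul_eq_mul]
      have h1 : (bins r).card ≤ ⌊1 / r⌋₊ + 1 :=
        (Finset.card_filter_le _ _).trans (Finset.card_image_le.trans (by simp))
      have h2 : ((bins r).card : ℝ) ≤ ⌊1 / r⌋₊ + 1 := by exact_mod_cast h1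
      have h3 : (⌊1 / r⌋₊ : ℝ) ≤ 1 / r := Nat.floor_le (by positivity)
      calc ((bins r).card : ℝ) * r ≤ (1 / r + 1) * r := by gcongr; linarith
        _ = 1 + r := by field_simp
        _ ≤ 2 := by linarith [(scale_mem hγ hr).2]
    refine (Finset.sum_le_sum h).trans ?_
    have := card_scales_le hγ hγT hT
    simp only [Finset.sum_const, nsmul_eq_mul]
    linarith
  · intro r _ r' _ hne
    refine Finset.disjoint_left.2 fun θ h1 h2 => hne ?_
    obtain ⟨b, -, rfl⟩ := Finset.mem_image.1 h1
    obtain ⟨b', -, h⟩ := Finset.mem_image.1 h2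
    exact (Prod.mk.inj h).1.symm

end Counting

/-! ### Regret on the event that all concentration tests succeed. -/

section Deterministic

variable {γ : ℝ} {T : ℕ}

/-- The constraint means of a pair as a statistic of the loss; `none` is the negated count. -/
noncomputable def testStat (θ : Theta γ) : Option Xi → Loss → ℝ
  | none, _ => -1
  | some ξ, ℓ => hmean γ ξ θ.1.1 θ.1.2 ℓ

/-- The parameter of the exponential supermartingale. -/
noncomputable def testRate (θ : Theta γ) : Option Xi → ℝ
  | none => 1 / 2
  | some _ => γ / (16 * θ.1.1)

/-- The exponent of the supermartingale of a test. -/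
noncomputable def testExp (P : Predictor γ) (θ : Theta γ) (τ : Option Xi)
    (h : List (Theta γ × Loss)) : ℝ :=
  pathSum (fun h x => testRate θ τ * (hit θ x - prob P θ h) * testStat θ τ x.2
    - testRate θ τ ^ 2 * prob P θ h) h

theorem testExp_eq (P : Predictor γ) (θ : Theta γ) (τ : Option Xi) (h : List (Theta γ × Loss)) :
    testExp P θ τ h = testRate θ τ * pathSum (fun _ x => hit θ x * testStat θ τ x.2) h
      - testRate θ τ * pathSum (fun h x => prob P θ h * testStat θ τ x.2) h
      - testRate θ τ ^ 2 * pathSum (fun h _ => prob P θ h) h := by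
  unfold testExp
  simp only [← pathSum_const_mul, ← pathSum_sub]
  refine pathSum_congr _ fun _ _ _ => by ring

/-- With statistic `-1` and parameter `1/2` the test reads `(n - n')/2 - n/4 ≤ L`, where `n` is the
sum of probabilities and `n'` the number of draws. -/
theorem prob_le_of_test {P : Predictor γ} {θ : Theta γ} {h : List (Theta γ × Loss)} {L : ℝ}
    (ht : testExp P θ none h ≤ L) :
    pathSum (fun h _ => prob P θ h) h ≤ 4 * L + 2 * pathSum (fun _ x => hit θ x) h := by
  rw [testExp_eq] at ht
  simp only [testStat, testRate] at ht
  have e1 : pathSum (fun _ x => hit θ x * (-1)) h = -1 * pathSum (fun _ x => hit θ x) h := by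
    rw [← pathSum_const_mul]; exact pathSum_congr _ fun _ _ _ => by ring
  have e2 : pathSum (fun h (_ : Theta γ × Loss) => prob P θ h * (-1)) h =
      -1 * pathSum (fun h _ => prob P θ h) h := by
    rw [← pathSum_const_mul]; exact pathSum_congr _ fun _ _ _ => by ring
  rw [e1, e2] at ht
  linarith

/-- The expert bound and the concentration test each contribute `γ/(16r)` times the sum of
probabilities. The resulting `γ/(8r)` is tuned so that the drift of the constraints `±2` absorbs it.
-/
theorem hit_reward_le (hγ : 0 < γ) (hγ1 : γ ≤ 1) (hT : 1 < T) (h16 : 16 < γ * T) {ε : ℝ}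
    (hε : ε ≤ 1 / T) {P : Predictor γ} (hP : P.Follows T ε) (θ : Theta γ) (ξ : Xi)
    {h : List (Theta γ × Loss)} (hlen : h.length ≤ T) {L A : ℝ}
    (hA : Real.log (Fintype.card (Expert γ)) / 2 + 2 * Real.log (1024 * θ.1.1 / γ) ≤ A)
    (ht : testExp P θ (some ξ) h ≤ L) :
    pathSum (fun _ x => hit θ x * hmean γ ξ θ.1.1 θ.1.2 x.2) h ≤
      γ / (8 * θ.1.1) * pathSum (fun h _ => prob P θ h) h
        + (16 * L + 1024 * A + 129) * (θ.1.1 / γ) := by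
  obtain ⟨hr, hb⟩ := mem_Theta.1 θ.2
  obtain ⟨⟨i, hi⟩, hi1⟩ := (mem_scales hγ).1 hr
  have hrγ := Theta_scale_ge hγ θ
  set r := θ.1.1 with hrdef
  have hr0 : 0 < r := hγ.trans_le hrγ
  -- The shift by `4` selects the rate `γ/(1024 r)`, for which `64 η = γ/(16 r)`. Its existence in
  -- the grid requires `16 · 2 ^ i < T`, hence the assumption on `γ T`.
  have hk : i + 4 < Nat.clog 2 T := by
    rw [Nat.lt_clog_iff_pow_lt (by norm_num)]
    have := pow_lt_of_scale (m := 16) hγ (by exact_mod_cast h16) (hi ▸ hi1)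
    rw [pow_add]; omega
  have hrate : rate (⟨i + 4, hk⟩ : Fin (Nat.clog 2 T)) = γ / (1024 * r) := by
    simp only [rate, hi, pow_add]; field_simp; norm_num
  have h1 := sum_reward_le hγ hγ1 hT hε hP ⟨i + 4, hk⟩ (θ, ξ) (h.map Prod.snd) (by simpa using hlen)
  rw [hrate, pathSum_map, pathSum_map] at h1
  simp only [reward_eq, one_div_div] at h1
  rw [testExp_eq] at ht
  simp only [testStat, testRate, ← hrdef] at ht
  set n := pathSum (fun h _ => prob P θ h) h
  set u := pathSum (fun h x => prob P θ h * hmean γ ξ r θ.1.2 x.2) h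
  set uh := pathSum (fun _ x => hit θ x * hmean γ ξ r θ.1.2 x.2) h
  have h2 : u ≤ A / (γ / (1024 * r)) + 129 + 64 * (γ / (1024 * r)) * n := by
    refine h1.trans ?_
    gcongr
    exact le_rfl
  have e1 : A / (γ / (1024 * r)) = 1024 * A * (r / γ) := by field_simp
  have e2 : 64 * (γ / (1024 * r)) = γ / (16 * r) := by field_simp; norm_num
  rw [e1, e2] at h2
  have hl : 0 < γ / (16 * r) := by positivity
  have h3 : uh ≤ u + γ / (16 * r) * n + 16 * L * (r / γ) := by
    have : γ / (16 * r) * uh ≤ γ / (16 * r) * (u + γ / (16 * r) * n + 16 * L * (r / γ)) := by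
      have e3 : γ / (16 * r) * (16 * L * (r / γ)) = L := by field_simp
      rw [mul_add, mul_add, e3]
      linarith
    exact le_of_mul_le_mul_left this hl
  have h4 : 1 ≤ r / γ := by rwa [le_div_iff₀ hγ, one_mul]
  have e4 : γ / (8 * r) = γ / (16 * r) + γ / (16 * r) := by field_simp; norm_num
  rw [e4]
  nlinarith

/-- The regret of a pair. -/
theorem pair_regret_le (hγ : 0 < γ) (hγ1 : γ ≤ 1) (hT : 1 < T) (h16 : 16 < γ * T) {ε : ℝ}
    (hε : ε ≤ 1 / T) {P : Predictor γ} (hP : P.Follows T ε) (θ : Theta γ)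
    {h : List (Theta γ × Loss)} (hlen : h.length ≤ T) {L A B : ℝ} (hL0 : 0 ≤ L)
    (hA0 : 0 ≤ A) (hA : Real.log (Fintype.card (Expert γ)) / 2 + 2 * Real.log (1024 * θ.1.1 / γ) ≤ A)
    (hB : 16 * L + 1024 * A + 129 ≤ B) (ht : ∀ τ, testExp P θ τ h ≤ L) (b q : unitInterval)
    (hb : (b : ℝ) = θ.1.2) :
    pathSum (fun _ x => hit θ x * (x.2.toFun b - x.2.toFun q)) h ≤
      γ / 2 * pathSum (fun h _ => prob P θ h) h + 2 * γ * pathSum (fun _ x => hit θ x) h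
        + 7 * B / γ * θ.1.1 := by
  have hrγ := Theta_scale_ge hγ θ
  have hr1 := (scale_mem hγ (mem_Theta.1 θ.2).1).2
  have hn := prob_le_of_test (ht none)
  have huh := fun ξ => hit_reward_le hγ hγ1 hT h16 hε hP θ ξ hlen hA (ht (some ξ))
  obtain ⟨ξ, ξ', s, e, hs0, hs1, he0, he1, hle⟩ := Loss.exists_sub_le hγ hrγ b q
  set r := θ.1.1 with hrdef
  have hr0 : 0 < r := hγ.trans_le hrγ
  have hhit : ∀ x : Theta γ × Loss, 0 ≤ hit θ x := fun x => by unfold hit; split_ifs <;> norm_num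
  have hsum : pathSum (fun _ x => hit θ x * (x.2.toFun b - x.2.toFun q)) h ≤
      s * (2 * pathSum (fun _ x => hit θ x * hmean γ ξ r θ.1.2 x.2) h
        + γ / r * pathSum (fun _ x => hit θ x) h)
      + e * (2 * pathSum (fun _ x => hit θ x * hmean γ ξ' r θ.1.2 x.2) h
        - γ / (2 * r) * pathSum (fun _ x => hit θ x) h) := by
    simp only [← pathSum_const_mul, ← pathSum_add, ← pathSum_sub]
    refine pathSum_le_pathSum _ fun x _ _ => ?_
    have h1 := hle x.2
    rw [hb] at h1
    have := mul_le_mul_of_nonneg_left h1 (hhit x)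
    refine le_trans (le_of_eq (by ring)) (this.trans (le_of_eq (by ring)))
  refine hsum.trans ?_
  have hn0 : 0 ≤ pathSum (fun h (_ : Theta γ × Loss) => prob P θ h) h :=
    pathSum_nonneg (fun _ _ => ENNReal.toReal_nonneg) _
  have hnh0 : 0 ≤ pathSum (fun _ x => hit θ x) h := pathSum_nonneg (fun _ x => hhit x) _
  have h1 := huh ξ
  have h2 := huh ξ'
  set n := pathSum (fun h (_ : Theta γ × Loss) => prob P θ h) h
  set nh := pathSum (fun _ x => hit θ x) h
  set U := γ / (8 * r) * n + B * (r / γ) with hU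
  have h4 : 1 ≤ r / γ := by rwa [le_div_iff₀ hγ, one_mul]
  have hB0 : 0 ≤ B := by linarith
  have hU0 : 0 ≤ U := by positivity
  have hUB : γ / (8 * r) * n + (16 * L + 1024 * A + 129) * (r / γ) ≤ U := by
    simp only [hU]
    gcongr
  have h5 : s * (2 * pathSum (fun _ x => hit θ x * hmean γ ξ r θ.1.2 x.2) h + γ / r * nh) ≤
      2 * r * (2 * U + γ / r * nh) :=
    (mul_le_mul_of_nonneg_left (by linarith) hs0).trans
      (mul_le_mul_of_nonneg_right hs1 (by positivity))
  -- The decisive cancellation: `2 · γ/(8r) · 2 nh` is exactly the drift `γ/(2r) · nh`, so the far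
  -- part costs nothing proportional to the number of draws.
  have h6 : 2 * U - γ / (2 * r) * nh ≤ 3 * B * (r / γ) := by
    have h7 : γ / (8 * r) * n ≤ γ / (8 * r) * (4 * L + 2 * nh) :=
      mul_le_mul_of_nonneg_left hn (by positivity)
    have e1 : γ / (8 * r) * (4 * L + 2 * nh) = γ / r * (L / 2) + γ / (2 * r) * nh / 2 := by
      field_simp; ring
    have h8 : γ / r ≤ 1 := div_le_one_of_le₀ hrγ hr0.le
    have h9 : γ / r * (L / 2) ≤ L / 2 := mul_le_of_le_one_left (by linarith) h8
    have h10 : L ≤ B * (r / γ) := by nlinarith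
    simp only [hU]
    linarith
  have h7 : e * (2 * pathSum (fun _ x => hit θ x * hmean γ ξ' r θ.1.2 x.2) h
      - γ / (2 * r) * nh) ≤ 3 * B * (r / γ) := by
    have h8 : 0 ≤ 3 * B * (r / γ) := by positivity
    calc _ ≤ e * (3 * B * (r / γ)) := mul_le_mul_of_nonneg_left (by linarith) he0
      _ ≤ _ := mul_le_of_le_one_left h8 he1
  have h8 : 2 * r * (2 * U + γ / r * nh) ≤ γ / 2 * n + 2 * γ * nh + 4 * B * (r / γ) := by
    have e1 : 2 * r * (2 * U + γ / r * nh) = γ / 2 * n + 2 * γ * nh + 4 * B * (r / γ) * r := by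
      simp only [hU]; field_simp; ring
    rw [e1]
    have : 4 * B * (r / γ) * r ≤ 4 * B * (r / γ) := mul_le_of_le_one_right (by positivity) hr1
    linarith
  have e9 : 7 * B / γ * r = 7 * B * (r / γ) := by field_simp
  rw [e9]
  linarith

/-- On the good event the swap regret is small. -/
theorem swapRegret_le_of_tests (hγ : 0 < γ) (hγ1 : γ ≤ 1) (hT : 2 < T) (h16 : 16 < γ * T) {ε : ℝ}
    (hε : ε ≤ 1 / T) {P : Predictor γ} (hP : P.Follows T ε)
    {h : List (Theta γ × Loss)} (hlen : h.length = T) {L A B : ℝ} (hL0 : 0 ≤ L)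
    (hA0 : 0 ≤ A)
    (hA : ∀ θ : Theta γ,
      Real.log (Fintype.card (Expert γ)) / 2 + 2 * Real.log (1024 * θ.1.1 / γ) ≤ A)
    (hB : 16 * L + 1024 * A + 129 ≤ B) (ht : ∀ θ τ, testExp P θ τ h ≤ L) :
    swapRegret (h.map forget) ≤ 5 / 2 * (γ * T) + 42 * (B * Real.log T / γ) := by
  classical
  refine ciSup_le fun σ => ?_
  rw [List.map_map, sum_map_eq_pathSum]
  -- Since `σ` sees only the prediction, within one pair the comparison point is fixed, and the
  -- regret is a sum of external regrets over pairs.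
  have e1 : pathSum (fun _ x => ((fun x : unitInterval × Loss => x.2.toFun x.1 - x.2.toFun (σ x.1))
      ∘ forget) x) h = ∑ θ : Theta γ, pathSum (fun _ x => hit θ x *
        (x.2.toFun (Set.projIcc 0 1 (zero_le_one' ℝ) θ.1.2)
          - x.2.toFun (σ (Set.projIcc 0 1 (zero_le_one' ℝ) θ.1.2)))) h := by
    rw [← pathSum_finset_sum]
    refine pathSum_congr _ fun x _ _ => ?_
    rw [Finset.sum_eq_single x.1]
    · simp [hit, forget]
    · intro θ _ hne; simp [hit, hne.symm]
    · simp
  rw [e1]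
  have h1 : ∀ θ : Theta γ, _ := fun θ => pair_regret_le hγ hγ1 (by omega) h16 hε hP θ hlen.le hL0 hA0
    (hA θ) hB (ht θ) (Set.projIcc 0 1 (zero_le_one' ℝ) θ.1.2)
    (σ (Set.projIcc 0 1 (zero_le_one' ℝ) θ.1.2)) (by
      obtain ⟨hr, hb⟩ := mem_Theta.1 θ.2
      rw [Set.projIcc_of_mem _ (bin_mem (hγ.trans_le (Theta_scale_ge hγ θ)) hb)])
  refine (Finset.sum_le_sum fun θ _ => h1 θ).trans ?_
  rw [Finset.sum_add_distrib, Finset.sum_add_distrib, ← Finset.mul_sum, ← Finset.mul_sum,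
    ← Finset.mul_sum, sum_pathSum_hit, sum_pathSum_prob, hlen]
  have h2 := sum_scale_le hγ (by linarith) hT
  have h3 : 7 * B / γ * ∑ θ : Theta γ, θ.1.1 ≤ 7 * B / γ * (6 * Real.log T) :=
    mul_le_mul_of_nonneg_left h2 (by have : 0 ≤ B := by linarith
                                     positivity)
  have e2 : 7 * B / γ * (6 * Real.log T) = 42 * (B * Real.log T / γ) := by ring
  linarith

end Deterministic

end SwapRegret

namespace SwapRegret

/-! ### The regret bounds with high probability and in expectation. -/

section Regret

theorem pmf_markov {α : Type*} (p : PMF α) (f : α → ENNReal) (c : ENNReal) :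
    c * p.toOuterMeasure {x | c ≤ f x} ≤ ∑' x, p x * f x := by
  rw [PMF.toOuterMeasure_apply, ← ENNReal.tsum_mul_left]
  refine ENNReal.tsum_le_tsum fun x => ?_
  by_cases h : c ≤ f x
  · rw [Set.indicator_of_mem (by exact h), mul_comm]
    gcongr
  · rw [Set.indicator_of_notMem (by exact h)]
    simp

theorem pmf_add_compl {α : Type*} (p : PMF α) (s : Set α) :
    p.toOuterMeasure s + p.toOuterMeasure sᶜ = 1 := by
  rw [PMF.toOuterMeasure_apply, PMF.toOuterMeasure_apply, ← ENNReal.tsum_add, ← p.tsum_coe]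
  congr 1
  funext x
  exact congrFun (Set.indicator_self_add_compl s p) x

theorem card_Option_Xi : Fintype.card (Option Xi) = 5 := rfl

theorem abs_testStat_le {γ : ℝ} (hγ : 0 < γ) (θ : Theta γ) (τ : Option Xi) (ℓ : Loss) :
    |testStat θ τ ℓ| ≤ 1 := by
  cases τ with
  | none => simp [testStat]
  | some ξ => exact abs_hmean_le hγ (Theta_scale_ge hγ θ) _ _ _

theorem testRate_mem {γ : ℝ} (hγ : 0 < γ) (θ : Theta γ) (τ : Option Xi) :
    0 ≤ testRate θ τ ∧ testRate θ τ ≤ 1 := by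
  have h := Theta_scale_ge hγ θ
  have h0 := hγ.trans_le h
  cases τ with
  | none => norm_num [testRate]
  | some ξ => exact ⟨by simp only [testRate]; positivity, div_le_one_of_le₀ (by linarith) (by linarith)⟩

/-- All tests succeed with high probability. -/
theorem tests_fail_le {γ : ℝ} (hγ : 0 < γ) (hγ1 : γ ≤ 1) (P : Predictor γ)
    (adversary : Transcript → Loss) (n : ℕ) {δ : ℝ} (hδ : 0 < δ) :
    (playTheta P adversary n).toOuterMeasure
      {h | ¬ ∀ θ τ, testExp P θ τ h ≤ Real.log (5 * (Theta γ).card / δ)} ≤ ENNReal.ofReal δ := by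
  have := Theta_nonempty hγ hγ1
  have hc0 : 0 < (Theta γ).card := Finset.card_pos.2 ⟨_, (Classical.arbitrary (Theta γ)).2⟩
  have hc : (0 : ℝ) < (Theta γ).card := by exact_mod_cast hc0
  set N : ℝ := 5 * (Theta γ).card with hN
  have hN0 : 0 < N := by positivity
  -- One Markov inequality for the sum of the supermartingales of all five tests of all pairs serves
  -- as the union bound.
  set W : List (Theta γ × Loss) → ENNReal := fun h =>
    ∑ x : Theta γ × Option Xi, ENNReal.ofReal (Real.exp (testExp P x.1 x.2 h)) with hW
  have hEW : ∑' h, playTheta P adversary n h * W h ≤ ENNReal.ofReal N := by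
    simp only [hW, Finset.mul_sum]
    rw [Summable.tsum_finsetSum fun _ _ => ENNReal.summable]
    refine (Finset.sum_le_sum fun x _ => tsum_exp_le_one P adversary x.1 (testRate_mem hγ x.1 x.2).1
      (testRate_mem hγ x.1 x.2).2 (abs_testStat_le hγ x.1 x.2) n).trans ?_
    simp only [Finset.sum_const, Finset.card_univ, Fintype.card_prod, card_Option_Xi,
      Fintype.card_coe, nsmul_eq_mul, mul_one, hN]
    rw [show (5 : ℝ) * (Theta γ).card = (((Theta γ).card * 5 : ℕ) : ℝ) by push_cast; ring,
      ENNReal.ofReal_natCast]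
  have hsub : {h | ¬ ∀ θ τ, testExp P θ τ h ≤ Real.log (N / δ)} ⊆
      {h | ENNReal.ofReal (N / δ) ≤ W h} := by
    intro h hh
    by_contra hlt
    refine hh fun θ τ => ?_
    have h1 : ENNReal.ofReal (Real.exp (testExp P θ τ h)) ≤ W h :=
      Finset.single_le_sum (f := fun x : Theta γ × Option Xi =>
        ENNReal.ofReal (Real.exp (testExp P x.1 x.2 h))) (fun _ _ => zero_le)
        (Finset.mem_univ (θ, τ))
    have h2 := (ENNReal.ofReal_lt_ofReal_iff (by positivity)).1 (h1.trans_lt (not_le.1 hlt))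
    rw [Real.le_log_iff_exp_le (by positivity)]
    exact h2.le
  refine ((playTheta P adversary n).toOuterMeasure.mono hsub).trans ?_
  have hm := (pmf_markov (playTheta P adversary n) W (ENNReal.ofReal (N / δ))).trans hEW
  have hne : ENNReal.ofReal (N / δ) ≠ 0 := by
    rw [Ne, ENNReal.ofReal_eq_zero, not_le]; positivity
  rw [mul_comm, ← ENNReal.le_div_iff_mul_le (Or.inl hne) (Or.inl ENNReal.ofReal_ne_top),
    ← ENNReal.ofReal_div_of_pos (by positivity)] at hm
  refine hm.trans (le_of_eq ?_)
  congr 1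
  field_simp

variable {T : ℕ} {δ : ℝ}

/-- With `Q = √(T log T · D)`, the choice `γ = Q/T` balances `γ T = Q` against `D log T / γ = Q`. If
`T ≤ 32 Q` the trivial bound `T` is enough; this case includes every instance in which the cap `γ ≤
1` is active. -/
theorem regret_fail_le (hT : 2 < T) (hδ : 0 < δ) (hδT : δ ≤ 1 / T) {ε : ℝ} (hε : ε ≤ 1 / T)
    {γ : ℝ} (hγdef : γ = gammaParam T δ) {P : Predictor γ} (hP : P.Follows T ε) (adversary : Transcript → Loss) :
    (playTheta P adversary T).toOuterMeasure
      {h | swapRegret (h.map forget) ≤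
        300000 * Real.sqrt ((T * Real.log T) * Real.log (1 / δ))}ᶜ ≤ ENNReal.ofReal δ := by
  have hlog := one_lt_log_natCast hT
  have hD := log_natCast_le_log_inv hT hδ hδT
  have hγ := gammaParam_pos hT hδ hδT
  have hγ1 := gammaParam_le_one T δ
  rw [← hγdef] at hγ hγ1
  have hT0 : (0 : ℝ) < T := by positivity
  set D := Real.log (1 / δ) with hDdef
  set Q := Real.sqrt ((T * Real.log T) * D) with hQ
  have hQ0 : 0 ≤ Q := Real.sqrt_nonneg _
  have hQ2 : Q ^ 2 = T * Real.log T * D := Real.sq_sqrt (by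
    have : 0 ≤ D := by linarith
    positivity)
  by_cases htriv : (T : ℝ) ≤ 32 * Q
  · refine le_trans (le_of_eq ?_) zero_le
    rw [PMF.toOuterMeasure_apply_eq_zero_iff, Set.disjoint_left]
    intro h hh hn
    refine hn ?_
    have h1 := swapRegret_le_length (h.map forget)
    rw [List.length_map, length_of_mem_support P adversary T h hh] at h1
    suffices swapRegret (h.map forget) ≤ 300000 * Q from this
    linarith
  · rw [not_le] at htriv
    have hQT : (T : ℝ) ≤ Q ^ 2 := by rw [hQ2]; nlinarith [mul_le_mul_of_nonneg_left hlog.le hT0.le]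
    have hQ32 : 32 < Q := by nlinarith
    have hsq : Real.sqrt (Real.log T * D / T) = Q / T := by
      rw [Real.sqrt_eq_iff_mul_self_eq (by have : 0 ≤ D := by linarith
                                           positivity) (by positivity)]
      field_simp
      linarith
    have hγQ : γ = Q / T := by
      rw [hγdef, gammaParam, ← hDdef, hsq, min_eq_right]
      rw [div_le_one hT0]
      linarith
    have hγT : γ * T = Q := by rw [hγQ]; field_simp
    have hT1024 : (1024 : ℝ) < T := by nlinarith
    have hT4 : 5 * (T : ℝ) ^ 2 ≤ T ^ 4 := by
      have : (5 : ℝ) ≤ T ^ 2 := by nlinarith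
      nlinarith [sq_nonneg (T : ℝ)]
    have hcard : ((Theta γ).card : ℝ) ≤ T ^ 2 := by
      exact_mod_cast card_Theta_le hγ (by rw [hγT]; linarith)
    have := Theta_nonempty hγ hγ1
    have hc0 : 0 < (Theta γ).card := Finset.card_pos.2 ⟨_, (Classical.arbitrary (Theta γ)).2⟩
    have hc1 : (1 : ℝ) ≤ (Theta γ).card := by exact_mod_cast hc0
    have hδ1 : δ ≤ 1 := hδT.trans (div_le_one_of_le₀ (by linarith) hT0.le)
    set L := Real.log (5 * (Theta γ).card / δ) with hL
    have hL0 : 0 ≤ L := Real.log_nonneg (by rw [le_div_iff₀ hδ]; linarith)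
    have hL5 : L ≤ 5 * D := by
      have h1 : 5 * ((Theta γ).card : ℝ) / δ ≤ (T : ℝ) ^ 4 * (1 / δ) := by
        rw [mul_one_div]
        gcongr
        linarith
      have h2 := Real.log_le_log (by positivity) h1
      rw [Real.log_mul (by positivity) (by positivity), Real.log_pow] at h2
      push_cast at h2
      linarith
    have hA : ∀ θ : Theta γ, Real.log (Fintype.card (Expert γ)) / 2
        + 2 * Real.log (1024 * θ.1.1 / γ) ≤ 6 * D := by
      intro θ
      have hr1 := (scale_mem hγ (mem_Theta.1 θ.2).1).2
      have hr0 := hγ.trans_le (Theta_scale_ge hγ θ)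
      have h1 : Real.log (Fintype.card (Expert γ)) ≤ 4 * Real.log T := by
        have : (Fintype.card (Expert γ) : ℝ) ≤ (T : ℝ) ^ 4 := by
          simp only [Fintype.card_prod, Fintype.card_coe, card_Xi]
          push_cast
          linarith
        have h2 := Real.log_le_log (by
          simp only [Fintype.card_prod, Fintype.card_coe, card_Xi]
          push_cast
          positivity) this
        rw [Real.log_pow] at h2
        exact_mod_cast h2
      have h2 : Real.log (1024 * θ.1.1 / γ) ≤ 2 * Real.log T := by
        have : 1024 * θ.1.1 / γ ≤ (T : ℝ) ^ 2 := by
          rw [div_le_iff₀ hγ, sq, mul_assoc, mul_comm (T : ℝ) γ, hγT]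
          nlinarith
        have h3 := Real.log_le_log (by positivity) this
        rw [Real.log_pow] at h3
        exact_mod_cast h3
      linarith
    refine le_trans ((playTheta P adversary T).toOuterMeasure_mono ?_)
      (tests_fail_le hγ hγ1 P adversary T hδ)
    rintro h ⟨hbad, hsupp⟩ hgood
    refine hbad ?_
    -- With `L ≤ 5D`, `A = 6D` and `D ≥ 1` one gets `16·5 + 1024·6 + 129 = 6353`. Then `42 · 6353 +
    -- 5/2` stays below `300000`.
    have h1 := swapRegret_le_of_tests hγ hγ1 hT (by rw [hγT]; linarith) hε hP
      (length_of_mem_support P adversary T h hsupp) hL0 (by linarith : (0:ℝ) ≤ 6 * D) hA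
      (B := 6353 * D) (by linarith) hgood
    have h2 : 6353 * D * Real.log T / γ = 6353 * Q := by
      rw [hγQ]
      field_simp
      linarith
    rw [h2, hγT] at h1
    suffices swapRegret (h.map forget) ≤ 300000 * Q from this
    linarith

theorem regret_high_probability (hT : 2 < T) (hδ : 0 < δ) (hδT : δ ≤ 1 / T) {ε : ℝ}
    (hε : ε ≤ 1 / T) {P : Predictor (gammaParam T δ)} (hP : P.Follows T ε)
    (adversary : Transcript → Loss) {C : ℝ} (hC : 300000 ≤ C) :
    ENNReal.ofReal (1 - δ) ≤ (play P.strategy adversary T).toOuterMeasure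
      {h | swapRegret h ≤ C * Real.sqrt ((T * Real.log T) * Real.log (1 / δ))} := by
  have h1 := regret_fail_le hT hδ hδT hε rfl hP adversary
  have h2 := pmf_add_compl (playTheta P adversary T) {h | swapRegret (h.map forget) ≤
        300000 * Real.sqrt ((T * Real.log T) * Real.log (1 / δ))}
  rw [play_eq_map, PMF.toOuterMeasure_map_apply]
  refine le_trans (b := (playTheta P adversary T).toOuterMeasure {h | swapRegret (h.map forget) ≤
        300000 * Real.sqrt ((T * Real.log T) * Real.log (1 / δ))}) ?_
    ((playTheta P adversary T).toOuterMeasure.mono fun h hh => ?_)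
  · rw [ENNReal.ofReal_sub _ hδ.le, ENNReal.ofReal_one, tsub_le_iff_right, ← h2]
    gcongr
  · exact le_trans (b := 300000 * Real.sqrt ((T * Real.log T) * Real.log (1 / δ))) hh (mul_le_mul_of_nonneg_right hC (Real.sqrt_nonneg _))

/-- The failure event has probability at most `1/T` and regret at most `T`, so it adds at most `1 ≤
√T log T`. -/
theorem regret_expectation (hT : 2 < T) {ε : ℝ} (hε : ε ≤ 1 / T)
    {P : Predictor (gammaParam T (1 / T))} (hP : P.Follows T ε) (adversary : Transcript → Loss) :
    ∑' h, play P.strategy adversary T h * ENNReal.ofReal (swapRegret h) ≤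
      ENNReal.ofReal (300001 * (Real.sqrt T * Real.log T)) := by
  have hT0 : (0 : ℝ) < T := by positivity
  have hlog := one_lt_log_natCast hT
  have h1 := regret_fail_le hT (one_div_pos.2 hT0) le_rfl hε rfl hP adversary
  have hQ : Real.sqrt ((T * Real.log T) * Real.log (1 / (1 / T))) = Real.sqrt T * Real.log T := by
    rw [one_div_one_div, mul_assoc, Real.sqrt_mul hT0.le, Real.sqrt_mul_self (by linarith)]
  rw [hQ] at h1
  set Q := Real.sqrt T * Real.log T with hQdef
  have hQ1 : 1 ≤ Q := by
    have : 1 ≤ Real.sqrt T := by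
      rw [Real.one_le_sqrt]; exact_mod_cast (by omega : 1 ≤ T)
    nlinarith
  set S : Set (List (Theta (gammaParam T (1 / T)) × Loss)) :=
    {h | swapRegret (h.map forget) ≤ 300000 * Q} with hS
  rw [play_eq_map, tsum_map_mul]
  have h2 : ∀ h, playTheta P adversary T h * ENNReal.ofReal (swapRegret (h.map forget)) ≤
      playTheta P adversary T h * ENNReal.ofReal (300000 * Q)
        + T * Sᶜ.indicator (playTheta P adversary T) h := by
    intro h
    by_cases hh : h ∈ S
    · refine le_add_right ?_
      gcongr
      exact hh
    · rw [Set.indicator_of_mem (by exact hh)]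
      refine le_add_left ?_
      by_cases hsupp : h ∈ (playTheta P adversary T).support
      · rw [mul_comm]
        gcongr
        have := swapRegret_le_length (h.map forget)
        rw [List.length_map, length_of_mem_support P adversary T h hsupp] at this
        rw [← ENNReal.ofReal_natCast]
        exact ENNReal.ofReal_le_ofReal this
      · rw [PMF.mem_support_iff, not_not] at hsupp
        simp [hsupp]
  refine (ENNReal.tsum_le_tsum h2).trans ?_
  rw [ENNReal.tsum_add, ENNReal.tsum_mul_right, PMF.tsum_coe, one_mul, ENNReal.tsum_mul_left,
    ← PMF.toOuterMeasure_apply]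
  have h3 : (T : ENNReal) * (playTheta P adversary T).toOuterMeasure Sᶜ ≤ ENNReal.ofReal 1 := by
    refine (mul_le_mul_right h1 _).trans ?_
    rw [← ENNReal.ofReal_natCast, ← ENNReal.ofReal_mul hT0.le]
    refine ENNReal.ofReal_le_ofReal (le_of_eq ?_)
    field_simp
  refine (add_le_add le_rfl h3).trans ?_
  rw [← ENNReal.ofReal_add (by positivity) zero_le_one]
  refine ENNReal.ofReal_le_ofReal ?_
  linarith

end Regret

end SwapRegret

namespace SwapRegret

/-! ### A matrix language compiled to the real random access machine -/

section Compiler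

/-- Contents of the real arrays. -/
abbrev Mem := ℕ → ℕ → ℕ → ℝ

/-- Real expressions with index variables ranging over `0, …, T - 1` and sums over this range.
`sum e` binds the variable whose number is the current level. In `cell a i j` the indices are
variables, or `0` if absent. -/
inductive RE where
  | const (q : ℚ)
  | size
  | idx (x : ℕ)
  | cell (a : ℕ) (i j : Option ℕ)
  | add (e f : RE)
  | sub (e f : RE)
  | mul (e f : RE)
  | div (e f : RE)
  | exp (e : RE)
  | log (e : RE)
  | ifLt (e f g h : RE)
  | sum (e : RE)

/-- The value of an index. -/
def idxVal (env : ℕ → ℕ) : Option ℕ → ℕ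
  | none => 0
  | some x => env x

open Classical in
noncomputable def RE.eval (T : ℕ) (m : Mem) : RE → ℕ → (ℕ → ℕ) → ℝ
  | const q, _, _ => q
  | size, _, _ => T
  | idx x, _, env => env x
  | cell a i j, _, env => m a (idxVal env i) (idxVal env j)
  | add e f, l, env => e.eval T m l env + f.eval T m l env
  | sub e f, l, env => e.eval T m l env - f.eval T m l env
  | mul e f, l, env => e.eval T m l env * f.eval T m l env
  | div e f, l, env => e.eval T m l env / f.eval T m l env
  | exp e, l, env => Real.exp (e.eval T m l env)
  | log e, l, env => Real.log (e.eval T m l env)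
  | ifLt e f g h, l, env =>
      if e.eval T m l env < f.eval T m l env then g.eval T m l env else h.eval T m l env
  | sum e, l, env => ∑ k ∈ Finset.range T, e.eval T m (l + 1) (Function.update env l k)

/-- All variables are below the level. -/
def RE.Closed : RE → ℕ → Prop
  | const _, _ => True
  | size, _ => True
  | idx x, l => x < l
  | cell _ i j, l => (∀ x ∈ i, x < l) ∧ ∀ x ∈ j, x < l
  | add e f, l => e.Closed l ∧ f.Closed l
  | sub e f, l => e.Closed l ∧ f.Closed l
  | mul e f, l => e.Closed l ∧ f.Closed l
  | div e f, l => e.Closed l ∧ f.Closed l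
  | exp e, l => e.Closed l
  | log e, l => e.Closed l
  | ifLt e f g h, l => e.Closed l ∧ f.Closed l ∧ g.Closed l ∧ h.Closed l
  | sum e, l => e.Closed (l + 1)

/-- The arrays that an expression reads satisfy `p`. -/
def RE.Reads (p : ℕ → Prop) : RE → Prop
  | const _ => True
  | size => True
  | idx _ => True
  | cell a _ _ => p a
  | add e f => e.Reads p ∧ f.Reads p
  | sub e f => e.Reads p ∧ f.Reads p
  | mul e f => e.Reads p ∧ f.Reads p
  | div e f => e.Reads p ∧ f.Reads p
  | exp e => e.Reads p
  | log e => e.Reads p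
  | ifLt e f g h => e.Reads p ∧ f.Reads p ∧ g.Reads p ∧ h.Reads p
  | sum e => e.Reads p

theorem idxVal_congr {env env' : ℕ → ℕ} {l : ℕ} (h : ∀ x < l, env x = env' x) {i : Option ℕ}
    (hi : ∀ x ∈ i, x < l) : idxVal env i = idxVal env' i := by
  cases i with
  | none => rfl
  | some x => exact h x (hi x rfl)

/-- The frame property behind all later correctness proofs: temporary cells and deeper index
variables may change without affecting a value. -/
theorem RE.eval_congr {T : ℕ} {p : ℕ → Prop} {m m' : Mem} (hm : ∀ a, p a → m a = m' a) :
    ∀ (e : RE) {l : ℕ} {env env' : ℕ → ℕ}, e.Reads p → e.Closed l → (∀ x < l, env x = env' x) →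
      e.eval T m l env = e.eval T m' l env'
  | const _, _, _, _, _, _, _ => rfl
  | size, _, _, _, _, _, _ => rfl
  | idx x, _, _, _, _, hc, h => by simp only [eval]; rw [h x hc]
  | cell a i j, _, _, _, hr, hc, h => by
    simp only [eval]
    rw [hm a hr, idxVal_congr h hc.1, idxVal_congr h hc.2]
  | add e f, _, _, _, hr, hc, h => by
    simp only [eval]; rw [eval_congr hm e hr.1 hc.1 h, eval_congr hm f hr.2 hc.2 h]
  | sub e f, _, _, _, hr, hc, h => by
    simp only [eval]; rw [eval_congr hm e hr.1 hc.1 h, eval_congr hm f hr.2 hc.2 h]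
  | mul e f, _, _, _, hr, hc, h => by
    simp only [eval]; rw [eval_congr hm e hr.1 hc.1 h, eval_congr hm f hr.2 hc.2 h]
  | div e f, _, _, _, hr, hc, h => by
    simp only [eval]; rw [eval_congr hm e hr.1 hc.1 h, eval_congr hm f hr.2 hc.2 h]
  | exp e, _, _, _, hr, hc, h => by simp only [eval]; rw [eval_congr hm e hr hc h]
  | log e, _, _, _, hr, hc, h => by simp only [eval]; rw [eval_congr hm e hr hc h]
  | ifLt e f g k, _, _, _, hr, hc, h => by
    simp only [eval]
    rw [eval_congr hm e hr.1 hc.1 h, eval_congr hm f hr.2.1 hc.2.1 h,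
      eval_congr hm g hr.2.2.1 hc.2.2.1 h, eval_congr hm k hr.2.2.2 hc.2.2.2 h]
  | sum e, l, env, env', hr, hc, h => by
    simp only [eval]
    refine Finset.sum_congr rfl fun k _ => eval_congr hm e hr hc fun x hx => ?_
    by_cases hxl : x = l
    · subst hxl; simp
    · rw [Function.update_of_ne hxl, Function.update_of_ne hxl]
      exact h x (by omega)

/-- `for r in 0, …, T - 1` with the bound in register `0`. -/
def forLoop (r : ℕ) (body : Cmd) : Cmd :=
  Cmd.seq (Cmd.setNat r (NExp.const 0))
    (Cmd.loop (Cond.natLt (NExp.var r) (NExp.var 0))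
      (Cmd.seq body (Cmd.setNat r (NExp.add (NExp.var r) (NExp.const 1)))))

/-- Execution with a bound on the number of steps and a postcondition. -/
def Runs (O : Query → ℝ → ℝ) (c : Cmd) (s : State) (B : ℕ) (Q : State → Prop) : Prop :=
  ∃ s' n, Exec O c s s' n ∧ n ≤ B ∧ Q s'

variable {O : Query → ℝ → ℝ}

theorem Runs.mono {c : Cmd} {s : State} {B B' : ℕ} {Q Q' : State → Prop} (h : Runs O c s B Q)
    (hB : B ≤ B') (hQ : ∀ s', Q s' → Q' s') : Runs O c s B' Q' := by
  obtain ⟨s', n, h1, h2, h3⟩ := h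
  exact ⟨s', n, h1, h2.trans hB, hQ s' h3⟩

theorem Runs.seq {c d : Cmd} {s : State} {B B' : ℕ} {Q R : State → Prop} (h : Runs O c s B Q)
    (h' : ∀ s', Q s' → Runs O d s' B' R) : Runs O (Cmd.seq c d) s (B + B' + 1) R := by
  obtain ⟨s', n, h1, h2, h3⟩ := h
  obtain ⟨s'', n', h4, h5, h6⟩ := h' s' h3
  exact ⟨s'', _, Exec.seq h1 h4, by omega, h6⟩

theorem runs_setReal {s : State} {a : ℕ} {i j : NExp} {e : RExp} {Q : State → Prop}
    (h : Q (s.setReal a (i.eval s) (j.eval s) (e.eval s))) :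
    Runs O (Cmd.setReal a i j e) s (i.cost + j.cost + e.cost + 1) Q :=
  ⟨_, _, Exec.setReal s a i j e, le_rfl, h⟩

theorem runs_ask {s : State} {a : ℕ} {i j : NExp} {q : Query} {e : RExp} {Q : State → Prop}
    (h : Q (s.setReal a (i.eval s) (j.eval s) (O q (e.eval s)))) :
    Runs O (Cmd.ask a i j q e) s (i.cost + j.cost + e.cost + 1) Q :=
  ⟨_, _, Exec.ask s a i j q e, le_rfl, h⟩

theorem runs_setNat {s : State} {x : ℕ} {e : NExp} {Q : State → Prop}
    (h : Q (s.setNat x (e.eval s))) : Runs O (Cmd.setNat x e) s (e.cost + 1) Q :=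
  ⟨_, _, Exec.setNat s x e, le_rfl, h⟩

theorem runs_ite {b : Cond} {c d : Cmd} {s : State} {B B' : ℕ} {Q : State → Prop}
    (h : b.Holds s → Runs O c s B Q) (h' : ¬ b.Holds s → Runs O d s B' Q) :
    Runs O (Cmd.ite b c d) s (b.cost + (B + B') + 1) Q := by
  by_cases hb : b.Holds s
  · obtain ⟨s', n, h1, h2, h3⟩ := h hb
    exact ⟨s', _, Exec.ite_true hb h1, by omega, h3⟩
  · obtain ⟨s', n, h1, h2, h3⟩ := h' hb
    exact ⟨s', _, Exec.ite_false hb h1, by omega, h3⟩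

theorem State.setNat_nat_self (s : State) (x n : ℕ) : (s.setNat x n).nat x = n := by
  simp [State.setNat]

theorem State.setNat_nat_of_ne (s : State) {x y : ℕ} (n : ℕ) (h : y ≠ x) :
    (s.setNat x n).nat y = s.nat y := by
  simp [State.setNat, h]

theorem State.setNat_real (s : State) (x n : ℕ) : (s.setNat x n).real = s.real := rfl

theorem State.setReal_nat (s : State) (a i j : ℕ) (z : ℝ) : (s.setReal a i j z).nat = s.nat := rfl

theorem State.setReal_real_self (s : State) (a i j : ℕ) (z : ℝ) :
    (s.setReal a i j z).real a i j = z := by simp [State.setReal]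

theorem State.setReal_real_of_ne (s : State) {a a' : ℕ} (i j : ℕ) (z : ℝ) (h : a' ≠ a) :
    (s.setReal a i j z).real a' = s.real a' := by
  funext i' j'; simp [State.setReal, h]

/-- The invariant is stated for the state after the counter has been advanced, so that consecutive
iterations chain. The body has to leave the counter as it found it. -/
theorem forLoop_runs {T r B : ℕ} {body : Cmd} (Inv : ℕ → State → Prop) {s : State}
    (h0 : Inv 0 (s.setNat r 0)) (hT : ∀ k s, Inv k s → s.nat 0 = T)
    (step : ∀ k < T, ∀ s, Inv k s → s.nat r = k →
      Runs O body s B fun s' => s'.nat r = k ∧ Inv (k + 1) (s'.setNat r (k + 1))) :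
    Runs O (forLoop r body) s (T * (B + 10) + 10) fun s' => Inv T s' := by
  have main : ∀ n k s, k + n = T → Inv k s → s.nat r = k →
      Runs O (Cmd.loop (Cond.natLt (NExp.var r) (NExp.var 0))
        (Cmd.seq body (Cmd.setNat r (NExp.add (NExp.var r) (NExp.const 1))))) s
        (n * (B + 10) + 4) fun s' => Inv T s' := by
    intro n
    induction n with
    | zero =>
      intro k s hk hI hr
      have hkT : k = T := by omega
      refine ⟨s, _, Exec.loop_false ?_, ?_, hkT ▸ hI⟩
      · simp [Cond.Holds, NExp.eval, hT k s hI, hr, hkT]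
      · simp [Cond.cost, NExp.cost]
    | succ n ih =>
      intro k s hk hI hr
      obtain ⟨s', n', h1, h2, h3, h4⟩ := step k (by omega) s hI hr
      have h5 : Exec O (Cmd.setNat r (NExp.add (NExp.var r) (NExp.const 1))) s'
          (s'.setNat r (k + 1)) 4 := by
        have := Exec.setNat (O := O) s' r (NExp.add (NExp.var r) (NExp.const 1))
        simpa [NExp.eval, NExp.cost, h3] using this
      obtain ⟨s'', n'', h6, h7, h8⟩ := ih (k + 1) (s'.setNat r (k + 1)) (by omega) h4
        (State.setNat_nat_self _ _ _)
      refine ⟨s'', _, Exec.loop_true ?_ (Exec.seq h1 h5) h6, ?_, h8⟩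
      · simp [Cond.Holds, NExp.eval, hT k s hI, hr]; omega
      · simp only [Cond.cost, NExp.cost]
        have : (n + 1) * (B + 10) = n * (B + 10) + (B + 10) := by ring
        omega
  refine (Runs.seq (B' := T * (B + 10) + 4)
    (runs_setNat (Q := fun s' => s' = s.setNat r 0) rfl) ?_).mono ?_ fun _ h => h
  · rintro _ rfl
    exact main T 0 _ (by omega) h0 (State.setNat_nat_self _ _ _)
  · simp only [NExp.cost]; omega

/-- The register of an index variable. -/
def vreg (x : ℕ) : ℕ := 2 * x + 2

def idxExp : Option ℕ → NExp
  | none => NExp.const 0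
  | some x => NExp.var (vreg x)

/-- The index variables of a state. -/
def State.env (s : State) (x : ℕ) : ℕ := s.nat (vreg x)

theorem idxExp_eval (s : State) (i : Option ℕ) : (idxExp i).eval s = idxVal s.env i := by
  cases i <;> rfl

theorem idxExp_cost (i : Option ℕ) : (idxExp i).cost = 1 := by cases i <;> rfl

/-- The temporary cell with number `d`. -/
def tcell (d : ℕ) : RExp := RExp.cell 4 (NExp.const d) (NExp.const 0)

def setT (d : ℕ) (e : RExp) : Cmd := Cmd.setReal 4 (NExp.const d) (NExp.const 0) e

/-- Code that leaves the value of an expression in the temporary cell `d`. -/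
def RE.code : RE → ℕ → ℕ → Cmd
  | const q, _, d => setT d (RExp.const q)
  | size, _, d => setT d (RExp.ofNat (NExp.var 0))
  | idx x, _, d => setT d (RExp.ofNat (NExp.var (vreg x)))
  | cell a i j, _, d => setT d (RExp.cell a (idxExp i) (idxExp j))
  | add e f, l, d => Cmd.seq (e.code l d) (Cmd.seq (f.code l (d + 1))
      (setT d (RExp.add (tcell d) (tcell (d + 1)))))
  | sub e f, l, d => Cmd.seq (e.code l d) (Cmd.seq (f.code l (d + 1))
      (setT d (RExp.sub (tcell d) (tcell (d + 1)))))
  | mul e f, l, d => Cmd.seq (e.code l d) (Cmd.seq (f.code l (d + 1))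
      (setT d (RExp.mul (tcell d) (tcell (d + 1)))))
  | div e f, l, d => Cmd.seq (e.code l d) (Cmd.seq (f.code l (d + 1))
      (setT d (RExp.div (tcell d) (tcell (d + 1)))))
  | exp e, l, d => Cmd.seq (e.code l d) (setT d (RExp.exp (tcell d)))
  | log e, l, d => Cmd.seq (e.code l d) (setT d (RExp.log (tcell d)))
  | ifLt e f g h, l, d => Cmd.seq (e.code l d) (Cmd.seq (f.code l (d + 1))
      (Cmd.ite (Cond.realLt (tcell d) (tcell (d + 1))) (g.code l d) (h.code l d)))
  | sum e, l, d => Cmd.seq (setT d (RExp.const 0))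
      (forLoop (vreg l) (Cmd.seq (e.code (l + 1) (d + 1))
        (setT d (RExp.add (tcell d) (tcell (d + 1))))))

/-- A bound on the number of steps of the code of an expression. -/
def RE.bound (T : ℕ) : RE → ℕ
  | const _ => 10
  | size => 10
  | idx _ => 10
  | cell _ _ _ => 10
  | add e f => e.bound T + f.bound T + 20
  | sub e f => e.bound T + f.bound T + 20
  | mul e f => e.bound T + f.bound T + 20
  | div e f => e.bound T + f.bound T + 20
  | exp e => e.bound T + 20
  | log e => e.bound T + 20
  | ifLt e f g h => e.bound T + f.bound T + (g.bound T + h.bound T) + 20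
  | sum e => T * (e.bound T + 30) + 20

/-- `s'` agrees with `s` except for temporary cells from `d` on and index variables from `l` on. -/
structure Frame (l d : ℕ) (s s' : State) : Prop where
  real : ∀ a, a ≠ 4 → s'.real a = s.real a
  temp : ∀ i < d, ∀ j, s'.real 4 i j = s.real 4 i j
  nat : ∀ x, x < vreg l ∨ x % 2 = 1 → s'.nat x = s.nat x

theorem Frame.trans {l d : ℕ} {s s' s'' : State} (h : Frame l d s s') (h' : Frame l d s' s'') :
    Frame l d s s'' :=
  ⟨fun a ha => (h'.real a ha).trans (h.real a ha), fun i hi j => (h'.temp i hi j).trans (h.temp i hi j),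
    fun x hx => (h'.nat x hx).trans (h.nat x hx)⟩

theorem Frame.weaken {l l' d d' : ℕ} {s s' : State} (h : Frame l d s s') (hl : l' ≤ l)
    (hd : d' ≤ d) : Frame l' d' s s' :=
  ⟨h.real, fun i hi j => h.temp i (by omega) j, fun x hx => h.nat x (by
    unfold vreg at hx ⊢; omega)⟩

theorem Frame.env {l d : ℕ} {s s' : State} (h : Frame l d s s') : ∀ x < l, s'.env x = s.env x :=
  fun x hx => h.nat _ (Or.inl (by unfold vreg; omega))

theorem Frame.zero {l d : ℕ} {s s' : State} (h : Frame l d s s') : s'.nat 0 = s.nat 0 :=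
  h.nat 0 (Or.inl (by unfold vreg; omega))

theorem frame_setT (l d : ℕ) (s : State) (z : ℝ) : Frame l d s (s.setReal 4 d 0 z) :=
  ⟨fun a ha => State.setReal_real_of_ne _ _ _ _ ha, fun i hi j => by
    simp only [State.setReal]; rw [if_neg]; omega, fun _ _ => rfl⟩

theorem runs_setT {s : State} {d : ℕ} {e : RExp} {Q : State → Prop}
    (h : Q (s.setReal 4 d 0 (e.eval s))) : Runs O (setT d e) s (e.cost + 3) Q :=
  (runs_setReal (i := NExp.const d) (j := NExp.const 0) h).mono (by simp [NExp.cost]; omega)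
    fun _ h => h

/-- The postcondition of the code of an expression. -/
def Post (T : ℕ) (e : RE) (l d : ℕ) (s s' : State) : Prop :=
  Frame l d s s' ∧ s'.real 4 d 0 = e.eval T s.real l s.env

theorem eval_of_frame {T : ℕ} {e : RE} {l l' d : ℕ} {s s' : State} (hr : e.Reads (· ≠ 4))
    (hc : e.Closed l) (h : Frame l' d s s') (hl : l ≤ l') :
    e.eval T s'.real l s'.env = e.eval T s.real l s.env :=
  RE.eval_congr (p := (· ≠ 4)) (fun a ha => h.real a ha) e hr hc
    fun x hx => h.env x (by omega)

theorem runs_binary {T l d B B' : ℕ} {e f : RE} {g : RExp → RExp → RExp} {op : ℝ → ℝ → ℝ} {s : State}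
    (hg : ∀ s e f, (g e f).eval s = op (e.eval s) (f.eval s))
    (hcost : ∀ e f, (g e f).cost = e.cost + f.cost + 1)
    (hrf : f.Reads (· ≠ 4)) (hcf : f.Closed l)
    (he : Runs O (e.code l d) s B (Post T e l d s))
    (hf : ∀ s', Frame l d s s' → Runs O (f.code l (d + 1)) s' B' (Post T f l (d + 1) s')) :
    Runs O (Cmd.seq (e.code l d) (Cmd.seq (f.code l (d + 1)) (setT d (g (tcell d) (tcell (d + 1))))))
      s (B + B' + 20) fun s' => Frame l d s s' ∧
        s'.real 4 d 0 = op (e.eval T s.real l s.env) (f.eval T s.real l s.env) := by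
  refine (Runs.seq he fun s1 h1 => Runs.seq (hf s1 h1.1) fun s2 h2 =>
    runs_setT (Q := fun s' => Frame l d s s' ∧
        s'.real 4 d 0 = op (e.eval T s.real l s.env) (f.eval T s.real l s.env)) ?_).mono ?_
    fun _ h => h
  · refine ⟨(h1.1.trans (h2.1.weaken le_rfl (by omega))).trans (frame_setT _ _ _ _), ?_⟩
    rw [State.setReal_real_self, hg]
    have e1 : (tcell d).eval s2 = s2.real 4 d 0 := rfl
    have e2 : (tcell (d + 1)).eval s2 = s2.real 4 (d + 1) 0 := rfl
    rw [e1, e2, h2.1.temp d (by omega), h1.2, h2.2, eval_of_frame hrf hcf h1.1 le_rfl]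
  · rw [hcost]
    simp only [tcell, RExp.cost, NExp.cost]
    omega

/-- Temporary cells are used as a stack of height `d`, and the loop variables of sums as a stack of
height `l`. Expressions may not read array `4`, which holds the former. -/
theorem RE.code_runs {T : ℕ} : ∀ (e : RE) (l d : ℕ) (s : State), e.Reads (· ≠ 4) → e.Closed l →
    s.nat 0 = T → Runs O (e.code l d) s (e.bound T) (Post T e l d s)
  | const q, l, d, s, _, _, _ =>
    (runs_setT (Q := Post T (const q) l d s) ⟨frame_setT _ _ _ _, by
      rw [State.setReal_real_self]; rfl⟩).mono (by simp [bound, RExp.cost]) fun _ h => h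
  | size, l, d, s, _, _, hT =>
    (runs_setT (Q := Post T size l d s) ⟨frame_setT _ _ _ _, by
      rw [State.setReal_real_self]; simp [RExp.eval, NExp.eval, RE.eval, hT]⟩).mono
        (by simp [bound, RExp.cost, NExp.cost]) fun _ h => h
  | idx x, l, d, s, _, _, _ =>
    (runs_setT (Q := Post T (idx x) l d s) ⟨frame_setT _ _ _ _, by
      rw [State.setReal_real_self]; rfl⟩).mono (by simp [bound, RExp.cost, NExp.cost]) fun _ h => h
  | cell a i j, l, d, s, _, _, _ =>
    (runs_setT (Q := Post T (cell a i j) l d s) ⟨frame_setT _ _ _ _, by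
      rw [State.setReal_real_self]; simp only [RExp.eval, idxExp_eval, RE.eval]⟩).mono
        (by simp [bound, RExp.cost, idxExp_cost]) fun _ h => h
  | add e f, l, d, s, hr, hc, hT =>
    runs_binary (fun _ _ _ => rfl) (fun _ _ => rfl) hr.2 hc.2 (code_runs e l d s hr.1 hc.1 hT)
      fun s' h => code_runs f l (d + 1) s' hr.2 hc.2 (h.zero.trans hT)
  | sub e f, l, d, s, hr, hc, hT =>
    runs_binary (fun _ _ _ => rfl) (fun _ _ => rfl) hr.2 hc.2 (code_runs e l d s hr.1 hc.1 hT)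
      fun s' h => code_runs f l (d + 1) s' hr.2 hc.2 (h.zero.trans hT)
  | mul e f, l, d, s, hr, hc, hT =>
    runs_binary (fun _ _ _ => rfl) (fun _ _ => rfl) hr.2 hc.2 (code_runs e l d s hr.1 hc.1 hT)
      fun s' h => code_runs f l (d + 1) s' hr.2 hc.2 (h.zero.trans hT)
  | div e f, l, d, s, hr, hc, hT =>
    runs_binary (fun _ _ _ => rfl) (fun _ _ => rfl) hr.2 hc.2 (code_runs e l d s hr.1 hc.1 hT)
      fun s' h => code_runs f l (d + 1) s' hr.2 hc.2 (h.zero.trans hT)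
  | exp e, l, d, s, hr, hc, hT =>
    (Runs.seq (code_runs e l d s hr hc hT) fun s1 h1 =>
      runs_setT (Q := Post T (exp e) l d s) ⟨h1.1.trans (frame_setT _ _ _ _), by
        rw [State.setReal_real_self]
        simp only [tcell, RExp.eval, NExp.eval, RE.eval, h1.2]⟩).mono
      (by simp only [bound, RExp.cost, tcell, NExp.cost]; omega) fun _ h => h
  | log e, l, d, s, hr, hc, hT =>
    (Runs.seq (code_runs e l d s hr hc hT) fun s1 h1 =>
      runs_setT (Q := Post T (log e) l d s) ⟨h1.1.trans (frame_setT _ _ _ _), by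
        rw [State.setReal_real_self]
        simp only [tcell, RExp.eval, NExp.eval, RE.eval, h1.2]⟩).mono
      (by simp only [bound, RExp.cost, tcell, NExp.cost]; omega) fun _ h => h
  | ifLt e f g k, l, d, s, hr, hc, hT => by
    refine (Runs.seq (code_runs e l d s hr.1 hc.1 hT) fun s1 h1 =>
      Runs.seq (code_runs f l (d + 1) s1 hr.2.1 hc.2.1 (h1.1.zero.trans hT)) fun s2 h2 =>
        runs_ite (B := g.bound T) (B' := k.bound T) (Q := Post T (ifLt e f g k) l d s)
          (fun hb => ?_) fun hb => ?_).mono ?_ fun _ h => h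
    all_goals try
      have hF : Frame l d s s2 := h1.1.trans (h2.1.weaken le_rfl (by omega))
      have hb' : (Cond.realLt (tcell d) (tcell (d + 1))).Holds s2 ↔
          e.eval T s.real l s.env < f.eval T s.real l s.env := by
        change s2.real 4 d 0 < s2.real 4 (d + 1) 0 ↔ _
        rw [h2.1.temp d (by omega), h1.2, h2.2, eval_of_frame hr.2.1 hc.2.1 h1.1 le_rfl]
      rw [hb'] at hb
    · refine (code_runs g l d s2 hr.2.2.1 hc.2.2.1 (hF.zero.trans hT)).mono le_rfl
        fun s3 h3 => ⟨hF.trans h3.1, ?_⟩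
      rw [h3.2, eval_of_frame hr.2.2.1 hc.2.2.1 hF le_rfl]
      simp only [RE.eval, if_pos hb]
    · refine (code_runs k l d s2 hr.2.2.2 hc.2.2.2 (hF.zero.trans hT)).mono le_rfl
        fun s3 h3 => ⟨hF.trans h3.1, ?_⟩
      rw [h3.2, eval_of_frame hr.2.2.2 hc.2.2.2 hF le_rfl]
      simp only [RE.eval, if_neg hb]
    · simp only [bound, Cond.cost, tcell, RExp.cost, NExp.cost]
      omega
  | sum e, l, d, s, hr, hc, hT => by
    refine (Runs.seq (runs_setT (Q := fun s' => Frame l d s s' ∧ s'.real 4 d 0 = 0)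
      ⟨frame_setT _ _ _ _, by rw [State.setReal_real_self]; simp [RExp.eval]⟩) fun s1 h1 =>
      forLoop_runs (T := T) (B := e.bound T + 16)
        (fun k s' => Frame l d s s' ∧ s'.real 4 d 0 =
          ∑ j ∈ Finset.range k, e.eval T s.real (l + 1) (Function.update s.env l j)) ?_ ?_ ?_).mono
      ?_ ?_
    · refine ⟨h1.1.trans ⟨fun _ _ => rfl, fun _ _ _ => rfl, fun x hx => ?_⟩, ?_⟩
      · exact State.setNat_nat_of_ne _ _ (by unfold vreg at hx ⊢; omega)
      · rw [State.setNat_real, h1.2]; simp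
    · exact fun k s' h => h.1.zero.trans hT
    · intro k hk s' h hreg
      refine (Runs.seq (code_runs e (l + 1) (d + 1) s' hr hc (h.1.zero.trans hT)) fun s2 h2 =>
        runs_setT (Q := fun s2 => s2.nat (vreg l) = k ∧ Frame l d s (s2.setNat (vreg l) (k + 1)) ∧
          (s2.setNat (vreg l) (k + 1)).real 4 d 0 = ∑ j ∈ Finset.range (k + 1),
            e.eval T s.real (l + 1) (Function.update s.env l j)) ?_).mono ?_ fun _ h => h
      · refine ⟨?_, ?_, ?_⟩
        · rw [State.setReal_nat, h2.1.nat _ (Or.inl (by unfold vreg; omega)), hreg]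
        · refine (h.1.trans (h2.1.weaken (by omega) (by omega))).trans
            ((frame_setT _ _ _ _).trans ⟨fun _ _ => rfl, fun _ _ _ => rfl, fun x hx => ?_⟩)
          exact State.setNat_nat_of_ne _ _ (by unfold vreg at hx ⊢; omega)
        · rw [State.setNat_real, State.setReal_real_self, Finset.sum_range_succ]
          change s2.real 4 d 0 + s2.real 4 (d + 1) 0 = _
          rw [h2.1.temp d (by omega), h.2, h2.2]
          congr 1
          refine RE.eval_congr (p := (· ≠ 4)) (fun a ha => h.1.real a ha) e hr hc fun x hx => ?_
          by_cases hxl : x = l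
          · subst hxl
            rw [Function.update_self]
            exact hreg
          · rw [Function.update_of_ne hxl]
            exact h.1.env x (by omega)
      · simp only [RExp.cost, tcell, NExp.cost]
        omega
    · simp only [bound, RExp.cost]
      have : T * (e.bound T + 16 + 10) ≤ T * (e.bound T + 30) := Nat.mul_le_mul_left _ (by omega)
      omega
    · exact fun s' h => h

end Compiler

end SwapRegret

namespace SwapRegret

/-! ### Array programs: semantics, compilation and polynomial bounds. -/

section Programs

/-- Programs on `T × T` arrays: simultaneous assignment to an array, queries at computed points,
composition, and `T`-fold repetition. Variables `0` and `1` are the row and the column. -/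
inductive Prog where
  | map (a : ℕ) (e : RE)
  | ask (a : ℕ) (q : Query) (e : RE)
  | seq (p p' : Prog)
  | rep (p : Prog)

/-- The environment of an array entry. -/
def entry (i j : ℕ) : ℕ → ℕ := fun x => if x = 0 then i else j

open Classical in
/-- Assignment to the first `T` rows and columns of an array. -/
noncomputable def Mem.fill (T : ℕ) (m : Mem) (a : ℕ) (f : ℕ → ℕ → ℝ) : Mem :=
  fun a' i j => if a' = a ∧ i < T ∧ j < T then f i j else m a' i j

noncomputable def Prog.denote (T : ℕ) (O : Query → ℝ → ℝ) : Prog → Mem → Mem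
  | map a e, m => m.fill T a fun i j => e.eval T m 2 (entry i j)
  | ask a q e, m => m.fill T a fun i j => O q (e.eval T m 2 (entry i j))
  | seq p p', m => p'.denote T O (p.denote T O m)
  | rep p, m => (p.denote T O)^[T] m

/-- The arrays that programs may use; arrays `1` to `3` are for output, `4` and `5` are internal. -/
def Visible (a : ℕ) : Prop := a = 0 ∨ 6 ≤ a

def Prog.Ok : Prog → Prop
  | map a e => 6 ≤ a ∧ e.Reads Visible ∧ e.Closed 2
  | ask a _ e => 6 ≤ a ∧ e.Reads Visible ∧ e.Closed 2
  | seq p p' => p.Ok ∧ p'.Ok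
  | rep p => p.Ok

def forLoop₂ (body : Cmd) : Cmd := forLoop (vreg 0) (forLoop (vreg 1) body)

/-- Copy the staging array. -/
def copyTo (a : ℕ) : Cmd :=
  forLoop₂ (Cmd.setReal a (NExp.var (vreg 0)) (NExp.var (vreg 1))
    (RExp.cell 5 (NExp.var (vreg 0)) (NExp.var (vreg 1))))

/-- Results are first written to the staging array `5`, so that all entries are computed from the
old contents even if the target occurs in the expression. Repetition counters are odd registers from
`3` on, one per nesting depth; index variables use even registers and register `1` is kept for the
output. -/
def Prog.code : Prog → ℕ → Cmd
  | map a e, _ => Cmd.seq (forLoop₂ (Cmd.seq (e.code 2 0)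
      (Cmd.setReal 5 (NExp.var (vreg 0)) (NExp.var (vreg 1)) (tcell 0)))) (copyTo a)
  | ask a q e, _ => Cmd.seq (forLoop₂ (Cmd.seq (e.code 2 0)
      (Cmd.ask 5 (NExp.var (vreg 0)) (NExp.var (vreg 1)) q (tcell 0)))) (copyTo a)
  | seq p p', c => Cmd.seq (p.code c) (p'.code c)
  | rep p, c => forLoop (2 * c + 3) (p.code (c + 1))

def loopBound (T B : ℕ) : ℕ := T * (B + 10) + 10

def Prog.bound (T : ℕ) : Prog → ℕ
  | map _ e => loopBound T (loopBound T (e.bound T + 10)) + loopBound T (loopBound T 10) + 1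
  | ask _ _ e => loopBound T (loopBound T (e.bound T + 10)) + loopBound T (loopBound T 10) + 1
  | seq p p' => p.bound T + p'.bound T + 1
  | rep p => loopBound T (p.bound T)

/-- `s'` agrees with `s` except for temporary cells, the array `a`, and even registers. -/
structure Keeps (a : ℕ) (s s' : State) : Prop where
  real : ∀ a', a' ≠ 4 → a' ≠ a → s'.real a' = s.real a'
  nat : ∀ x, x = 0 ∨ x % 2 = 1 → s'.nat x = s.nat x

theorem Keeps.trans {a : ℕ} {s s' s'' : State} (h : Keeps a s s') (h' : Keeps a s' s'') :
    Keeps a s s'' :=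
  ⟨fun b hb hb' => (h'.real b hb hb').trans (h.real b hb hb'),
    fun x hx => (h'.nat x hx).trans (h.nat x hx)⟩

theorem keeps_setNat (a : ℕ) (s : State) (x n : ℕ) : Keeps a s (s.setNat (vreg x) n) :=
  ⟨fun _ _ _ => rfl, fun y hy => State.setNat_nat_of_ne _ _ (by unfold vreg; omega)⟩

variable {O : Query → ℝ → ℝ}

open Classical in
theorem forLoop₂_runs {T B a : ℕ} {body : Cmd} {val : ℕ → ℕ → ℝ} {s : State} (hT : s.nat 0 = T)
    (hbody : ∀ s', Keeps a s s' → ∀ i < T, ∀ j < T, s'.nat (vreg 0) = i → s'.nat (vreg 1) = j →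
      Runs O body s' B fun s'' => Keeps a s' s'' ∧ s''.nat (vreg 0) = i ∧ s''.nat (vreg 1) = j ∧
        ∀ i' j', s''.real a i' j' = if i' = i ∧ j' = j then val i j else s'.real a i' j') :
    Runs O (forLoop₂ body) s (loopBound T (loopBound T B)) fun s' => Keeps a s s' ∧
      ∀ i j, s'.real a i j = if i < T ∧ j < T then val i j else s.real a i j := by
  refine (forLoop_runs (T := T) (B := loopBound T B) (fun k s' => Keeps a s s' ∧
    ∀ i j, s'.real a i j = if i < k ∧ j < T then val i j else s.real a i j) ?_ ?_ ?_)
  · exact ⟨keeps_setNat _ _ _ _, fun i j => by simp [State.setNat_real]⟩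
  · exact fun k s' h => (h.1.nat 0 (Or.inl rfl)).trans hT
  · intro k hk s1 h1 hr
    refine (forLoop_runs (T := T) (B := B) (fun l s' => Keeps a s s' ∧ s'.nat (vreg 0) = k ∧
      ∀ i j, s'.real a i j = if (i < k ∧ j < T) ∨ (i = k ∧ j < l) then val i j
        else s.real a i j) ?_ ?_ ?_).mono le_rfl ?_
    · refine ⟨h1.1.trans (keeps_setNat _ _ _ _), ?_, fun i j => ?_⟩
      · rw [State.setNat_nat_of_ne _ _ (by unfold vreg; omega), hr]
      · simp [State.setNat_real, h1.2]
    · exact fun k s' h => (h.1.nat 0 (Or.inl rfl)).trans hT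
    · intro l hl s2 h2 hr2
      refine (hbody s2 h2.1 k hk l hl h2.2.1 hr2).mono le_rfl fun s3 h3 => ⟨h3.2.2.1,
        h2.1.trans (h3.1.trans (keeps_setNat _ _ _ _)), ?_, fun i j => ?_⟩
      · rw [State.setNat_nat_of_ne _ _ (by unfold vreg; omega), h3.2.1]
      · rw [State.setNat_real, h3.2.2.2, h2.2.2]
        by_cases hij : i = k ∧ j = l
        · obtain ⟨rfl, rfl⟩ := hij
          simp
        · rw [if_neg hij]
          refine if_congr ?_ rfl rfl
          omega
    · intro s2 h2
      refine ⟨h2.2.1, h2.1.trans (keeps_setNat _ _ _ _), fun i j => ?_⟩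
      rw [State.setNat_real, h2.2.2]
      refine if_congr ?_ rfl rfl
      omega

theorem keeps_setReal (a : ℕ) (s : State) (i j : ℕ) (z : ℝ) : Keeps a s (s.setReal a i j z) :=
  ⟨fun _ _ hb => State.setReal_real_of_ne _ _ _ _ hb, fun _ _ => rfl⟩

theorem Frame.keeps {l d : ℕ} {s s' : State} (h : Frame l d s s') (a : ℕ) : Keeps a s s' :=
  ⟨fun _ hb _ => h.real _ hb, fun x hx => h.nat x (by unfold vreg; omega)⟩

open Classical in
theorem setReal_real_apply (s : State) (a i j : ℕ) (z : ℝ) (i' j' : ℕ) :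
    (s.setReal a i j z).real a i' j' = if i' = i ∧ j' = j then z else s.real a i' j' := by
  simp [State.setReal]

theorem copyTo_runs {T a : ℕ} {s : State} (ha : 6 ≤ a) (hT : s.nat 0 = T) :
    Runs O (copyTo a) s (loopBound T (loopBound T 10)) fun s' => Keeps a s s' ∧
      s'.real a = Mem.fill T s.real a (s.real 5) a := by
  refine (forLoop₂_runs (val := s.real 5) hT ?_).mono le_rfl fun s' h => ⟨h.1, ?_⟩
  · intro s' h i hi j hj hri hrj
    refine (runs_setReal (Q := fun s'' => Keeps a s' s'' ∧ s''.nat (vreg 0) = i ∧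
      s''.nat (vreg 1) = j ∧ ∀ i' j', s''.real a i' j' =
        if i' = i ∧ j' = j then s.real 5 i j else s'.real a i' j') ?_).mono ?_ fun _ h => h
    · simp only [NExp.eval, RExp.eval, hri, hrj]
      refine ⟨keeps_setReal _ _ _ _ _, hri, hrj, fun i' j' => ?_⟩
      rw [setReal_real_apply, h.real 5 (by omega) (by omega)]
    · simp [NExp.cost, RExp.cost]
  · funext i j
    rw [h.2]
    simp [Mem.fill]

/-- The visible memory of a state is `m`. -/
def Agrees (T : ℕ) (s : State) (m : Mem) : Prop := s.nat 0 = T ∧ ∀ a, Visible a → s.real a = m a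

theorem eval_agrees {T : ℕ} {s s' : State} {m : Mem} {e : RE} (hs : Agrees T s m)
    (hr : e.Reads Visible) (hc : e.Closed 2) (h : Keeps 5 s s') :
    e.eval T s'.real 2 s'.env = e.eval T m 2 (entry (s'.nat (vreg 0)) (s'.nat (vreg 1))) := by
  refine RE.eval_congr (p := Visible) (fun a ha => ?_) e hr hc fun x hx => ?_
  · rw [h.real a (by unfold Visible at ha; omega) (by unfold Visible at ha; omega), hs.2 a ha]
  · interval_cases x <;> rfl

theorem RE.Reads.mono {p q : ℕ → Prop} (hpq : ∀ a, p a → q a) : ∀ {e : RE}, e.Reads p → e.Reads q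
  | const _, _ => trivial
  | size, _ => trivial
  | idx _, _ => trivial
  | cell _ _ _, h => hpq _ h
  | add _ _, h => ⟨h.1.mono hpq, h.2.mono hpq⟩
  | sub _ _, h => ⟨h.1.mono hpq, h.2.mono hpq⟩
  | mul _ _, h => ⟨h.1.mono hpq, h.2.mono hpq⟩
  | div _ _, h => ⟨h.1.mono hpq, h.2.mono hpq⟩
  | exp e, h => Reads.mono (e := e) hpq h
  | log e, h => Reads.mono (e := e) hpq h
  | ifLt _ _ _ _, h => ⟨h.1.mono hpq, h.2.1.mono hpq, h.2.2.1.mono hpq, h.2.2.2.mono hpq⟩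
  | sum e, h => Reads.mono (e := e) hpq h

/-- The postcondition of programs at nesting depth `c`. -/
def ProgPost (T c : ℕ) (m : Mem) (s s' : State) : Prop :=
  Agrees T s' m ∧ ∀ x, x % 2 = 1 → x < 2 * c + 3 → s'.nat x = s.nat x

/-- Assignments and queries differ only in the command `w` that stores the computed value, passed
through `g`. Filling the staging array leaves the visible memory intact. -/
theorem staged_runs {T a c : ℕ} {e : RE} {s : State} {m : Mem} {g : ℝ → ℝ} {w : Cmd} (ha : 6 ≤ a)
    (hr : e.Reads Visible) (hc : e.Closed 2) (hs : Agrees T s m)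
    (hw : ∀ s, Runs O w s 9 fun s' =>
      s' = s.setReal 5 (s.nat (vreg 0)) (s.nat (vreg 1)) (g (s.real 4 0 0))) :
    Runs O (Cmd.seq (forLoop₂ (Cmd.seq (e.code 2 0) w)) (copyTo a)) s
      (loopBound T (loopBound T (e.bound T + 10)) + loopBound T (loopBound T 10) + 1)
      (ProgPost T c (m.fill T a fun i j => g (e.eval T m 2 (entry i j))) s) := by
  refine Runs.seq (forLoop₂_runs (a := 5) (val := fun i j => g (e.eval T m 2 (entry i j)))
    hs.1 ?_) fun s1 h1 => (copyTo_runs ha ((h1.1.nat 0 (Or.inl rfl)).trans hs.1)).mono le_rfl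
      fun s2 h2 => ?_
  · intro s' h i hi j hj hri hrj
    have h0 : s'.nat 0 = T := (h.nat 0 (Or.inl rfl)).trans hs.1
    refine (Runs.seq (RE.code_runs e 2 0 s' (hr.mono fun a ha => by unfold Visible at ha; omega)
      hc h0) fun s2 h2 => (hw s2).mono (Q' := fun s'' => Keeps 5 s' s'' ∧ s''.nat (vreg 0) = i ∧
      s''.nat (vreg 1) = j ∧ ∀ i' j', s''.real 5 i' j' =
        if i' = i ∧ j' = j then g (e.eval T m 2 (entry i j)) else s'.real 5 i' j') le_rfl ?_).mono
      (by omega) fun _ h => h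
    rintro _ rfl
    have e0 : s2.nat (vreg 0) = i := (h2.1.env 0 (by omega)).trans hri
    have e1 : s2.nat (vreg 1) = j := (h2.1.env 1 (by omega)).trans hrj
    rw [e0, e1]
    refine ⟨(h2.1.keeps 5).trans (keeps_setReal _ _ _ _ _), e0, e1, fun i' j' => ?_⟩
    rw [setReal_real_apply, h2.2, h2.1.real 5 (by omega), eval_agrees hs hr hc h, hri, hrj]
  · refine ⟨⟨(h2.1.nat 0 (Or.inl rfl)).trans ((h1.1.nat 0 (Or.inl rfl)).trans hs.1), ?_⟩, ?_⟩
    · intro a' ha'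
      have hv : a' = 0 ∨ 6 ≤ a' := ha'
      by_cases haa : a' = a
      · subst haa
        rw [h2.2]
        funext i j
        simp only [Mem.fill, h1.2]
        by_cases hij : i < T ∧ j < T
        · simp [hij]
        · simp only [hij, and_false, if_false]
          rw [h1.1.real a' (by omega) (by omega), hs.2 a' ha']
      · rw [h2.1.real a' (by omega) haa, h1.1.real a' (by omega) (by omega), hs.2 a' ha']
        funext i j
        simp [Mem.fill, haa]
    · exact fun x hx _ => (h2.1.nat x (Or.inr hx)).trans (h1.1.nat x (Or.inr hx))

/-- For repetition, the body is compiled at depth `c + 1` and so preserves the odd registers below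
`2c + 5`, in particular its own counter `2c + 3`. -/
theorem Prog.code_runs {T : ℕ} : ∀ (p : Prog) (c : ℕ) (s : State) (m : Mem), p.Ok → Agrees T s m →
    Runs O (p.code c) s (p.bound T) (ProgPost T c (p.denote T O m) s)
  | map a e, c, s, m, hp, hs =>
    staged_runs (g := fun z => z) hp.1 hp.2.1 hp.2.2 hs fun s =>
      (runs_setReal (Q := fun s' => s' = s.setReal 5 (s.nat (vreg 0)) (s.nat (vreg 1))
        (s.real 4 0 0)) rfl).mono (by simp [NExp.cost, RExp.cost, tcell]) fun _ h => h
  | ask a q e, c, s, m, hp, hs =>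
    staged_runs (g := O q) hp.1 hp.2.1 hp.2.2 hs fun s =>
      (runs_ask (Q := fun s' => s' = s.setReal 5 (s.nat (vreg 0)) (s.nat (vreg 1))
        (O q (s.real 4 0 0))) rfl).mono (by simp [NExp.cost, RExp.cost, tcell]) fun _ h => h
  | seq p p', c, s, m, hp, hs =>
    Runs.seq (code_runs p c s m hp.1 hs) fun s1 h1 =>
      (code_runs p' c s1 _ hp.2 h1.1).mono le_rfl fun _ h2 =>
        ⟨h2.1, fun x hx hx' => (h2.2 x hx hx').trans (h1.2 x hx hx')⟩
  | rep p, c, s, m, hp, hs => by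
    refine forLoop_runs (T := T) (B := p.bound T)
      (fun k s' => ProgPost T c ((p.denote T O)^[k] m) s s') ?_ (fun k s' h => h.1.1) ?_
    · exact ⟨⟨by rw [State.setNat_nat_of_ne _ _ (by omega)]; exact hs.1, hs.2⟩,
        fun x _ hx' => State.setNat_nat_of_ne _ _ (by omega)⟩
    · intro k hk s1 h1 hr
      refine (code_runs p (c + 1) s1 _ hp h1.1).mono le_rfl fun s2 h2 => ⟨?_, ?_, ?_⟩
      · rw [h2.2 _ (by omega) (by omega), hr]
      · rw [Function.iterate_succ_apply']
        exact ⟨by rw [State.setNat_nat_of_ne _ _ (by omega)]; exact h2.1.1, h2.1.2⟩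
      · intro x hx hx'
        rw [State.setNat_nat_of_ne _ _ (by omega), h2.2 x hx (by omega), h1.2 x hx hx']

/-- Polynomially bounded functions. -/
def PolyBdd (f : ℕ → ℕ) : Prop := ∃ c k : ℕ, ∀ T, 1 ≤ T → f T ≤ c * T ^ k

theorem PolyBdd.add {f g : ℕ → ℕ} (hf : PolyBdd f) (hg : PolyBdd g) :
    PolyBdd fun T => f T + g T := by
  obtain ⟨c, k, h⟩ := hf
  obtain ⟨c', k', h'⟩ := hg
  refine ⟨c + c', k + k', fun T hT => ?_⟩
  have h1 : T ^ k ≤ T ^ (k + k') := Nat.pow_le_pow_right hT (by omega)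
  have h2 : T ^ k' ≤ T ^ (k + k') := Nat.pow_le_pow_right hT (by omega)
  nlinarith [h T hT, h' T hT, Nat.mul_le_mul_left c h1, Nat.mul_le_mul_left c' h2]

theorem PolyBdd.const (n : ℕ) : PolyBdd fun _ => n := ⟨n, 0, fun T _ => by simp⟩

theorem PolyBdd.size_mul {f : ℕ → ℕ} (hf : PolyBdd f) : PolyBdd fun T => T * f T := by
  obtain ⟨c, k, h⟩ := hf
  refine ⟨c, k + 1, fun T hT => ?_⟩
  calc T * f T ≤ T * (c * T ^ k) := Nat.mul_le_mul_left _ (h T hT)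
    _ = _ := by ring

theorem PolyBdd.loop {f : ℕ → ℕ} (hf : PolyBdd f) : PolyBdd fun T => loopBound T (f T) :=
  ((hf.add (.const 10)).size_mul).add (.const 10)

theorem RE.bound_poly : ∀ e : RE, PolyBdd fun T => e.bound T
  | const _ => .const _
  | size => .const _
  | idx _ => .const _
  | cell _ _ _ => .const _
  | add e f => (e.bound_poly.add f.bound_poly).add (.const _)
  | sub e f => (e.bound_poly.add f.bound_poly).add (.const _)
  | mul e f => (e.bound_poly.add f.bound_poly).add (.const _)
  | div e f => (e.bound_poly.add f.bound_poly).add (.const _)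
  | exp e => e.bound_poly.add (.const _)
  | log e => e.bound_poly.add (.const _)
  | ifLt e f g h =>
    ((e.bound_poly.add f.bound_poly).add (g.bound_poly.add h.bound_poly)).add (.const _)
  | sum e => (e.bound_poly.add (.const _)).size_mul.add (.const _)

theorem Prog.bound_poly : ∀ p : Prog, PolyBdd fun T => p.bound T
  | map _ e => (((e.bound_poly.add (.const _)).loop.loop).add (PolyBdd.const _).loop.loop).add
      (.const _)
  | ask _ _ e => (((e.bound_poly.add (.const _)).loop.loop).add (PolyBdd.const _).loop.loop).add
      (.const _)
  | seq p p' => (p.bound_poly.add p'.bound_poly).add (.const _)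
  | rep p => p.bound_poly.loop

end Programs

end SwapRegret

namespace SwapRegret

/-! ### Output of the distribution and the machine of a pair of programs. -/

section Machines

variable {O : Query → ℝ → ℝ}

/-- Output of the entries `x`, `y` of three arrays, register `1` counting the entries. -/
def emit (aR aB aK : ℕ) : Cmd :=
  Cmd.seq (Cmd.setReal 1 (NExp.var 1) (NExp.const 0)
      (RExp.cell aR (NExp.var (vreg 0)) (NExp.var (vreg 1))))
    (Cmd.seq (Cmd.setReal 2 (NExp.var 1) (NExp.const 0)
        (RExp.cell aB (NExp.var (vreg 0)) (NExp.var (vreg 1))))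
      (Cmd.seq (Cmd.setReal 3 (NExp.var 1) (NExp.const 0)
          (RExp.cell aK (NExp.var (vreg 0)) (NExp.var (vreg 1))))
        (Cmd.setNat 1 (NExp.add (NExp.var 1) (NExp.const 1)))))

def output (aR aB aK : ℕ) : Cmd :=
  Cmd.seq (Cmd.setNat 1 (NExp.const 0)) (forLoop₂ (emit aR aB aK))

/-- The first `n` entries of the output. -/
structure Emitted (T n : ℕ) (R B K : ℕ → ℕ → ℝ) (s : State) : Prop where
  count : s.nat 1 = n
  fst : ∀ j < n, s.real 1 j 0 = R (j / T) (j % T)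
  snd : ∀ j < n, s.real 2 j 0 = B (j / T) (j % T)
  prob : ∀ j < n, s.real 3 j 0 = K (j / T) (j % T)

theorem Emitted.setNat {T n x k : ℕ} {R B K : ℕ → ℕ → ℝ} {s : State} (h : Emitted T n R B K s)
    (hx : x ≠ 1) : Emitted T n R B K (s.setNat x k) :=
  ⟨by rw [State.setNat_nat_of_ne _ _ hx.symm]; exact h.count, h.fst, h.snd, h.prob⟩

theorem Agrees.setNat {T x k : ℕ} {s : State} {m : Mem} (h : Agrees T s m) (hx : x ≠ 0) :
    Agrees T (s.setNat x k) m :=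
  ⟨by rw [State.setNat_nat_of_ne _ _ hx.symm]; exact h.1, h.2⟩

theorem emit_runs {T i j aR aB aK : ℕ} {s : State} {m : Mem} (hR : Visible aR) (hB : Visible aB)
    (hK : Visible aK) (hs : Agrees T s m) (hi : s.nat (vreg 0) = i) (hj : s.nat (vreg 1) = j)
    (hjT : j < T) (he : Emitted T (i * T + j) (m aR) (m aB) (m aK) s) :
    Runs O (emit aR aB aK) s 30 fun s' => s'.nat (vreg 0) = i ∧ s'.nat (vreg 1) = j ∧
      Agrees T s' m ∧ Emitted T (i * T + j + 1) (m aR) (m aB) (m aK) s' := by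
  have hdiv : (i * T + j) / T = i := by
    rw [mul_comm, Nat.mul_add_div (by omega), Nat.div_eq_of_lt hjT, add_zero]
  have hmod : (i * T + j) % T = j := by
    rw [mul_comm, Nat.mul_add_mod, Nat.mod_eq_of_lt hjT]
  have vis : ∀ {a}, Visible a → a ≠ 1 ∧ a ≠ 2 ∧ a ≠ 3 := by
    intro a ha
    unfold Visible at ha
    omega
  have h1 := vis hR
  have h2 := vis hB
  have h3 := vis hK
  refine ⟨_, _, Exec.seq (Exec.setReal _ _ _ _ _) (Exec.seq (Exec.setReal _ _ _ _ _)
    (Exec.seq (Exec.setReal _ _ _ _ _) (Exec.setNat _ _ _))), by simp [NExp.cost, RExp.cost], ?_⟩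
  simp only [NExp.eval, RExp.eval, State.setReal_nat, he.count, hi, hj]
  refine ⟨?_, ?_, Agrees.setNat ⟨hs.1, fun a ha => ?_⟩ (by omega), ?_, ?_, ?_, ?_⟩
  · rw [State.setNat_nat_of_ne _ _ (by unfold vreg; omega)]; exact hi
  · rw [State.setNat_nat_of_ne _ _ (by unfold vreg; omega)]; exact hj
  · have := vis ha
    rw [State.setReal_real_of_ne _ _ _ _ this.2.2, State.setReal_real_of_ne _ _ _ _ this.2.1,
      State.setReal_real_of_ne _ _ _ _ this.1, hs.2 a ha]
  · rw [State.setNat_nat_self]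
  · intro l hl
    rw [State.setNat_real, State.setReal_real_of_ne _ _ _ _ (by omega),
      State.setReal_real_of_ne _ _ _ _ (by omega), setReal_real_apply]
    split_ifs with hc
    · rw [hc.1, hdiv, hmod, hs.2 aR hR]
    · exact he.fst l (by omega)
  · intro l hl
    rw [State.setNat_real, State.setReal_real_of_ne _ _ _ _ (by omega), setReal_real_apply]
    split_ifs with hc
    · rw [hc.1, hdiv, hmod, State.setReal_real_of_ne _ _ _ _ h2.1, hs.2 aB hB]
    · rw [State.setReal_real_of_ne _ _ _ _ (by omega)]
      exact he.snd l (by omega)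
  · intro l hl
    rw [State.setNat_real, setReal_real_apply]
    split_ifs with hc
    · rw [hc.1, hdiv, hmod, State.setReal_real_of_ne _ _ _ _ h3.2.1,
        State.setReal_real_of_ne _ _ _ _ h3.1, hs.2 aK hK]
    · rw [State.setReal_real_of_ne _ _ _ _ (by omega),
        State.setReal_real_of_ne _ _ _ _ (by omega)]
      exact he.prob l (by omega)

theorem output_runs {T aR aB aK : ℕ} {s : State} {m : Mem} (hR : Visible aR) (hB : Visible aB)
    (hK : Visible aK) (hs : Agrees T s m) :
    Runs O (output aR aB aK) s (loopBound T (loopBound T 30) + 3) fun s' =>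
      Agrees T s' m ∧ Emitted T (T * T) (m aR) (m aB) (m aK) s' := by
  refine (Runs.seq (B' := loopBound T (loopBound T 30))
    (runs_setNat (Q := fun s' => s' = s.setNat 1 0) rfl) ?_).mono
    (by simp only [NExp.cost]; omega) fun _ h => h
  rintro _ rfl
  refine forLoop_runs (T := T) (fun k s' => Agrees T s' m ∧
    Emitted T (k * T) (m aR) (m aB) (m aK) s') ?_ (fun k s' h => h.1.1) ?_
  · refine ⟨(hs.setNat (by omega)).setNat (by unfold vreg; omega), ?_⟩
    refine Emitted.setNat ⟨?_, ?_, ?_, ?_⟩ (by unfold vreg; omega)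
    · rw [State.setNat_nat_self]; simp
    all_goals intro j hj; simp at hj
  · intro k hk s1 h1 hr
    refine (forLoop_runs (T := T) (B := 30) (fun l s' => s'.nat (vreg 0) = k ∧ Agrees T s' m ∧
      Emitted T (k * T + l) (m aR) (m aB) (m aK) s') ?_ (fun k s' h => h.2.1.1) ?_).mono le_rfl ?_
    · exact ⟨by rw [State.setNat_nat_of_ne _ _ (by unfold vreg; omega), hr],
        h1.1.setNat (by unfold vreg; omega), h1.2.setNat (by unfold vreg; omega)⟩
    · intro l hl s2 h2 hr2
      refine (emit_runs hR hB hK h2.2.1 h2.1 hr2 hl h2.2.2).mono le_rfl fun s3 h3 =>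
        ⟨h3.2.1, ?_, h3.2.2.1.setNat (by unfold vreg; omega),
          h3.2.2.2.setNat (by unfold vreg; omega)⟩
      rw [State.setNat_nat_of_ne _ _ (by unfold vreg; omega), h3.1]
    · intro s2 h2
      refine ⟨h2.1, h2.2.1.setNat (by unfold vreg; omega), ?_⟩
      have := h2.2.2.setNat (x := vreg 0) (k := k + 1) (by unfold vreg; omega)
      rwa [show k * T + T = (k + 1) * T by ring] at this

/-- The machine that runs `first` in the first round and `next` in later rounds, and outputs three
arrays. -/
def machineOf (first next : Prog) (aR aB aK : ℕ) : Machine :=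
  ⟨Cmd.seq (first.code 0) (output aR aB aK), Cmd.seq (next.code 0) (output aR aB aK)⟩

/-- The memory of this machine. -/
noncomputable def roundMem (first next : Prog) (T : ℕ) (δ : ℝ) : List Loss → Mem
  | [] => first.denote T (fun _ _ => 0) (inputState T δ).real
  | ℓ :: H => next.denote T ℓ.answer (roundMem first next T δ H)

/-- There are `H.length + 1 ≤ T` phases of polynomial cost. The bounds of both programs are added,
so that one bound serves every phase. -/
theorem machineOf_run {first next : Prog} {aR aB aK : ℕ} (h1 : first.Ok) (h2 : next.Ok)
    (hR : Visible aR) (hB : Visible aB) (hK : Visible aK) :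
    ∃ c k : ℕ, ∀ T : ℕ, 1 ≤ T → ∀ (δ : ℝ) (H : List Loss), H.length < T →
      ∃ (s : State) (n : ℕ), (machineOf first next aR aB aK).Run T δ H s n ∧ n ≤ c * T ^ k ∧
        Emitted T (T * T) (roundMem first next T δ H aR) (roundMem first next T δ H aB)
          (roundMem first next T δ H aK) s := by
  obtain ⟨c, k, hck⟩ : PolyBdd fun T => T * (first.bound T + next.bound T +
      (loopBound T (loopBound T 30) + 4)) :=
    ((first.bound_poly.add next.bound_poly).add
      ((PolyBdd.const 30).loop.loop.add (.const 4))).size_mul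
  refine ⟨c, k, fun T hT δ H hH => ?_⟩
  suffices key : ∀ H : List Loss, ∃ (s : State) (n : ℕ),
      (machineOf first next aR aB aK).Run T δ H s n ∧
      n ≤ (H.length + 1) * (first.bound T + next.bound T + (loopBound T (loopBound T 30) + 4)) ∧
      Agrees T s (roundMem first next T δ H) ∧
        Emitted T (T * T) (roundMem first next T δ H aR) (roundMem first next T δ H aB)
          (roundMem first next T δ H aK) s by
    obtain ⟨s, n, hr, hn, -, he⟩ := key H
    exact ⟨s, n, hr, hn.trans ((Nat.mul_le_mul_right _ (by omega)).trans (hck T hT)), he⟩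
  intro H
  induction H with
  | nil =>
    obtain ⟨s, n, hr, hn, ha, he⟩ := Runs.seq (O := fun _ _ => 0)
      (Prog.code_runs (T := T) first 0 (inputState T δ) (inputState T δ).real h1
        ⟨by simp [inputState], fun _ _ => rfl⟩)
      fun s' h => output_runs hR hB hK h.1
    exact ⟨s, n, .first hr, by simp only [List.length_nil]; omega, ha, he⟩
  | cons ℓ H ih =>
    obtain ⟨s, n, hr, hn, ha, -⟩ := ih
    obtain ⟨s', n', hr', hn', ha', he'⟩ := Runs.seq (O := ℓ.answer)
      (Prog.code_runs (T := T) next 0 s _ h2 ha) fun s' h => output_runs hR hB hK h.1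
    refine ⟨s', n + n', .next hr hr', ?_, ha', he'⟩
    simp only [List.length_cons, Nat.add_mul, one_mul] at hn ⊢
    omega

end Machines

end SwapRegret

namespace SwapRegret

/-! ### Search for a normalizing multiplier. -/

section Scan

/-- Stepping to the right until a strictly decreasing function is at most `1`. -/
theorem scan_mem_Icc {Φ : ℝ → ℝ} (hΦ : StrictAnti Φ) {Λ a h : ℝ} (h0 : 0 < h) (hΛ : Φ Λ = 1)
    (ha : a ≤ Λ) {x : ℕ → ℝ} (hx0 : x 0 = a)
    (hx : ∀ n, x (n + 1) = if 1 < Φ (x n) then x n + h else x n) {N : ℕ} (hN : Λ ≤ a + N * h) :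
    x N ∈ Set.Icc Λ (Λ + h) := by
  have key : ∀ n, x n ≤ Λ + h ∧ (Λ ≤ x n ∨ x n = a + n * h) := by
    intro n
    induction n with
    | zero => exact ⟨by rw [hx0]; linarith, Or.inr (by rw [hx0]; simp)⟩
    | succ n ih =>
      rw [hx n]
      split_ifs with h1
      · have h2 : x n < Λ := by rw [← hΛ] at h1; exact hΦ.lt_iff_gt.1 h1
        refine ⟨by linarith, ?_⟩
        rcases ih.2 with h3 | h3
        · linarith
        · exact Or.inr (by rw [h3]; push_cast; ring)
      · refine ⟨ih.1, Or.inl ?_⟩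
        rw [← hΛ, not_lt] at h1
        exact hΦ.le_iff_ge.1 h1
  refine ⟨?_, (key N).1⟩
  rcases (key N).2 with h | h
  · exact h
  · rw [h]; exact hN

/-- The error made by replacing the exact multiplier by a nearby one and normalizing. -/
theorem sum_abs_tilt_sub_le {ι : Type} [Fintype ι] {η y G : ι → ℝ} (hη : ∀ i, 0 < η i)
    (hη1 : ∀ i, η i ≤ 1 / 64) (hy : ∀ i, 0 < y i) {Λ x h : ℝ}
    (hΛ : ∑ i, tilt η y G Λ i = 1) (hx : x ∈ Set.Icc Λ (Λ + h)) (hh : h ≤ 1) :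
    ∑ i, |tilt η y G x i / (∑ j, tilt η y G x j) - tilt η y G Λ i| ≤ h / 32 := by
  have hd0 : 0 ≤ x - Λ := by linarith [hx.1]
  have hd1 : x - Λ ≤ h := by linarith [hx.2]
  have hle : ∀ i, tilt η y G x i ≤ tilt η y G Λ i := fun i => by
    refine mul_le_mul_of_nonneg_left (Real.exp_le_exp.2 (neg_le_neg ?_)) (hy i).le
    exact mul_le_mul_of_nonneg_left (by linarith) (hη i).le
  -- Moving the multiplier by at most `h` changes each coordinate by a factor in `[1 - h/64, 1]`.
  -- Normalization can only raise the coordinates again, so the total error is at most twice the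
  -- lost mass.
  have hge : ∀ i, (1 - h / 64) * tilt η y G Λ i ≤ tilt η y G x i := fun i => by
    have e : tilt η y G x i = tilt η y G Λ i * Real.exp (-(η i * (x - Λ))) := by
      simp only [tilt]
      rw [mul_assoc, ← Real.exp_add]
      congr 2; ring
    rw [e, mul_comm]
    refine mul_le_mul_of_nonneg_left ?_ (tilt_pos hy Λ i).le
    have h1 := Real.add_one_le_exp (-(η i * (x - Λ)))
    have h2 : η i * (x - Λ) ≤ 1 / 64 * h :=
      mul_le_mul (hη1 i) hd1 hd0 (by norm_num)
    linarith
  set N := ∑ j, tilt η y G x j with hN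
  have hN1 : N ≤ 1 := by rw [← hΛ]; exact Finset.sum_le_sum fun i _ => hle i
  have hN2 : 1 - h / 64 ≤ N := by
    calc 1 - h / 64 = ∑ i, (1 - h / 64) * tilt η y G Λ i := by rw [← Finset.mul_sum, hΛ, mul_one]
      _ ≤ N := Finset.sum_le_sum fun i _ => hge i
  have hN0 : 0 < N := by linarith
  calc ∑ i, |tilt η y G x i / N - tilt η y G Λ i|
      ≤ ∑ i, ((tilt η y G x i / N - tilt η y G x i) + (tilt η y G Λ i - tilt η y G x i)) := by
        refine Finset.sum_le_sum fun i _ => ?_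
        have h1 : tilt η y G x i ≤ tilt η y G x i / N := by
          rw [le_div_iff₀ hN0]
          exact mul_le_of_le_one_right (tilt_pos hy x i).le hN1
        rw [abs_le]
        constructor <;> linarith [hle i]
    _ = (1 - N) + (1 - N) := by
        rw [Finset.sum_add_distrib, Finset.sum_sub_distrib, Finset.sum_sub_distrib,
          ← Finset.sum_div, hΛ, ← hN, div_self hN0.ne']
    _ ≤ h / 32 := by linarith

end Scan

/-! ### Blackwell approachability of the nonpositive orthant. -/

section Approachability

/-- Averages of uniform choices among the actions with a nonpositive product with the positive part
of the cumulative payoff. -/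
theorem approach_orthant {α β : Type*} {s : Finset α} {t : Finset β} {V : β → Prop}
    {A : β → α → ℝ} (hA : ∀ b ∈ t, V b → ∀ c ∈ s, |A b c| ≤ 1)
    (hex : ∀ φ : α → ℝ, (∀ c, 0 ≤ φ c) → ∃ b ∈ t, V b ∧ ∑ c ∈ s, φ c * A b c ≤ 0)
    {S : ℕ → α → ℝ} {cnt sel : ℕ → β → ℝ}
    (hsel : ∀ n, ∀ b ∈ t, (V b ∧ ∑ c ∈ s, max (S n c) 0 * A b c ≤ 0 → sel n b = 1) ∧
      (¬ (V b ∧ ∑ c ∈ s, max (S n c) 0 * A b c ≤ 0) → sel n b = 0))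
    (hS0 : ∀ c ∈ s, S 0 c = 0) (hcnt0 : ∀ b ∈ t, cnt 0 b = 0)
    (hcnt : ∀ n, ∀ b ∈ t, cnt (n + 1) b = cnt n b + sel n b / ∑ b' ∈ t, sel n b')
    (hS : ∀ n, ∀ c ∈ s, S (n + 1) c = S n c + ∑ b ∈ t, sel n b / (∑ b' ∈ t, sel n b') * A b c)
    (n : ℕ) :
    (∀ b ∈ t, 0 ≤ cnt n b) ∧ (∀ b ∈ t, ¬ V b → cnt n b = 0) ∧ ∑ b ∈ t, cnt n b = n ∧
      (∀ c ∈ s, ∑ b ∈ t, cnt n b * A b c = S n c) ∧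
      ∑ c ∈ s, max (S n c) 0 ^ 2 ≤ s.card * n := by
  induction n with
  | zero =>
    refine ⟨fun b hb => (hcnt0 b hb).ge, fun b hb _ => hcnt0 b hb, ?_, fun c hc => ?_, ?_⟩
    · rw [Finset.sum_eq_zero hcnt0]; simp
    · rw [hS0 c hc]
      exact Finset.sum_eq_zero fun b hb => by rw [hcnt0 b hb, zero_mul]
    · rw [Finset.sum_eq_zero fun c hc => by rw [hS0 c hc]; simp]
      simp
  | succ n ih =>
    obtain ⟨h1, h2, h3, h4, h5⟩ := ih
    have hsel0 : ∀ b ∈ t, 0 ≤ sel n b := fun b hb => by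
      by_cases h : V b ∧ ∑ c ∈ s, max (S n c) 0 * A b c ≤ 0
      · rw [(hsel n b hb).1 h]; exact zero_le_one
      · rw [(hsel n b hb).2 h]
    set D := ∑ b' ∈ t, sel n b' with hD
    have hD0 : 0 < D := by
      obtain ⟨b, hb, hV, hb'⟩ := hex (fun c => max (S n c) 0) fun c => le_max_right _ _
      have : sel n b = 1 := (hsel n b hb).1 ⟨hV, hb'⟩
      exact (zero_lt_one.trans_eq this.symm).trans_le
        (Finset.single_le_sum hsel0 hb)
    have hq0 : ∀ b ∈ t, 0 ≤ sel n b / D := fun b hb => div_nonneg (hsel0 b hb) hD0.le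
    have hq1 : ∑ b ∈ t, sel n b / D = 1 := by rw [← Finset.sum_div, ← hD, div_self hD0.ne']
    set Δ : α → ℝ := fun c => ∑ b ∈ t, sel n b / D * A b c with hΔ
    have hΔ1 : ∀ c ∈ s, |Δ c| ≤ 1 := fun c hc => by
      refine (Finset.abs_sum_le_sum_abs _ _).trans ?_
      rw [← hq1]
      refine Finset.sum_le_sum fun b hb => ?_
      rw [abs_mul, abs_of_nonneg (hq0 b hb)]
      by_cases hV : V b
      · exact mul_le_of_le_one_right (hq0 b hb) (hA b hb hV c hc)
      · rw [(hsel n b hb).2 fun h => hV h.1]; simp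
    have hdot : ∑ c ∈ s, max (S n c) 0 * Δ c ≤ 0 := by
      have : ∑ c ∈ s, max (S n c) 0 * Δ c =
          ∑ b ∈ t, sel n b / D * ∑ c ∈ s, max (S n c) 0 * A b c := by
        simp only [hΔ, Finset.mul_sum]
        rw [Finset.sum_comm]
        exact Finset.sum_congr rfl fun b _ => Finset.sum_congr rfl fun c _ => by ring
      rw [this]
      refine Finset.sum_nonpos fun b hb => ?_
      by_cases h : V b ∧ ∑ c ∈ s, max (S n c) 0 * A b c ≤ 0
      · exact mul_nonpos_of_nonneg_of_nonpos (hq0 b hb) h.2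
      · rw [(hsel n b hb).2 h]; simp
    refine ⟨fun b hb => ?_, fun b hb hV => ?_, ?_, fun c hc => ?_, ?_⟩
    · rw [hcnt n b hb]; exact add_nonneg (h1 b hb) (hq0 b hb)
    · rw [hcnt n b hb, h2 b hb hV, (hsel n b hb).2 fun h => hV h.1]; simp
    · rw [Finset.sum_congr rfl (hcnt n), Finset.sum_add_distrib, h3, hq1]; push_cast; ring
    · rw [hS n c hc, ← h4 c hc, ← Finset.sum_add_distrib]
      refine Finset.sum_congr rfl fun b hb => ?_
      rw [hcnt n b hb]; ring
    · have hpt : ∀ c ∈ s, max (S (n + 1) c) 0 ^ 2 ≤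
          max (S n c) 0 ^ 2 + 2 * (max (S n c) 0 * Δ c) + 1 := fun c hc => by
        rw [hS n c hc]
        change max (S n c + Δ c) 0 ^ 2 ≤ _
        have hd := hΔ1 c hc
        have hd2 : Δ c ^ 2 ≤ 1 := by rw [← sq_abs]; exact pow_le_one₀ (abs_nonneg _) hd
        have hle : |max (S n c + Δ c) 0| ≤ |max (S n c) 0 + Δ c| := by
          rw [abs_of_nonneg (le_max_right _ _)]
          refine max_le ?_ (abs_nonneg _)
          exact le_trans (by linarith [le_max_left (S n c) 0]) (le_abs_self _)
        have := sq_le_sq.2 hle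
        nlinarith
      calc ∑ c ∈ s, max (S (n + 1) c) 0 ^ 2
          ≤ ∑ c ∈ s, (max (S n c) 0 ^ 2 + 2 * (max (S n c) 0 * Δ c) + 1) :=
            Finset.sum_le_sum hpt
        _ = ∑ c ∈ s, max (S n c) 0 ^ 2 + 2 * ∑ c ∈ s, max (S n c) 0 * Δ c + s.card := by
            rw [Finset.sum_add_distrib, Finset.sum_add_distrib, ← Finset.mul_sum]; simp
        _ ≤ s.card * ((n + 1 : ℕ) : ℝ) := by push_cast; linarith

end Approachability

/-! ### Pairs as index pairs below `T`. -/

section Indices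

variable {γ : ℝ} {T : ℕ}

/-- The indices `i`, `k` describe the pair `(2 ^ i γ, k 2 ^ i γ)` of `Θ`. -/
def IsPair (γ : ℝ) (i k : ℕ) : Prop := 2 ^ i * γ ≤ 1 ∧ k * (2 ^ i * γ) ≤ 1

theorem IsPair.mem (hγ : 0 < γ) {i k : ℕ} (h : IsPair γ i k) :
    ((2 ^ i * γ, k * (2 ^ i * γ)) : ℝ × ℝ) ∈ Theta γ :=
  mem_Theta.2 ⟨(mem_scales hγ).2 ⟨⟨i, rfl⟩, h.1⟩, (mem_bins (by positivity)).2 ⟨⟨k, rfl⟩, h.2⟩⟩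

/-- The pair with given indices. -/
def IsPair.pair (hγ : 0 < γ) {i k : ℕ} (h : IsPair γ i k) : Theta γ := ⟨_, h.mem hγ⟩

theorem exists_isPair (hγ : 0 < γ) (hγT : 1 < γ * T) (θ : Theta γ) :
    ∃ i < T, ∃ k < T, ∃ h : IsPair γ i k, θ = h.pair hγ := by
  obtain ⟨⟨r, b⟩, hθ⟩ := θ
  obtain ⟨hr, hb⟩ := mem_Theta.1 hθ
  obtain ⟨⟨i, rfl⟩, hr1⟩ := (mem_scales hγ).1 hr
  obtain ⟨⟨k, rfl⟩, hb1⟩ := (mem_bins (by positivity)).1 hb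
  exact ⟨i, scale_index_lt hγ hγT hr1, k, bin_index_lt hγ hγT hb1, ⟨hr1, hb1⟩, rfl⟩

theorem pair_injective (hγ : 0 < γ) {i k i' k' : ℕ}
    (h : ((2 ^ i * γ, k * (2 ^ i * γ)) : ℝ × ℝ) = (2 ^ i' * γ, k' * (2 ^ i' * γ))) :
    i = i' ∧ k = k' := by
  rw [Prod.mk.injEq] at h
  have hi : i = i' := by
    have := mul_right_cancel₀ hγ.ne' h.1
    exact_mod_cast pow_right_injective₀ (by norm_num : (0 : ℝ) < 2) (by norm_num) this
  subst hi
  have : (k : ℝ) = k' := mul_right_cancel₀ (by positivity) h.2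
  exact ⟨rfl, by exact_mod_cast this⟩

open Classical in
theorem sum_Theta_eq (hγ : 0 < γ) (hγT : 1 < γ * T) (f : Theta γ → ℝ) {g : ℕ → ℕ → ℝ}
    (hfg : ∀ i < T, ∀ k < T, ∀ h : IsPair γ i k, f (h.pair hγ) = g i k)
    (hg : ∀ i < T, ∀ k < T, ¬ IsPair γ i k → g i k = 0) :
    ∑ θ, f θ = ∑ i ∈ Finset.range T, ∑ k ∈ Finset.range T, g i k := by
  rw [← Finset.sum_product (Finset.range T) (Finset.range T) fun p => g p.1 p.2]
  symm
  rw [← Finset.sum_subset (Finset.filter_subset (fun p : ℕ × ℕ => IsPair γ p.1 p.2) _)]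
  · refine Finset.sum_bij (fun p hp => (Finset.mem_filter.1 hp).2.pair hγ)
      (fun _ _ => Finset.mem_univ _) ?_ ?_ ?_
    · intro p hp p' hp' h
      have := pair_injective hγ (congrArg Subtype.val h)
      exact Prod.ext this.1 this.2
    · intro θ _
      obtain ⟨i, hi, k, hk, h, rfl⟩ := exists_isPair hγ hγT θ
      exact ⟨(i, k), Finset.mem_filter.2 ⟨by simp [hi, hk], h⟩, rfl⟩
    · intro p hp
      have := Finset.mem_product.1 (Finset.mem_filter.1 hp).1
      exact (hfg _ (Finset.mem_range.1 this.1) _ (Finset.mem_range.1 this.2) _).symm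
  · intro p hp hp'
    have := Finset.mem_product.1 hp
    exact hg _ (Finset.mem_range.1 this.1) _ (Finset.mem_range.1 this.2) fun h =>
      hp' (Finset.mem_filter.2 ⟨hp, h⟩)

end Indices

/-! ### Means of constraints from first-order queries. -/

section Means

open MeasureTheory

theorem integral_ite_mass (ℓ : Loss) {p : unitInterval → Prop} [DecidablePred p]
    (hp : MeasurableSet {v | p v}) (c : ℝ) :
    ∫ v, ((if p v then 1 else 0) - c) ∂(vDist ℓ : Measure unitInterval) = ℓ.mass {v | p v} - c := by
  rw [integral_sub _ (integrable_const c)]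
  · have : (fun v => if p v then (1 : ℝ) else 0) = Set.indicator {v | p v} 1 := by
      funext v; simp [Set.indicator]
    rw [this, integral_indicator_one hp]
    simp [Loss.mass]
  · refine Integrable.of_bound (C := 1) ?_ (Filter.Eventually.of_forall fun v => ?_)
    · exact (Measurable.ite hp measurable_const measurable_const).aestronglyMeasurable
    · split_ifs <;> simp

theorem mass_compl (ℓ : Loss) {A : Set unitInterval} (hA : MeasurableSet A) :
    ℓ.mass Aᶜ = 1 - ℓ.mass A := by
  unfold Loss.mass
  rw [probReal_compl_eq_one_sub hA]

open Classical in
/-- The mean of a constraint, computed from the one-sided derivatives `z` of the loss. -/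
noncomputable def meanFrom (γ : ℝ) (ξ : Xi) (r b z : ℝ) : ℝ :=
  match ξ with
  | Xi.pos2 => (if b + 2 * r < 1 then (1 - z) / 2 else 0) - (1 / 2 - γ / (4 * r))
  | Xi.neg2 => (if 0 < b - 2 * r then (1 + z) / 2 else 0) - (1 / 2 - γ / (4 * r))
  | Xi.pos1 => (1 / 2 - γ / (2 * r)) - (if 0 < b then (1 - z) / 2 else 1)
  | Xi.neg1 => (1 / 2 - γ / (2 * r)) - (if b < 1 then (1 + z) / 2 else 1)

/-- The query for a constraint. -/
def queryOf : Xi → Query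
  | Xi.pos2 => Query.right
  | Xi.neg2 => Query.left
  | Xi.pos1 => Query.left
  | Xi.neg1 => Query.right

/-- The query point for a constraint. -/
noncomputable def queryPoint (ξ : Xi) (r b : ℝ) : ℝ :=
  match ξ with
  | Xi.pos2 => b + 2 * r
  | Xi.neg2 => b - 2 * r
  | Xi.pos1 => b
  | Xi.neg1 => b

/-- Inside the interval the masses come from one-sided derivatives. Where the derivative does not
give the mass, the event is empty or everything, and the default `0` or `1` in `meanFrom` replaces
the answer. -/
theorem hmean_eq_meanFrom (γ : ℝ) (ξ : Xi) {r b : ℝ} (hr : 0 < r) (hb0 : 0 ≤ b) (hb1 : b ≤ 1)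
    (ℓ : Loss) :
    hmean γ ξ r b ℓ = meanFrom γ ξ r b (ℓ.answer (queryOf ξ) (queryPoint ξ r b)) := by
  have hc : Measurable fun v : unitInterval => (v : ℝ) := measurable_subtype_coe
  have m1 : ∀ x : ℝ, MeasurableSet {v : unitInterval | x < v} := fun x =>
    measurableSet_lt measurable_const hc
  have m2 : ∀ x : ℝ, MeasurableSet {v : unitInterval | x ≤ v} := fun x =>
    measurableSet_le measurable_const hc
  have m3 : ∀ x : ℝ, MeasurableSet {v : unitInterval | (v : ℝ) < x} := fun x =>
    measurableSet_lt hc measurable_const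
  have m4 : ∀ x : ℝ, MeasurableSet {v : unitInterval | (v : ℝ) ≤ x} := fun x =>
    measurableSet_le hc measurable_const
  have flip : ∀ (c : ℝ) (p : unitInterval → Prop) [DecidablePred p], MeasurableSet {v | p v} →
      ∫ v, (c - (if p v then 1 else 0)) ∂(vDist ℓ : Measure unitInterval) =
        c - ℓ.mass {v | p v} := by
    intro c p _ hp
    have := integral_ite_mass ℓ hp c
    rw [← neg_sub, ← this, ← integral_neg]
    exact integral_congr_ae (Filter.Eventually.of_forall fun v => by simp)
  have e3 : ∀ x : ℝ, {v : unitInterval | (v : ℝ) < x} = {v : unitInterval | x ≤ v}ᶜ := fun x => by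
    ext v; simp
  have e4 : ∀ x : ℝ, {v : unitInterval | (v : ℝ) ≤ x} = {v : unitInterval | x < v}ᶜ := fun x => by
    ext v; simp
  have huniv : ℓ.mass Set.univ = 1 := by simp [Loss.mass]
  unfold hmean
  cases ξ <;> simp only [hval, meanFrom, queryOf, queryPoint]
  · rw [integral_ite_mass ℓ (m1 _)]
    congr 1
    split_ifs with h
    · rw [ℓ.answer_right (by linarith) h]; ring
    · have : {v : unitInterval | b + 2 * r < v} = ∅ := by
        ext v; simp only [Set.mem_ofPred_eq, Set.mem_empty_iff_false, iff_false]
        have := v.2.2; linarith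
      rw [this]; simp [Loss.mass]
  · rw [integral_ite_mass ℓ (m3 _)]
    congr 1
    split_ifs with h
    · rw [ℓ.answer_left h (by linarith), e3, mass_compl ℓ (m2 _)]; ring
    · have : {v : unitInterval | (v : ℝ) < b - 2 * r} = ∅ := by
        ext v; simp only [Set.mem_ofPred_eq, Set.mem_empty_iff_false, iff_false]
        have := v.2.1; linarith
      rw [this]; simp [Loss.mass]
  · rw [flip _ _ (m2 _)]
    congr 1
    split_ifs with h
    · rw [ℓ.answer_left h hb1]; ring
    · have : {v : unitInterval | b ≤ v} = Set.univ := by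
        ext v; simp only [Set.mem_ofPred_eq, Set.mem_univ, iff_true]
        have := v.2.1; linarith
      rw [this, huniv]
  · rw [flip _ _ (m4 _)]
    congr 1
    split_ifs with h
    · rw [ℓ.answer_right hb0 h, e4, mass_compl ℓ (m1 _)]; ring
    · have : {v : unitInterval | (v : ℝ) ≤ b} = Set.univ := by
        ext v; simp only [Set.mem_ofPred_eq, Set.mem_univ, iff_true]
        have := v.2.2; linarith
      rw [this, huniv]

end Means

end SwapRegret

namespace SwapRegret

/-! ### Programs acting on four arrays, one per constraint. -/

section Blocks

variable {T : ℕ} {O : Query → ℝ → ℝ}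

theorem Mem.fill_of_ne {m : Mem} {a a' : ℕ} {f : ℕ → ℕ → ℝ} (h : a' ≠ a) :
    m.fill T a f a' = m a' := by
  funext i j; simp [Mem.fill, h]

theorem Mem.fill_self {m : Mem} {a : ℕ} {f : ℕ → ℕ → ℝ} {i j : ℕ} (hi : i < T) (hj : j < T) :
    m.fill T a f a i j = f i j := by
  simp [Mem.fill, hi, hj]

/-- The number of a constraint. -/
def Xi.num : Xi → ℕ
  | pos2 => 0
  | neg2 => 1
  | pos1 => 2
  | neg1 => 3

theorem Xi.num_lt (ξ : Xi) : ξ.num < 4 := by cases ξ <;> decide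

/-- One program for each constraint. -/
def seqXi (p : Xi → Prog) : Prog :=
  (p Xi.pos2).seq ((p Xi.neg2).seq ((p Xi.pos1).seq (p Xi.neg1)))

theorem seqXi_ok {p : Xi → Prog} (h : ∀ ξ, (p ξ).Ok) : (seqXi p).Ok := ⟨h _, h _, h _, h _⟩

/-- No component reads an array of the block other than its own, so sequential execution has the
effect of simultaneous assignment from the initial memory. -/
theorem denote_seqXi {base : ℕ} {p : Xi → Prog} {F : Xi → Mem → ℕ → ℕ → ℝ}
    (hp : ∀ ξ m, (p ξ).denote T O m = m.fill T (base + ξ.num) (F ξ m))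
    (hF : ∀ ξ (m m' : Mem), (∀ a, a < base ∨ base + 4 ≤ a ∨ a = base + ξ.num → m a = m' a) →
      F ξ m = F ξ m') (m : Mem) :
    (∀ a, a < base ∨ base + 4 ≤ a → (seqXi p).denote T O m a = m a) ∧
      ∀ ξ, ∀ i < T, ∀ j < T, (seqXi p).denote T O m (base + ξ.num) i j = F ξ m i j := by
  simp only [seqXi, Prog.denote, hp]
  set m1 := m.fill T (base + Xi.pos2.num) (F Xi.pos2 m) with hm1
  set m2 := m1.fill T (base + Xi.neg2.num) (F Xi.neg2 m1) with hm2
  set m3 := m2.fill T (base + Xi.pos1.num) (F Xi.pos1 m2) with hm3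
  have h1 : ∀ a, a ≠ base + 0 → m1 a = m a := fun a h => Mem.fill_of_ne h
  have h2 : ∀ a, a ≠ base + 1 → m2 a = m1 a := fun a h => Mem.fill_of_ne h
  have h3 : ∀ a, a ≠ base + 2 → m3 a = m2 a := fun a h => Mem.fill_of_ne h
  have h4 : ∀ a, a ≠ base + 3 →
      m3.fill T (base + Xi.neg1.num) (F Xi.neg1 m3) a = m3 a := fun a h => Mem.fill_of_ne h
  have e1 : F Xi.neg2 m1 = F Xi.neg2 m := hF _ _ _ fun a ha => by
    simp only [Xi.num] at ha; rw [h1 a (by omega)]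
  have e2 : F Xi.pos1 m2 = F Xi.pos1 m := hF _ _ _ fun a ha => by
    simp only [Xi.num] at ha; rw [h2 a (by omega), h1 a (by omega)]
  have e3 : F Xi.neg1 m3 = F Xi.neg1 m := hF _ _ _ fun a ha => by
    simp only [Xi.num] at ha; rw [h3 a (by omega), h2 a (by omega), h1 a (by omega)]
  refine ⟨fun a ha => ?_, fun ξ i hi j hj => ?_⟩
  · rw [h4 a (by omega), h3 a (by omega), h2 a (by omega), h1 a (by omega)]
  · cases ξ
    · rw [h4 _ (by simp [Xi.num]), h3 _ (by simp [Xi.num]), h2 _ (by simp [Xi.num]), hm1,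
        Mem.fill_self hi hj]
    · rw [h4 _ (by simp [Xi.num]), h3 _ (by simp [Xi.num]), hm2, Mem.fill_self hi hj, e1]
    · rw [h4 _ (by simp [Xi.num]), hm3, Mem.fill_self hi hj, e2]
    · rw [Mem.fill_self hi hj, e3]

theorem denote_mapXi {base : ℕ} {e : Xi → RE} (hr : ∀ ξ, (e ξ).Reads fun a =>
      a < base ∨ base + 4 ≤ a ∨ a = base + ξ.num) (hc : ∀ ξ, (e ξ).Closed 2) (m : Mem) :
    (∀ a, a < base ∨ base + 4 ≤ a →
      (seqXi fun ξ => .map (base + ξ.num) (e ξ)).denote T O m a = m a) ∧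
      ∀ ξ, ∀ i < T, ∀ j < T, (seqXi fun ξ => .map (base + ξ.num) (e ξ)).denote T O m
        (base + ξ.num) i j = (e ξ).eval T m 2 (entry i j) :=
  denote_seqXi (F := fun ξ m i j => (e ξ).eval T m 2 (entry i j)) (fun _ _ => rfl)
    (fun ξ _ _ h => by
      funext i j
      exact RE.eval_congr h (e ξ) (hr ξ) (hc ξ) fun _ _ => rfl) m

theorem denote_askXi {base : ℕ} {q : Xi → Query} {e : Xi → RE} (hr : ∀ ξ, (e ξ).Reads fun a =>
      a < base ∨ base + 4 ≤ a ∨ a = base + ξ.num) (hc : ∀ ξ, (e ξ).Closed 2) (m : Mem) :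
    (∀ a, a < base ∨ base + 4 ≤ a →
      (seqXi fun ξ => .ask (base + ξ.num) (q ξ) (e ξ)).denote T O m a = m a) ∧
      ∀ ξ, ∀ i < T, ∀ j < T, (seqXi fun ξ => .ask (base + ξ.num) (q ξ) (e ξ)).denote T O m
        (base + ξ.num) i j = O (q ξ) ((e ξ).eval T m 2 (entry i j)) :=
  denote_seqXi (F := fun ξ m i j => O (q ξ) ((e ξ).eval T m 2 (entry i j))) (fun _ _ => rfl)
    (fun ξ _ _ h => by
      funext i j
      exact congrArg _ (RE.eval_congr h (e ξ) (hr ξ) (hc ξ) fun _ _ => rfl)) m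

theorem denote_map (a : ℕ) (e : RE) (m : Mem) :
    (∀ a', a' ≠ a → (Prog.map a e).denote T O m a' = m a') ∧
      ∀ i < T, ∀ j < T, (Prog.map a e).denote T O m a i j = e.eval T m 2 (entry i j) :=
  ⟨fun _ h => Mem.fill_of_ne h, fun _ hi _ hj => Mem.fill_self hi hj⟩

/-- `T ^ n`-fold repetition. -/
def Prog.reps (p : Prog) : ℕ → Prog
  | 0 => p
  | n + 1 => rep (p.reps n)

theorem Prog.reps_denote (p : Prog) (n : ℕ) : (p.reps n).denote T O = (p.denote T O)^[T ^ n] := by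
  induction n with
  | zero => simp [reps]
  | succ n ih =>
    funext m
    simp only [reps, denote, ih]
    rw [pow_succ, Function.iterate_mul]

theorem Prog.reps_ok {p : Prog} (h : p.Ok) : ∀ n, (p.reps n).Ok
  | 0 => h
  | n + 1 => reps_ok (p := p) h n

end Blocks

/-! ### The prediction algorithm as an array program. -/

section Algorithm

open RE

/-- The sum over the constraints. -/
def sumXi (f : Xi → RE) : RE :=
  add (add (add (f Xi.pos2) (f Xi.neg2)) (f Xi.pos1)) (f Xi.neg1)

theorem eval_sumXi (f : Xi → RE) (T : ℕ) (m : Mem) (l : ℕ) (env : ℕ → ℕ) :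
    (sumXi f).eval T m l env = ∑ ξ, (f ξ).eval T m l env := by
  rw [sum_Xi]; rfl

theorem reads_sumXi {p : ℕ → Prop} {f : Xi → RE} (h : ∀ ξ, (f ξ).Reads p) : (sumXi f).Reads p :=
  ⟨⟨⟨h _, h _⟩, h _⟩, h _⟩

theorem closed_sumXi {l : ℕ} {f : Xi → RE} (h : ∀ ξ, (f ξ).Closed l) : (sumXi f).Closed l :=
  ⟨⟨⟨h _, h _⟩, h _⟩, h _⟩

/-- The power `2 ^ x` of an index. -/
def ePow (x : ℕ) : RE := exp (mul (idx x) (log (const 2)))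

theorem eval_ePow (x T : ℕ) (m : Mem) (l : ℕ) (env : ℕ → ℕ) :
    (ePow x).eval T m l env = 2 ^ env x := by
  simp only [ePow, eval]
  rw [mul_comm, Real.exp_mul, Real.exp_log (by norm_num), Real.rpow_natCast]
  norm_num

/-- The entry of an array at two indices. -/
def eAt (a x y : ℕ) : RE := cell a (some x) (some y)

theorem eval_eAt (a x y T : ℕ) (m : Mem) (l : ℕ) (env : ℕ → ℕ) :
    (eAt a x y).eval T m l env = m a (env x) (env y) := rfl

def eGamma : RE := cell 6 none none

theorem eval_eGamma (T : ℕ) (m : Mem) (l : ℕ) (env : ℕ → ℕ) :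
    eGamma.eval T m l env = m 6 0 0 := rfl

/-- The learning rate `η_{q+1}`. -/
noncomputable def lrate (q : ℕ) : ℝ := 1 / (32 * 2 ^ (q + 1))

def eRate (q : ℕ) : RE := div (const 1) (mul (const 64) (ePow q))

theorem eval_eRate (q T : ℕ) (m : Mem) (l : ℕ) (env : ℕ → ℕ) :
    (eRate q).eval T m l env = lrate (env q) := by
  simp only [eRate, eval, eval_ePow, lrate]
  rw [pow_succ]
  push_cast
  ring_nf

/-- The constraint `ξ` of the pair `i`, `k` at the test point `x`, `y`. -/
def eVal (ξ : Xi) (i k x y : ℕ) : RE :=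
  match ξ with
  | Xi.pos2 => sub (ifLt (add (eAt 8 i k) (mul (const 2) (eAt 7 i k))) (eAt 10 x y) (const 1) (const 0))
      (sub (const (1 / 2)) (div eGamma (mul (const 4) (eAt 7 i k))))
  | Xi.neg2 => sub (ifLt (eAt 10 x y) (sub (eAt 8 i k) (mul (const 2) (eAt 7 i k))) (const 1) (const 0))
      (sub (const (1 / 2)) (div eGamma (mul (const 4) (eAt 7 i k))))
  | Xi.pos1 => sub (sub (const (1 / 2)) (div eGamma (mul (const 2) (eAt 7 i k))))
      -- Only strict comparison is available, so `b ≤ v` is tested as the failure of `v < b`.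
      (ifLt (eAt 10 x y) (eAt 8 i k) (const 0) (const 1))
  | Xi.neg1 => sub (sub (const (1 / 2)) (div eGamma (mul (const 2) (eAt 7 i k))))
      (ifLt (eAt 8 i k) (eAt 10 x y) (const 0) (const 1))

theorem eval_eVal (ξ : Xi) (i k x y T : ℕ) (m : Mem) (l : ℕ) (env : ℕ → ℕ) :
    (eVal ξ i k x y).eval T m l env = hval (m 6 0 0) ξ (m 7 (env i) (env k)) (m 8 (env i) (env k))
      (m 10 (env x) (env y)) := by
  cases ξ <;> simp only [eVal, eval, eval_eAt, eval_eGamma, hval] <;> push_cast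
  · rfl
  · rfl
  · congr 1
    by_cases h : m 8 (env i) (env k) ≤ m 10 (env x) (env y)
    · simp [h]
    · simp [h]
  · congr 1
    by_cases h : m 10 (env x) (env y) ≤ m 8 (env i) (env k)
    · simp [h]
    · simp [h]

/-- The query point of the constraint `ξ`. -/
def eQuery (ξ : Xi) : RE :=
  match ξ with
  | Xi.pos2 => add (eAt 8 0 1) (mul (const 2) (eAt 7 0 1))
  | Xi.neg2 => sub (eAt 8 0 1) (mul (const 2) (eAt 7 0 1))
  | Xi.pos1 => eAt 8 0 1
  | Xi.neg1 => eAt 8 0 1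

theorem eval_eQuery (ξ : Xi) (T : ℕ) (m : Mem) (l : ℕ) (env : ℕ → ℕ) :
    (eQuery ξ).eval T m l env =
      queryPoint ξ (m 7 (env 0) (env 1)) (m 8 (env 0) (env 1)) := by
  cases ξ <;> simp [eQuery, eval, eval_eAt, queryPoint]

/-- The mean of the constraint `ξ`, from the answer to its query. -/
def eMean (ξ : Xi) : RE :=
  match ξ with
  | Xi.pos2 => sub (ifLt (add (eAt 8 0 1) (mul (const 2) (eAt 7 0 1))) (const 1)
      (div (sub (const 1) (eAt 20 0 1)) (const 2)) (const 0))
      (sub (const (1 / 2)) (div eGamma (mul (const 4) (eAt 7 0 1))))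
  | Xi.neg2 => sub (ifLt (const 0) (sub (eAt 8 0 1) (mul (const 2) (eAt 7 0 1)))
      (div (add (const 1) (eAt 21 0 1)) (const 2)) (const 0))
      (sub (const (1 / 2)) (div eGamma (mul (const 4) (eAt 7 0 1))))
  | Xi.pos1 => sub (sub (const (1 / 2)) (div eGamma (mul (const 2) (eAt 7 0 1))))
      (ifLt (const 0) (eAt 8 0 1) (div (sub (const 1) (eAt 22 0 1)) (const 2)) (const 1))
  | Xi.neg1 => sub (sub (const (1 / 2)) (div eGamma (mul (const 2) (eAt 7 0 1))))
      (ifLt (eAt 8 0 1) (const 1) (div (add (const 1) (eAt 23 0 1)) (const 2)) (const 1))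

theorem eval_eMean (ξ : Xi) (T : ℕ) (m : Mem) (l : ℕ) (env : ℕ → ℕ) :
    (eMean ξ).eval T m l env = meanFrom (m 6 0 0) ξ (m 7 (env 0) (env 1)) (m 8 (env 0) (env 1))
      (m (20 + ξ.num) (env 0) (env 1)) := by
  cases ξ <;> simp [eMean, eval, eval_eAt, eval_eGamma, meanFrom, Xi.num]

/-- The unnormalized weight of an expert in the base algorithm `q`. -/
noncomputable def expoM (m : Mem) (ξ : Xi) (q i k : ℕ) : ℝ :=
  Real.exp (-(2 * lrate q * (m (28 + ξ.num) i k + 32 * (2 * lrate q) * m (32 + ξ.num) i k)))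

def eExpo (ξ : Xi) (q i k : ℕ) : RE :=
  exp (sub (const 0) (mul (mul (const 2) (eRate q)) (add (eAt (28 + ξ.num) i k)
    (mul (mul (const 32) (mul (const 2) (eRate q))) (eAt (32 + ξ.num) i k)))))

theorem eval_eExpo (ξ : Xi) (q i k T : ℕ) (m : Mem) (l : ℕ) (env : ℕ → ℕ) :
    (eExpo ξ q i k).eval T m l env = expoM m ξ (env q) (env i) (env k) := by
  simp [eExpo, eval, eval_eAt, eval_eRate, expoM]

/-- The normalization of the base algorithm `q`. -/
noncomputable def normM (T : ℕ) (m : Mem) (q : ℕ) : ℝ :=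
  ∑ i ∈ Finset.range T, ∑ k ∈ Finset.range T, m 9 i k * ∑ ξ, expoM m ξ q i k

/-- The loss of the base algorithm `q`. -/
noncomputable def baseLossM (T : ℕ) (m : Mem) (q : ℕ) : ℝ :=
  (∑ i ∈ Finset.range T, ∑ k ∈ Finset.range T,
    m 9 i k * ∑ ξ, expoM m ξ q i k * m (24 + ξ.num) i k) / normM T m q

def eNorm : RE := sum (sum (mul (eAt 9 2 3) (sumXi fun ξ => eExpo ξ 0 2 3)))

def eBaseLoss : RE :=
  div (sum (sum (mul (eAt 9 2 3) (sumXi fun ξ => mul (eExpo ξ 0 2 3) (eAt (24 + ξ.num) 2 3))))) eNorm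

theorem eval_eNorm (T : ℕ) (m : Mem) (i j : ℕ) : eNorm.eval T m 2 (entry i j) = normM T m i := by
  simp [eNorm, eval, eval_eAt, eval_sumXi, eval_eExpo, normM, entry]

theorem eval_eBaseLoss (T : ℕ) (m : Mem) (i j : ℕ) :
    eBaseLoss.eval T m 2 (entry i j) = baseLossM T m i := by
  simp only [eBaseLoss, eval, eval_eNorm, baseLossM]
  simp [eval_eAt, eval_sumXi, eval, eval_eExpo, entry]

/-- The sum that the multiplier of the master makes equal to `1`. -/
noncomputable def tiltM (T : ℕ) (m : Mem) (x : ℝ) : ℝ :=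
  ∑ q ∈ Finset.range T, m 12 q 0 * Real.exp (-(lrate q * (m 36 q 0 + x)))

def eTilt (q : ℕ) : RE :=
  mul (cell 12 (some q) none) (exp (sub (const 0) (mul (eRate q)
    (add (cell 36 (some q) none) (cell 41 none none)))))

theorem eval_eTilt (q T : ℕ) (m : Mem) (l : ℕ) (env : ℕ → ℕ) :
    (eTilt q).eval T m l env =
      m 12 (env q) 0 * Real.exp (-(lrate (env q) * (m 36 (env q) 0 + m 41 0 0))) := by
  simp [eTilt, eval, eval_eRate, idxVal]

/-- The mixture of the constraints of the pair `i`, `k` at the test point `x`, `y`. -/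
noncomputable def mixM (m : Mem) (i k x y : ℕ) : ℝ :=
  m 11 x y * ∑ ξ : Xi, m (43 + ξ.num) i k * hval (m 6 0 0) ξ (m 7 i k) (m 8 i k) (m 10 x y)

def eMix (i k x y : ℕ) : RE :=
  mul (eAt 11 x y) (sumXi fun ξ => mul (eAt (43 + ξ.num) i k) (eVal ξ i k x y))

theorem eval_eMix (i k x y T : ℕ) (m : Mem) (l : ℕ) (env : ℕ → ℕ) :
    (eMix i k x y).eval T m l env = mixM m (env i) (env k) (env x) (env y) := by
  simp [eMix, eval, eval_eAt, eval_sumXi, eval_eVal, mixM]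

/-- The positive part. -/
def ePos (e : RE) : RE := ifLt (const 0) e e (const 0)

theorem eval_ePos (e : RE) (T : ℕ) (m : Mem) (l : ℕ) (env : ℕ → ℕ) :
    (ePos e).eval T m l env = max (e.eval T m l env) 0 := by
  simp only [ePos, eval]
  push_cast
  split_ifs with h
  · rw [max_eq_left h.le]
  · rw [max_eq_right (not_lt.1 h)]

/-- The parameters and the index tables. Arrays: `6` the parameter `γ`, `7` scales, `8` bins,
`9` validity of pairs, `10` test points, `11` validity of test points, `12` initial weights. -/
def initProg : Prog :=
  let x := div (mul (log size) (log (div (const 1) (cell 0 none none)))) size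
  -- A square root, by `exp` and `log`; its argument is positive.
  let s := exp (div (log x) (const 2))
  -- The condition `2 ^ q < T` singles out the `⌈log₂ T⌉` base algorithms without computing a
  -- logarithm as a natural number.
  let y := fun q => ifLt (ePow q) size (mul (eRate q) (eRate q)) (const 0)
  (Prog.map 6 (ifLt (const 1) s (const 1) s)).seq <|
  (Prog.map 9 (ifLt (const 1) (mul (ePow 0) eGamma) (const 0)
    (ifLt (const 1) (mul (idx 1) (mul (ePow 0) eGamma)) (const 0) (const 1)))).seq <|
  -- Index pairs outside `Θ` default to the pair `(γ, 0)`, so that even unused table entries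
  -- describe an element of `Θ`.
  (Prog.map 7 (ifLt (const 0) (eAt 9 0 1) (mul (ePow 0) eGamma) eGamma)).seq <|
  (Prog.map 8 (ifLt (const 0) (eAt 9 0 1) (mul (idx 1) (mul (ePow 0) eGamma)) (const 0))).seq <|
  (Prog.map 10 (add (mul (idx 1) eGamma) (div (mul (idx 0) eGamma) (const 2)))).seq <|
  (Prog.map 11 (ifLt (idx 0) (const 2)
    (ifLt (const 1) (mul (idx 1) eGamma) (const 0) (const 1)) (const 0))).seq <|
  Prog.map 12 (div (y 0) (sum (y 2)))

/-- The reaction to a loss. Arrays: `20`–`23` answers, `24`–`27` losses of the experts, `28`–`31`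
their sums, `32`–`35` the sums of their squares, `36` cumulative losses of the master, `39` the
losses of the base algorithms, `50` the distribution. -/
def updateProg : Prog :=
  (seqXi fun ξ => .ask (20 + ξ.num) (queryOf ξ) (eQuery ξ)).seq <|
  (seqXi fun ξ => .map (24 + ξ.num) (sub (const 0) (mul (eAt 50 0 1) (eMean ξ)))).seq <|
  -- Computed before the sums in arrays `28`–`35` change, since the base losses refer to the weights
  -- of the round just played.
  (Prog.map 39 eBaseLoss).seq <|
  (Prog.map 36 (add (eAt 36 0 1) (add (eAt 39 0 1) (mul (mul (const 32) (eRate 0))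
    (mul (eAt 39 0 1) (eAt 39 0 1)))))).seq <|
  (seqXi fun ξ => .map (28 + ξ.num) (add (eAt (28 + ξ.num) 0 1) (eAt (24 + ξ.num) 0 1))).seq <|
  seqXi fun ξ => .map (32 + ξ.num) (add (eAt (32 + ξ.num) 0 1)
    (mul (eAt (24 + ξ.num) 0 1) (eAt (24 + ξ.num) 0 1)))

/-- The search for the multiplier of the master. -/
def scanStep : Prog :=
  Prog.map 41 (ifLt (const 1) (sum (eTilt 2)) (add (cell 41 none none) (div (const 1) size))
    (cell 41 none none))

/-- One step of the approachability algorithm. Arrays: `47` cumulative payoffs, `48` cumulative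
distribution, `49` current distribution, `51` admissible pairs. -/
def approachStep : Prog :=
  (Prog.map 51 (ifLt (const 0) (eAt 9 0 1)
    (ifLt (const 0) (sum (sum (mul (ePos (eAt 47 2 3)) (eMix 0 1 2 3)))) (const 0) (const 1))
    (const 0))).seq <|
  (Prog.map 49 (div (eAt 51 0 1) (sum (sum (eAt 51 2 3))))).seq <|
  (Prog.map 48 (add (eAt 48 0 1) (eAt 49 0 1))).seq <|
  Prog.map 47 (add (eAt 47 0 1) (sum (sum (mul (eAt 49 2 3) (eMix 2 3 0 1)))))

/-- The weights of the experts. Arrays: `38` normalizations of the base algorithms, `41` the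
multiplier of the master, `42` the weights of the master, `43`–`46` the weights of the experts. -/
def weightProg : Prog :=
  (Prog.map 38 eNorm).seq <|
  -- The multiplier lies in `[-2T, 2T]`; the scan starts at the left end and its `T^4` steps of
  -- length `1/T` cover the range.
  (Prog.map 41 (sub (const 0) (mul (const 2) size))).seq <|
  (scanStep.reps 4).seq <|
  (Prog.map 42 (div (eTilt 0) (sum (eTilt 2)))).seq <|
  seqXi fun ξ => .map (43 + ξ.num) (mul (eAt 9 0 1)
    (sum (div (mul (cell 42 (some 2) none) (eExpo ξ 2 0 1)) (cell 38 (some 2) none))))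

/-- The distribution, in array `50`. -/
def lpProg : Prog :=
  (Prog.map 47 (const 0)).seq <|
  (Prog.map 48 (const 0)).seq <|
  -- After `T^17` steps on at most `T²` test points the average exceeds zero by at most `T^(19/2 -
  -- 17)`, which is below `1 / (32 T^4)` for `T ≥ 3`.
  (approachStep.reps 17).seq <|
  Prog.map 50 (div (eAt 48 0 1) (sum (sum (eAt 48 2 3))))

def firstProg : Prog := initProg.seq (weightProg.seq lpProg)

def nextProg : Prog := updateProg.seq (weightProg.seq lpProg)

theorem reads_eVal (ξ : Xi) (i k x y : ℕ) {p : ℕ → Prop} (h6 : p 6) (h7 : p 7) (h8 : p 8)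
    (h10 : p 10) : (eVal ξ i k x y).Reads p := by
  cases ξ <;> simp [eVal, Reads, eAt, eGamma, h6, h7, h8, h10]

theorem closed_eVal (ξ : Xi) {i k x y l : ℕ} (hi : i < l) (hk : k < l) (hx : x < l) (hy : y < l) :
    (eVal ξ i k x y).Closed l := by
  cases ξ <;> simp [eVal, Closed, eAt, eGamma, hi, hk, hx, hy]

theorem reads_eQuery (ξ : Xi) {p : ℕ → Prop} (h7 : p 7) (h8 : p 8) : (eQuery ξ).Reads p := by
  cases ξ <;> simp [eQuery, Reads, eAt, h7, h8]

theorem closed_eQuery (ξ : Xi) : (eQuery ξ).Closed 2 := by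
  cases ξ <;> simp [eQuery, Closed, eAt]

theorem reads_eMean (ξ : Xi) {p : ℕ → Prop} (h6 : p 6) (h7 : p 7) (h8 : p 8)
    (h : p (20 + ξ.num)) : (eMean ξ).Reads p := by
  cases ξ <;> simp only [Xi.num] at h <;> simp [eMean, Reads, eAt, eGamma, h6, h7, h8, h]

theorem closed_eMean (ξ : Xi) : (eMean ξ).Closed 2 := by
  cases ξ <;> simp [eMean, Closed, eAt, eGamma]

theorem reads_eExpo (ξ : Xi) (q i k : ℕ) {p : ℕ → Prop} (h1 : p (28 + ξ.num))
    (h2 : p (32 + ξ.num)) : (eExpo ξ q i k).Reads p := by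
  simp [eExpo, Reads, eAt, eRate, ePow, h1, h2]

theorem closed_eExpo (ξ : Xi) {q i k l : ℕ} (hq : q < l) (hi : i < l) (hk : k < l) :
    (eExpo ξ q i k).Closed l := by
  simp [eExpo, Closed, eAt, eRate, ePow, hq, hi, hk]

theorem visible_of_le {a : ℕ} (h : 6 ≤ a) : Visible a := Or.inr h

theorem initProg_ok : initProg.Ok := by
  simp [initProg, Prog.Ok, Reads, Closed, Visible, ePow, eGamma, eAt, eRate]

theorem eNorm_reads : eNorm.Reads Visible :=
  ⟨visible_of_le (by omega), reads_sumXi fun ξ =>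
    reads_eExpo _ _ _ _ (visible_of_le (by omega)) (visible_of_le (by omega))⟩

theorem eNorm_closed : eNorm.Closed 2 :=
  ⟨by simp [eAt, Closed], closed_sumXi fun ξ => closed_eExpo _ (by omega) (by omega) (by omega)⟩

theorem eBaseLoss_reads : eBaseLoss.Reads Visible :=
  ⟨⟨visible_of_le (by omega), reads_sumXi fun ξ =>
    ⟨reads_eExpo _ _ _ _ (visible_of_le (by omega)) (visible_of_le (by omega)),
      visible_of_le (by omega)⟩⟩, eNorm_reads⟩

theorem eBaseLoss_closed : eBaseLoss.Closed 2 :=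
  ⟨⟨by simp [eAt, Closed], closed_sumXi fun ξ =>
    ⟨closed_eExpo _ (by omega) (by omega) (by omega), by simp [eAt, Closed]⟩⟩, eNorm_closed⟩

theorem updateProg_ok : updateProg.Ok := by
  refine ⟨seqXi_ok fun ξ => ⟨by omega, reads_eQuery ξ (visible_of_le (by omega))
    (visible_of_le (by omega)), closed_eQuery ξ⟩, seqXi_ok fun ξ => ⟨by omega, ⟨trivial,
      visible_of_le (by omega), reads_eMean ξ (visible_of_le (by omega)) (visible_of_le (by omega))
      (visible_of_le (by omega)) (visible_of_le (by omega))⟩, trivial, by simp [eAt, Closed],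
      closed_eMean ξ⟩, ⟨by omega, eBaseLoss_reads, eBaseLoss_closed⟩, ?_, seqXi_ok fun ξ => ?_,
      seqXi_ok fun ξ => ?_⟩
  all_goals
    simp only [Prog.Ok, Reads, Closed, eAt, eRate, ePow, Visible]
    simp
    try omega

theorem reads_eMix (i k x y : ℕ) : (eMix i k x y).Reads Visible :=
  ⟨visible_of_le (by omega), reads_sumXi fun ξ => ⟨visible_of_le (by omega),
    reads_eVal ξ i k x y (visible_of_le (by omega)) (visible_of_le (by omega))
      (visible_of_le (by omega)) (visible_of_le (by omega))⟩⟩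

theorem closed_eMix {i k x y l : ℕ} (hi : i < l) (hk : k < l) (hx : x < l) (hy : y < l) :
    (eMix i k x y).Closed l :=
  ⟨by simp [eAt, Closed, hx, hy], closed_sumXi fun ξ => ⟨by simp [eAt, Closed, hi, hk],
    closed_eVal ξ hi hk hx hy⟩⟩

theorem approachStep_ok : approachStep.Ok := by
  have h1 := reads_eMix 0 1 2 3
  have h2 := reads_eMix 2 3 0 1
  have h3 : (eMix 0 1 2 3).Closed 4 := closed_eMix (by omega) (by omega) (by omega) (by omega)
  have h4 : (eMix 2 3 0 1).Closed 4 := closed_eMix (by omega) (by omega) (by omega) (by omega)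
  simp [approachStep, Prog.Ok, Reads, Closed, Visible, eAt, ePos] at h1 h2 h3 h4 ⊢
  exact ⟨⟨h1, h3⟩, h2, h4⟩

theorem lpProg_ok : lpProg.Ok := by
  refine ⟨?_, ?_, Prog.reps_ok approachStep_ok 17, ?_⟩ <;>
    simp [Prog.Ok, Reads, Closed, Visible, eAt]

theorem weightProg_ok : weightProg.Ok := by
  refine ⟨⟨by omega, eNorm_reads, eNorm_closed⟩, ?_, Prog.reps_ok ?_ 4, ?_, seqXi_ok fun ξ => ?_⟩
  · simp [Prog.Ok, Reads, Closed]
  · simp [scanStep, Prog.Ok, Reads, Closed, Visible, eTilt, eRate, ePow]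
  · simp [Prog.Ok, Reads, Closed, Visible, eTilt, eRate, ePow]
  · refine ⟨by omega, ⟨visible_of_le (by omega), ⟨visible_of_le (by omega),
      reads_eExpo _ _ _ _ (visible_of_le (by omega)) (visible_of_le (by omega))⟩,
      visible_of_le (by omega)⟩, by simp [eAt, Closed], ⟨by simp [Closed],
      closed_eExpo _ (by omega) (by omega) (by omega)⟩, by simp [Closed]⟩

theorem firstProg_ok : firstProg.Ok := ⟨initProg_ok, weightProg_ok, lpProg_ok⟩

theorem nextProg_ok : nextProg.Ok := ⟨updateProg_ok, weightProg_ok, lpProg_ok⟩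

end Algorithm

end SwapRegret

namespace SwapRegret

/-! ### What the programs compute. -/

section Specs

variable {T : ℕ} {O : Query → ℝ → ℝ}

/-- A property of the memory that a program computes. -/
def Spec (T : ℕ) (O : Query → ℝ → ℝ) (p : Prog) (m : Mem) (Q : Mem → Prop) : Prop :=
  Q (p.denote T O m)

theorem Spec.map {a : ℕ} {e : RE} {m : Mem} {Q : Mem → Prop}
    (h : ∀ m' : Mem, (∀ a', a' ≠ a → m' a' = m a') →
      (∀ i < T, ∀ j < T, m' a i j = e.eval T m 2 (entry i j)) → Q m') :
    Spec T O (Prog.map a e) m Q :=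
  h _ (denote_map a e m).1 (denote_map a e m).2

theorem Spec.seq {p p' : Prog} {m : Mem} {Q : Mem → Prop}
    (h : Spec T O p m fun m' => Spec T O p' m' Q) : Spec T O (p.seq p') m Q := h

theorem Spec.mono {p : Prog} {m : Mem} {Q Q' : Mem → Prop} (h : Spec T O p m Q)
    (hQ : ∀ m', Q m' → Q' m') : Spec T O p m Q' := hQ _ h

theorem Spec.mapXi {base : ℕ} {e : Xi → RE} {m : Mem} {Q : Mem → Prop}
    (hr : ∀ ξ, (e ξ).Reads fun a => a < base ∨ base + 4 ≤ a ∨ a = base + ξ.num)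
    (hc : ∀ ξ, (e ξ).Closed 2)
    (h : ∀ m' : Mem, (∀ a, a < base ∨ base + 4 ≤ a → m' a = m a) →
      (∀ ξ : Xi, ∀ i < T, ∀ j < T, m' (base + ξ.num) i j = (e ξ).eval T m 2 (entry i j)) → Q m') :
    Spec T O (seqXi fun ξ => .map (base + ξ.num) (e ξ)) m Q :=
  h _ (denote_mapXi hr hc m).1 (denote_mapXi hr hc m).2

theorem Spec.askXi {base : ℕ} {q : Xi → Query} {e : Xi → RE} {m : Mem} {Q : Mem → Prop}
    (hr : ∀ ξ, (e ξ).Reads fun a => a < base ∨ base + 4 ≤ a ∨ a = base + ξ.num)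
    (hc : ∀ ξ, (e ξ).Closed 2)
    (h : ∀ m' : Mem, (∀ a, a < base ∨ base + 4 ≤ a → m' a = m a) →
      (∀ ξ : Xi, ∀ i < T, ∀ j < T,
        m' (base + ξ.num) i j = O (q ξ) ((e ξ).eval T m 2 (entry i j))) → Q m') :
    Spec T O (seqXi fun ξ => .ask (base + ξ.num) (q ξ) (e ξ)) m Q :=
  h _ (denote_askXi hr hc m).1 (denote_askXi hr hc m).2

/-- Hides the iterates behind an abstract sequence known only through its recursion, the form that
`scan_mem_Icc` and `approach_orthant` consume. -/
theorem Spec.reps {p : Prog} {n : ℕ} {m : Mem} {Q : Mem → Prop}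
    (h : ∀ x : ℕ → Mem, x 0 = m → (∀ n, Spec T O p (x n) fun m' => x (n + 1) = m') → Q (x (T ^ n))) :
    Spec T O (p.reps n) m Q := by
  unfold Spec
  rw [Prog.reps_denote]
  exact h (fun n => (p.denote T O)^[n] m) rfl fun n => Function.iterate_succ_apply' _ _ _

open Classical in
/-- The tables that do not change. -/
structure Static (T : ℕ) (γ : ℝ) (m : Mem) : Prop where
  gamma : m 6 0 0 = γ
  scale : ∀ i < T, ∀ k < T, m 7 i k = if IsPair γ i k then 2 ^ i * γ else γ
  bin : ∀ i < T, ∀ k < T, m 8 i k = if IsPair γ i k then k * (2 ^ i * γ) else 0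
  valid : ∀ i < T, ∀ k < T, m 9 i k = if IsPair γ i k then 1 else 0
  point : ∀ x < T, ∀ y < T, m 10 x y = testPoint γ x y
  pvalid : ∀ x < T, ∀ y < T, m 11 x y = if x < 2 ∧ y * γ ≤ 1 then 1 else 0
  init : ∀ q < T, ∀ j < T, m 12 q j = (if 2 ^ q < T then lrate q ^ 2 else 0) /
    ∑ q ∈ Finset.range T, if 2 ^ q < T then lrate q ^ 2 else 0

theorem Static.congr {γ : ℝ} {m m' : Mem} (h : Static T γ m)
    (hm : ∀ a, 6 ≤ a → a ≤ 12 → m' a = m a) : Static T γ m' := by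
  constructor <;> (rw [hm _ (by norm_num) (by norm_num)])
  exacts [h.gamma, h.scale, h.bin, h.valid, h.point, h.pvalid, h.init]

theorem initProg_spec (hT : 2 < T) {δ : ℝ} (hδ : 0 < δ) (hδT : δ ≤ 1 / T) :
    Spec T O initProg (inputState T δ).real fun m =>
      Static T (gammaParam T δ) m ∧ ∀ a, 13 ≤ a → ∀ i j, m a i j = 0 := by
  classical
  have hT0 : 0 < T := by omega
  obtain ⟨γ, hγdef⟩ : ∃ γ, γ = gammaParam T δ := ⟨_, rfl⟩
  rw [← hγdef]
  refine Spec.seq (Spec.map fun m1 k1 v1 => ?_)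
  refine Spec.seq (Spec.map fun m2 k2 v2 => ?_)
  refine Spec.seq (Spec.map fun m3 k3 v3 => ?_)
  refine Spec.seq (Spec.map fun m4 k4 v4 => ?_)
  refine Spec.seq (Spec.map fun m5 k5 v5 => ?_)
  refine Spec.seq (Spec.map fun m6 k6 v6 => ?_)
  refine Spec.map fun m7 k7 v7 => ?_
  have hγ : m1 6 0 0 = γ := by
    rw [v1 0 hT0 0 hT0]
    have h1 := one_lt_log_natCast hT
    have h2 := log_natCast_le_log_inv hT hδ hδT
    have hx : 0 < Real.log T * Real.log (1 / δ) / T := by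
      have : 0 < Real.log (1 / δ) := by linarith
      positivity
    have hs : Real.exp (Real.log (Real.log T * Real.log (1 / δ) / T) / 2) =
        Real.sqrt (Real.log T * Real.log (1 / δ) / T) := by
      rw [Real.sqrt_eq_rpow, Real.rpow_def_of_pos hx]
      congr 1; ring
    have hδ0 : (inputState T δ).real 0 0 0 = δ := by simp [inputState]
    simp only [RE.eval, idxVal, hδ0]
    push_cast
    rw [hs, hγdef, gammaParam]
    split_ifs with h
    · rw [min_eq_left h.le]
    · rw [min_eq_right (not_lt.1 h)]
  have g : ∀ n : Mem, n 6 = m1 6 → n 6 0 0 = γ := fun n h => by rw [h]; exact hγ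
  have g2 : m2 6 = m1 6 := k2 6 (by norm_num)
  have g3 : m3 6 = m1 6 := (k3 6 (by norm_num)).trans g2
  have g4 : m4 6 = m1 6 := (k4 6 (by norm_num)).trans g3
  have g5 : m5 6 = m1 6 := (k5 6 (by norm_num)).trans g4
  have g6 : m6 6 = m1 6 := (k6 6 (by norm_num)).trans g5
  have g7 : m7 6 = m1 6 := (k7 6 (by norm_num)).trans g6
  have h9 : ∀ i < T, ∀ k < T, m2 9 i k = @ite _ (IsPair γ i k) (Classical.propDecidable _) 1 0 := by
    intro i hi k hk
    rw [v2 i hi k hk]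
    simp only [RE.eval, eval_ePow, eval_eGamma, hγ, entry, IsPair]
    push_cast
    by_cases h1 : 2 ^ i * γ ≤ 1
    · by_cases h2 : (k : ℝ) * (2 ^ i * γ) ≤ 1
      · simp [h1, h2, not_lt.2 h1, not_lt.2 h2]
      · simp [h1, h2, not_lt.2 h1, not_le.1 h2]
    · simp [h1, not_le.1 h1]
  have h9' : ∀ i < T, ∀ k < T, (0 < m2 9 i k ↔ IsPair γ i k) := by
    intro i hi k hk
    rw [h9 i hi k hk]
    split_ifs with h <;> simp [h]
  constructor
  · refine ⟨g m7 g7, fun i hi k hk => ?_, fun i hi k hk => ?_, fun i hi k hk => ?_,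
      fun x hx y hy => ?_, fun x hx y hy => ?_, fun q hq j hj => ?_⟩
    · rw [k7 7 (by norm_num), k6 7 (by norm_num), k5 7 (by norm_num), k4 7 (by norm_num),
        v3 i hi k hk]
      simp only [RE.eval, eval_eAt, eval_ePow, eval_eGamma, g m2 g2, entry, if_true, one_ne_zero,
        if_false]
      exact if_congr (by rw [← h9' i hi k hk]; push_cast; rfl) rfl rfl
    · rw [k7 8 (by norm_num), k6 8 (by norm_num), k5 8 (by norm_num), v4 i hi k hk]
      simp only [RE.eval, eval_eAt, eval_ePow, eval_eGamma, g m3 g3, entry, k3 9 (by norm_num),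
        if_true, one_ne_zero, if_false]
      exact if_congr (by rw [← h9' i hi k hk]; push_cast; rfl) rfl (by simp)
    · rw [k7 9 (by norm_num), k6 9 (by norm_num), k5 9 (by norm_num), k4 9 (by norm_num),
        k3 9 (by norm_num), h9 i hi k hk]
    · rw [k7 10 (by norm_num), k6 10 (by norm_num), v5 x hx y hy]
      simp [RE.eval, eval_eGamma, g m4 g4, entry, testPoint]
    · rw [k7 11 (by norm_num), v6 x hx y hy]
      simp only [RE.eval, eval_eGamma, g m5 g5, entry]
      have e : ((x : ℝ) < 2) ↔ x < 2 := by exact_mod_cast Iff.rfl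
      by_cases h1 : x < 2 <;> by_cases h2 : (y : ℝ) * γ ≤ 1 <;> simp [e, h1, h2, not_lt.2, not_le.1]
    · rw [v7 q hq j hj]
      clear v1 v2 v3 v4 v5 v6 v7
      have e : ∀ q : ℕ, ((2 : ℝ) ^ q < T) ↔ 2 ^ q < T := fun q => by exact_mod_cast Iff.rfl
      simp [RE.eval, eval_ePow, eval_eRate, entry, e, sq]
  · intro a ha i j
    rw [k7 a (by omega), k6 a (by omega), k5 a (by omega), k4 a (by omega), k3 a (by omega),
      k2 a (by omega), k1 a (by omega)]
    simp only [inputState]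
    rw [if_neg (by omega)]

/-- The loss of an expert, from the memory before the update. -/
noncomputable def lossM (O : Query → ℝ → ℝ) (m : Mem) (ξ : Xi) (i k : ℕ) : ℝ :=
  -(m 50 i k * meanFrom (m 6 0 0) ξ (m 7 i k) (m 8 i k)
    (O (queryOf ξ) (queryPoint ξ (m 7 i k) (m 8 i k))))

/-- The loss of a base algorithm, from the memory before the update. -/
noncomputable def baseLoss (T : ℕ) (O : Query → ℝ → ℝ) (m : Mem) (q : ℕ) : ℝ :=
  (∑ i ∈ Finset.range T, ∑ k ∈ Finset.range T,
    m 9 i k * ∑ ξ, expoM m ξ q i k * lossM O m ξ i k) / normM T m q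

theorem expoM_congr {m m' : Mem} (h : ∀ a, 28 ≤ a → a < 36 → m' a = m a) (ξ : Xi) (q i k : ℕ) :
    expoM m' ξ q i k = expoM m ξ q i k := by
  have := ξ.num_lt
  unfold expoM
  rw [h _ (by omega) (by omega), h _ (by omega) (by omega)]

theorem normM_congr {m m' : Mem} (h : ∀ a, 28 ≤ a → a < 36 → m' a = m a) (h9 : m' 9 = m 9) (q : ℕ) :
    normM T m' q = normM T m q := by
  unfold normM
  simp only [expoM_congr h, h9]

theorem updateProg_spec (m : Mem) :
    Spec T O updateProg m fun m' => (∀ a, 6 ≤ a → a ≤ 12 → m' a = m a) ∧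
      (∀ ξ : Xi, ∀ i < T, ∀ k < T, m' (28 + ξ.num) i k = m (28 + ξ.num) i k + lossM O m ξ i k) ∧
      (∀ ξ : Xi, ∀ i < T, ∀ k < T,
        m' (32 + ξ.num) i k = m (32 + ξ.num) i k + lossM O m ξ i k ^ 2) ∧
      ∀ q < T, ∀ j < T, m' 36 q j =
        m 36 q j + (baseLoss T O m q + 32 * lrate q * baseLoss T O m q ^ 2) := by
  refine Spec.seq (Spec.askXi (fun ξ => reads_eQuery ξ (by omega) (by omega)) closed_eQuery
    fun m1 k1 v1 => ?_)
  refine Spec.seq (Spec.mapXi (fun ξ => ⟨trivial, show _ ∨ _ by omega,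
    reads_eMean ξ (by omega) (by omega) (by omega) (by have := ξ.num_lt; omega)⟩)
    (fun ξ => ⟨trivial, by simp [eAt, RE.Closed], closed_eMean ξ⟩) fun m2 k2 v2 => ?_)
  refine Spec.seq (Spec.map fun m3 k3 v3 => ?_)
  refine Spec.seq (Spec.map fun m4 k4 v4 => ?_)
  refine Spec.seq (Spec.mapXi (fun ξ => ⟨show _ ∨ _ by omega, show _ ∨ _ by
    have := ξ.num_lt; omega⟩) (fun ξ => by simp [eAt, RE.Closed]) fun m5 k5 v5 => ?_)
  refine Spec.mapXi (fun ξ => ⟨show _ ∨ _ by omega, show _ ∨ _ by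
    have := ξ.num_lt; omega, show _ ∨ _ by have := ξ.num_lt; omega⟩)
    (fun ξ => by simp [eAt, RE.Closed]) fun m6 k6 v6 => ?_
  have hc : ∀ ξ : Xi, ∀ i < T, ∀ k < T, m2 (24 + ξ.num) i k = lossM O m ξ i k := by
    intro ξ i hi k hk
    rw [v2 ξ i hi k hk]
    simp only [RE.eval, eval_eAt, eval_eMean, k1 50 (by norm_num), k1 6 (by norm_num),
      k1 7 (by norm_num), k1 8 (by norm_num), entry, if_true, one_ne_zero, if_false,
      v1 ξ i hi k hk, eval_eQuery, lossM]
    push_cast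
    ring
  have hM : ∀ q < T, ∀ j < T, m3 39 q j = baseLoss T O m q := by
    intro q hq j hj
    have h : ∀ a, 28 ≤ a → a < 36 → m2 a = m a := fun a h1 _ => by
      rw [k2 a (by omega), k1 a (by omega)]
    rw [v3 q hq j hj, eval_eBaseLoss, baseLossM, baseLoss,
      normM_congr h (by rw [k2 9 (by norm_num), k1 9 (by norm_num)])]
    congr 1
    refine Finset.sum_congr rfl fun i hi => Finset.sum_congr rfl fun k hk => ?_
    rw [Finset.mem_range] at hi hk
    simp only [expoM_congr h, hc _ i hi k hk, k2 9 (by norm_num), k1 9 (by norm_num)]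
  refine ⟨fun a h1 h2 => ?_, fun ξ i hi k hk => ?_, fun ξ i hi k hk => ?_, fun q hq j hj => ?_⟩
  · rw [k6 a (by omega), k5 a (by omega), k4 a (by omega), k3 a (by omega), k2 a (by omega),
      k1 a (by omega)]
  · have := ξ.num_lt
    rw [k6 _ (by omega), v5 ξ i hi k hk]
    simp only [RE.eval, eval_eAt, entry, if_true, one_ne_zero, if_false]
    rw [k4 (28 + ξ.num) (by omega), k3 (28 + ξ.num) (by omega), k2 (28 + ξ.num) (by omega),
      k1 (28 + ξ.num) (by omega), k4 (24 + ξ.num) (by omega), k3 (24 + ξ.num) (by omega),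
      hc ξ i hi k hk]
  · have := ξ.num_lt
    rw [v6 ξ i hi k hk]
    simp only [RE.eval, eval_eAt, entry, if_true, one_ne_zero, if_false]
    rw [k5 (32 + ξ.num) (by omega), k4 (32 + ξ.num) (by omega), k3 (32 + ξ.num) (by omega),
      k2 (32 + ξ.num) (by omega), k1 (32 + ξ.num) (by omega), k5 (24 + ξ.num) (by omega),
      k4 (24 + ξ.num) (by omega), k3 (24 + ξ.num) (by omega), hc ξ i hi k hk]
    ring
  · rw [k6 36 (by norm_num), k5 36 (by norm_num), v4 q hq j hj]
    simp only [RE.eval, eval_eAt, eval_eRate, entry, if_true, one_ne_zero, if_false]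
    rw [hM q hq j hj, k3 36 (by norm_num), k2 36 (by norm_num), k1 36 (by norm_num)]
    push_cast
    ring

theorem scanStep_spec (hT : 0 < T) (m : Mem) :
    Spec T O scanStep m fun m' => (∀ a, a ≠ 41 → m' a = m a) ∧
      m' 41 0 0 = @ite _ (1 < tiltM T m (m 41 0 0)) (Classical.propDecidable _)
        (m 41 0 0 + 1 / T) (m 41 0 0) := by
  refine Spec.map fun m1 k1 v1 => ⟨k1, ?_⟩
  rw [v1 0 hT 0 hT]
  simp only [RE.eval, eval_eTilt, idxVal, Function.update_self, tiltM]
  push_cast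
  rfl

theorem weightProg_spec (hT : 0 < T) (m : Mem) :
    Spec T O weightProg m fun m' => (∀ a, a < 38 → m' a = m a) ∧
      ∃ x : ℕ → ℝ, x 0 = -(2 * T) ∧
        (∀ n, x (n + 1) = @ite _ (1 < tiltM T m (x n)) (Classical.propDecidable _)
          (x n + 1 / T) (x n)) ∧
        ∀ ξ : Xi, ∀ i < T, ∀ k < T, m' (43 + ξ.num) i k = m 9 i k * ∑ q ∈ Finset.range T,
          m 12 q 0 * Real.exp (-(lrate q * (m 36 q 0 + x (T ^ 4)))) / tiltM T m (x (T ^ 4)) *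
            expoM m ξ q i k / normM T m q := by
  refine Spec.seq (Spec.map fun m1 k1 v1 => ?_)
  refine Spec.seq (Spec.map fun m2 k2 v2 => ?_)
  refine Spec.seq (Spec.reps fun y hy0 hy => ?_)
  refine Spec.seq (Spec.map fun m4 k4 v4 => ?_)
  refine Spec.mapXi (fun ξ => ⟨show _ ∨ _ by omega, ⟨show _ ∨ _ by omega,
    reads_eExpo ξ _ _ _ (by have := ξ.num_lt; omega) (by have := ξ.num_lt; omega)⟩,
    show _ ∨ _ by omega⟩) (fun ξ => ⟨by simp [eAt, RE.Closed], ⟨by simp [RE.Closed],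
    closed_eExpo _ (by omega) (by omega) (by omega)⟩, by simp [RE.Closed]⟩) fun m5 k5 v5 => ?_
  have hs : ∀ n, (∀ a, a ≠ 41 → y (n + 1) a = y n a) ∧
      y (n + 1) 41 0 0 = @ite _ (1 < tiltM T (y n) (y n 41 0 0)) (Classical.propDecidable _)
        (y n 41 0 0 + 1 / T) (y n 41 0 0) := fun n => by
    rw [hy n]
    exact scanStep_spec hT (y n)
  have hk : ∀ n a, a ≠ 41 → y n a = m2 a := by
    intro n
    induction n with
    | zero => intro a _; rw [hy0]
    | succ n ih =>
      intro a ha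
      exact ((hs n).1 a ha).trans (ih a ha)
  have hk2 : ∀ a, a ≠ 41 → a ≠ 38 → m2 a = m a := fun a h1 h2 => by rw [k2 a h1, k1 a h2]
  have htilt' : ∀ n, y n 12 = m 12 ∧ y n 36 = m 36 := fun n =>
    ⟨by rw [hk n 12 (by norm_num), hk2 12 (by norm_num) (by norm_num)],
      by rw [hk n 36 (by norm_num), hk2 36 (by norm_num) (by norm_num)]⟩
  have htilt : ∀ n, ∑ q ∈ Finset.range T, y n 12 q 0 *
      Real.exp (-(lrate q * (y n 36 q 0 + y n 41 0 0))) = tiltM T m (y n 41 0 0) := by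
    intro n
    rw [(htilt' n).1, (htilt' n).2, tiltM]
  refine ⟨fun a ha => ?_, fun n => y n 41 0 0, ?_, fun n => ?_, fun ξ i hi k hki => ?_⟩
  · rw [k5 a (by omega), k4 a (by omega), hk _ a (by omega), hk2 a (by omega) (by omega)]
  · simp only [hy0]
    rw [v2 0 hT 0 hT]
    simp [RE.eval]
  · refine (hs n).2.trans ?_
    unfold tiltM
    rw [(htilt' n).1, (htilt' n).2]
  · have := ξ.num_lt
    have h38 : ∀ q < T, m4 38 q 0 = normM T m q := fun q hq => by
      rw [k4 38 (by norm_num), hk _ 38 (by norm_num), k2 38 (by norm_num), v1 q hq 0 hT, eval_eNorm]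
    have h42 : ∀ q < T, m4 42 q 0 = m 12 q 0 *
        Real.exp (-(lrate q * (m 36 q 0 + y (T ^ 4) 41 0 0))) / tiltM T m (y (T ^ 4) 41 0 0) := by
      intro q hq
      rw [v4 q hq 0 hT]
      simp only [RE.eval, eval_eTilt, Function.update_self, htilt, entry, if_true]
      rw [(htilt' _).1, (htilt' _).2]
    have hE : ∀ q, expoM m4 ξ q i k = expoM m ξ q i k := fun q =>
      expoM_congr (fun a h1 h2 => by
        rw [k4 a (by omega), hk _ a (by omega), hk2 a (by omega) (by omega)]) ξ q i k
    rw [v5 ξ i hi k hki]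
    simp only [RE.eval, eval_eAt, eval_eExpo, idxVal, Function.update_self]
    have e0 : ∀ q, Function.update (entry i k) 2 q 0 = i := fun q => by simp [entry]
    have e1 : ∀ q, Function.update (entry i k) 2 q 1 = k := fun q => by simp [entry]
    simp only [e0, e1, hE, entry, if_true, one_ne_zero, if_false]
    rw [k4 9 (by norm_num), hk _ 9 (by norm_num), hk2 9 (by norm_num) (by norm_num)]
    congr 1
    refine Finset.sum_congr rfl fun q hq => ?_
    rw [h38 q (Finset.mem_range.1 hq), h42 q (Finset.mem_range.1 hq)]

theorem mixM_congr {m m' : Mem} (h : ∀ a, a < 47 → m' a = m a) (i k x y : ℕ) :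
    mixM m' i k x y = mixM m i k x y := by
  unfold mixM
  rw [h 11 (by norm_num), h 6 (by norm_num), h 7 (by norm_num), h 8 (by norm_num),
    h 10 (by norm_num)]
  congr 1
  refine Finset.sum_congr rfl fun ξ _ => ?_
  have := ξ.num_lt
  rw [h _ (by omega)]

theorem approachStep_spec (m : Mem) :
    Spec T O approachStep m fun m' => (∀ a, a < 47 → m' a = m a) ∧
      (∀ i < T, ∀ k < T, m' 51 i k = @ite _ (0 < m 9 i k) (Classical.propDecidable _)
        (@ite _ (0 < ∑ x ∈ Finset.range T, ∑ y ∈ Finset.range T, max (m 47 x y) 0 * mixM m i k x y)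
          (Classical.propDecidable _) 0 1) 0) ∧
      (∀ i < T, ∀ k < T, m' 48 i k = m 48 i k + m' 51 i k /
        ∑ i ∈ Finset.range T, ∑ k ∈ Finset.range T, m' 51 i k) ∧
      ∀ x < T, ∀ y < T, m' 47 x y = m 47 x y + ∑ i ∈ Finset.range T, ∑ k ∈ Finset.range T,
        m' 51 i k / (∑ i ∈ Finset.range T, ∑ k ∈ Finset.range T, m' 51 i k) * mixM m i k x y := by
  refine Spec.seq (Spec.map fun m1 k1 v1 => ?_)
  refine Spec.seq (Spec.map fun m2 k2 v2 => ?_)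
  refine Spec.seq (Spec.map fun m3 k3 v3 => ?_)
  refine Spec.map fun m4 k4 v4 => ?_
  have h51 : m4 51 = m1 51 := by rw [k4 _ (by norm_num), k3 _ (by norm_num), k2 _ (by norm_num)]
  have h49 : ∀ i < T, ∀ k < T, m2 49 i k = m1 51 i k /
      ∑ i ∈ Finset.range T, ∑ k ∈ Finset.range T, m1 51 i k := by
    intro i hi k hk
    rw [v2 i hi k hk]
    simp [RE.eval, eval_eAt, entry]
  rw [h51]
  refine ⟨fun a ha => ?_, fun i hi k hk => ?_, fun i hi k hk => ?_, fun x hx y hy => ?_⟩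
  · rw [k4 a (by omega), k3 a (by omega), k2 a (by omega), k1 a (by omega)]
  · rw [v1 i hi k hk]
    simp only [RE.eval, eval_eAt, eval_ePos, eval_eMix]
    push_cast
    simp [entry]
  · rw [k4 48 (by norm_num), v3 i hi k hk]
    simp only [RE.eval, eval_eAt, entry, if_true, one_ne_zero, if_false]
    rw [h49 i hi k hk, k2 48 (by norm_num), k1 48 (by norm_num)]
  · rw [v4 x hx y hy]
    simp only [RE.eval, eval_eAt, eval_eMix, entry, if_true, one_ne_zero, if_false]
    rw [k3 47 (by norm_num), k2 47 (by norm_num), k1 47 (by norm_num)]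
    congr 1
    refine Finset.sum_congr rfl fun i hi => Finset.sum_congr rfl fun k hk => ?_
    rw [Finset.mem_range] at hi hk
    have e0 : Function.update (Function.update (entry x y) 2 i) 3 k 0 = x := by simp [entry]
    have e1 : Function.update (Function.update (entry x y) 2 i) 3 k 1 = y := by simp [entry]
    have e2 : Function.update (Function.update (entry x y) 2 i) 3 k 2 = i := by simp
    have e3 : Function.update (Function.update (entry x y) 2 i) 3 k 3 = k := by simp
    simp only [e0, e1, e2, e3]
    rw [k3 49 (by norm_num), h49 i hi k hk, mixM_congr (m := m) fun a ha => by
      rw [k3 a (by omega), k2 a (by omega), k1 a (by omega)]]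

end Specs

end SwapRegret

namespace SwapRegret

/-! ### Approximate solution of the linear program by the program. -/

section LinearProgram

variable {T : ℕ} {O : Query → ℝ → ℝ} {γ : ℝ}

theorem abs_hmix_le (hγ : 0 < γ) {w : Expert γ → ℝ} (hw0 : ∀ e, 0 ≤ w e)
    (hw1 : ∀ θ, ∑ ξ, w (θ, ξ) ≤ 1) (θ : Theta γ) (v : ℝ) : |hmix γ w θ v| ≤ 1 := by
  refine ((Finset.abs_sum_le_sum_abs _ _).trans (Finset.sum_le_sum fun ξ _ => ?_)).trans (hw1 θ)
  rw [abs_mul, abs_of_nonneg (hw0 _)]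
  exact mul_le_of_le_one_right (hw0 _) (abs_hval_le hγ (Theta_scale_ge hγ θ) _ _ _)

open Classical in
theorem mixM_eq (hγ : 0 < γ) {m : Mem} (hm : Static T γ m) {w : Expert γ → ℝ} {i k x y : ℕ}
    (hi : i < T) (hk : k < T) (hx : x < T) (hy : y < T) (h : IsPair γ i k)
    (hwm : ∀ ξ : Xi, m (43 + ξ.num) i k = w (h.pair hγ, ξ)) :
    mixM m i k x y = (if x < 2 ∧ y * γ ≤ 1 then 1 else 0) *
      hmix γ w (h.pair hγ) (testPoint γ x y) := by
  unfold mixM hmix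
  rw [hm.pvalid x hx y hy, hm.gamma, hm.scale i hi k hk, hm.bin i hi k hk, hm.point x hx y hy,
    if_pos h, if_pos h]
  simp only [hwm]
  rfl

/-- Blackwell's condition, supplied by `exists_good_pair`. Cells that are not test points get weight
zero and are placed at the harmless outcome `0`. -/
theorem exists_mixM_nonpos (hγ : 0 < γ) (hγ1 : γ ≤ 1) (hγT : 1 < γ * T) {m : Mem}
    (hm : Static T γ m) {w : Expert γ → ℝ} (hw0 : ∀ e, 0 ≤ w e)
    (hwm : ∀ i < T, ∀ k < T, ∀ h : IsPair γ i k, ∀ ξ : Xi, m (43 + ξ.num) i k = w (h.pair hγ, ξ))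
    (φ : ℕ × ℕ → ℝ) (hφ : ∀ c, 0 ≤ φ c) :
    ∃ b ∈ Finset.range T ×ˢ Finset.range T, IsPair γ b.1 b.2 ∧
      ∑ c ∈ Finset.range T ×ˢ Finset.range T, φ c * mixM m b.1 b.2 c.1 c.2 ≤ 0 := by
  classical
  set good : ℕ × ℕ → Prop := fun c => c.1 < 2 ∧ c.2 * γ ≤ 1 with hgood
  obtain ⟨θ, hθ⟩ := exists_hmix_nonpos (α := ↥(Finset.range T ×ˢ Finset.range T)) hγ hγ1 hw0
    (φ := fun c => φ c * if good c then 1 else 0)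
    (x := fun c => if good c then testPoint γ c.1.1 c.1.2 else 0)
    (fun c => mul_nonneg (hφ _) (by split_ifs <;> norm_num))
    (fun c => by split_ifs; exacts [testPoint_nonneg hγ _ _, le_rfl])
    (fun c => by
      split_ifs with h
      · exact testPoint_lt hγ h.1 h.2
      · linarith)
  obtain ⟨i, hi, k, hk, h, rfl⟩ := exists_isPair hγ hγT θ
  refine ⟨(i, k), by simp [hi, hk], h, le_trans (le_of_eq ?_) hθ⟩
  rw [← Finset.sum_coe_sort]
  refine Finset.sum_congr rfl fun c _ => ?_
  have hc := Finset.mem_product.1 c.2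
  rw [mixM_eq hγ hm hi hk (Finset.mem_range.1 hc.1) (Finset.mem_range.1 hc.2) h (hwm i hi k hk h)]
  by_cases hg : good c
  · rw [if_pos hg, if_pos hg]; ring
  · rw [if_neg hg, if_neg hg]; ring

/-- The normalized cumulative distribution of the approachability iteration has average payoff equal
to cumulative payoff over `T^17`, and each positive part is at most the root of the potential. -/
theorem lpProg_spec (hγ : 0 < γ) (hγ1 : γ ≤ 1) (hγT : 1 < γ * T) (hT : 2 < T) {m : Mem}
    (hm : Static T γ m) {w : Expert γ → ℝ} (hw0 : ∀ e, 0 ≤ w e) (hw1 : ∀ θ, ∑ ξ, w (θ, ξ) ≤ 1)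
    (hwm : ∀ i < T, ∀ k < T, ∀ h : IsPair γ i k, ∀ ξ : Xi,
      m (43 + ξ.num) i k = w (h.pair hγ, ξ)) :
    Spec T O lpProg m fun m' => (∀ a, a < 47 → m' a = m a) ∧
      ∃ κ ∈ stdSimplex ℝ (Theta γ),
        (∀ i < T, ∀ k < T, ∀ h : IsPair γ i k, m' 50 i k = κ (h.pair hγ)) ∧
        (∀ i < T, ∀ k < T, ¬ IsPair γ i k → m' 50 i k = 0) ∧
        ∀ x < 2, ∀ y : ℕ, y * γ ≤ 1 →
          ∑ θ, κ θ * hmix γ w θ (testPoint γ x y) ≤ 1 / (32 * T ^ 4) := by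
  classical
  refine Spec.seq (Spec.map fun m1 k1 v1 => ?_)
  refine Spec.seq (Spec.map fun m2 k2 v2 => ?_)
  refine Spec.seq (Spec.reps fun z hz0 hz => ?_)
  refine Spec.map fun m4 k4 v4 => ?_
  have hstep := fun n => approachStep_spec (T := T) (O := O) (z n)
  simp only [Spec] at hz hstep
  simp only [← hz] at hstep
  have hst : ∀ n a, a < 47 → z n a = m a := by
    intro n
    induction n with
    | zero => intro a ha; rw [hz0, k2 a (by omega), k1 a (by omega)]
    | succ n ih => intro a ha; rw [(hstep n).1 a ha, ih a ha]
  have hmix : ∀ n i k x y, mixM (z n) i k x y = mixM m i k x y := fun n i k x y =>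
    mixM_congr (hst n) i k x y
  simp only [hmix] at hstep
  have hT0 : (0 : ℝ) < T := by positivity
  have hval9 : ∀ n, ∀ i < T, ∀ k < T, (0 < z n 9 i k ↔ IsPair γ i k) := fun n i hi k hk => by
    rw [hst n 9 (by norm_num), hm.valid i hi k hk]
    split_ifs with h <;> simp [h]
  have main := approach_orthant (s := Finset.range T ×ˢ Finset.range T)
    (t := Finset.range T ×ˢ Finset.range T) (V := fun b => IsPair γ b.1 b.2)
    (A := fun b c => mixM m b.1 b.2 c.1 c.2) (S := fun n c => z n 47 c.1 c.2)
    (cnt := fun n b => z n 48 b.1 b.2) (sel := fun n b => z (n + 1) 51 b.1 b.2)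
    (fun b hb hV c hc => by
      simp only [Finset.mem_product, Finset.mem_range] at hb hc
      rw [mixM_eq hγ hm hb.1 hb.2 hc.1 hc.2 hV (hwm _ hb.1 _ hb.2 hV), abs_mul]
      refine mul_le_one₀ (by split_ifs <;> simp) (abs_nonneg _) (abs_hmix_le hγ hw0 hw1 _ _))
    (exists_mixM_nonpos hγ hγ1 hγT hm hw0 hwm)
    (fun n b hb => by
      simp only [Finset.mem_product, Finset.mem_range] at hb
      rw [Finset.sum_product, (hstep n).2.1 _ hb.1 _ hb.2]
      by_cases h1 : IsPair γ b.1 b.2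
      · simp [h1, hval9 n _ hb.1 _ hb.2]
      · simp [h1, hval9 n _ hb.1 _ hb.2])
    (fun c hc => by
      simp only [Finset.mem_product, Finset.mem_range] at hc
      rw [hz0, k2 47 (by norm_num), v1 _ hc.1 _ hc.2]; simp [RE.eval])
    (fun b hb => by
      simp only [Finset.mem_product, Finset.mem_range] at hb
      rw [hz0, v2 _ hb.1 _ hb.2]; simp [RE.eval])
    (fun n b hb => by
      simp only [Finset.mem_product, Finset.mem_range] at hb
      rw [(hstep n).2.2.1 _ hb.1 _ hb.2, Finset.sum_product])
    (fun n c hc => by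
      simp only [Finset.mem_product, Finset.mem_range] at hc
      rw [(hstep n).2.2.2 _ hc.1 _ hc.2, Finset.sum_product, Finset.sum_product])
    (T ^ 17)
  obtain ⟨c0, cV, cS, cA, cB⟩ := main
  have h50 : ∀ i < T, ∀ k < T, m4 50 i k = z (T ^ 17) 48 i k / (T : ℝ) ^ 17 := by
    intro i hi k hk
    rw [v4 i hi k hk]
    simp only [RE.eval, eval_eAt, entry, if_true, one_ne_zero, if_false]
    rw [Finset.sum_product] at cS
    congr 1
    push_cast at cS
    rw [← cS]
    simp
  have hpair : ∀ i k, ∀ h : IsPair γ i k, ∀ i' k', ∀ h' : IsPair γ i' k',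
      h.pair hγ = h'.pair hγ → i = i' ∧ k = k' := fun i k h i' k' h' e =>
    pair_injective hγ (congrArg Subtype.val e)
  choose I hI K hK hIK hθ using exists_isPair hγ hγT
  have hκ : ∀ i < T, ∀ k < T, ∀ h : IsPair γ i k,
      m4 50 i k = m4 50 (I (h.pair hγ)) (K (h.pair hγ)) := fun i _ k _ h => by
    obtain ⟨e1, e2⟩ := hpair _ _ h _ _ _ (hθ (h.pair hγ))
    rw [← e1, ← e2]
  have hκ0 : ∀ i < T, ∀ k < T, ¬ IsPair γ i k → m4 50 i k = 0 := fun i hi k hk h => by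
    rw [h50 i hi k hk, cV (i, k) (by simp [hi, hk]) h, zero_div]
  refine ⟨fun a ha => by rw [k4 a (by omega), hst _ a ha], fun θ => m4 50 (I θ) (K θ),
    ⟨fun θ => ?_, ?_⟩, hκ, hκ0, fun x hx y hy => ?_⟩
  · change 0 ≤ m4 50 (I θ) (K θ)
    rw [h50 _ (hI θ) _ (hK θ)]
    exact div_nonneg (c0 (I θ, K θ) (by simp [hI, hK])) (by positivity)
  · rw [sum_Theta_eq hγ hγT (g := m4 50) _ (fun i hi k hk h => (hκ i hi k hk h).symm) hκ0,
      ← Finset.sum_product (Finset.range T) (Finset.range T) fun p => m4 50 p.1 p.2]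
    rw [Finset.sum_congr rfl fun b hb => by
      simp only [Finset.mem_product, Finset.mem_range] at hb
      exact h50 _ hb.1 _ hb.2, ← Finset.sum_div, cS]
    push_cast
    exact div_self (by positivity)
  · have hxT : x < T := by omega
    have hyT : y < T := bin_index_lt (i := 0) hγ hγT (by simpa using hy)
    rw [sum_Theta_eq hγ hγT (g := fun i k => m4 50 i k * mixM m i k x y) _
      (fun i hi k hk h => by
        rw [mixM_eq hγ hm hi hk hxT hyT h (hwm i hi k hk h), if_pos ⟨hx, hy⟩, one_mul,
          hκ i hi k hk h])
      (fun i hi k hk h => by rw [hκ0 i hi k hk h, zero_mul]),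
      ← Finset.sum_product (Finset.range T) (Finset.range T) fun p =>
        m4 50 p.1 p.2 * mixM m p.1 p.2 x y]
    have hsum := cA (x, y) (by simp [hxT, hyT])
    rw [Finset.sum_congr rfl fun b hb => by
      simp only [Finset.mem_product, Finset.mem_range] at hb
      rw [h50 _ hb.1 _ hb.2, div_mul_eq_mul_div], ← Finset.sum_div]
    simp only at hsum
    rw [hsum]
    -- `T²` cells times `T^17` steps.
    have hsq : max (z (T ^ 17) 47 x y) 0 ^ 2 ≤ (T : ℝ) ^ 19 := by
      refine (Finset.single_le_sum (f := fun c : ℕ × ℕ => max (z (T ^ 17) 47 c.1 c.2) 0 ^ 2)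
        (fun c _ => sq_nonneg _) (a := (x, y)) (by simp [hxT, hyT])).trans (cB.trans (le_of_eq ?_))
      rw [Finset.card_product, Finset.card_range]
      push_cast
      ring
    have hbound : max (z (T ^ 17) 47 x y) 0 ≤ (T : ℝ) ^ 13 / 32 := by
      refine le_of_sq_le_sq (hsq.trans ?_) (by positivity)
      have h3 : (3 : ℝ) ≤ T := by exact_mod_cast hT
      have h7 : (3 : ℝ) ^ 7 ≤ (T : ℝ) ^ 7 := pow_le_pow_left₀ (by norm_num) h3 7
      have h19 : (0 : ℝ) < (T : ℝ) ^ 19 := by positivity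
      have e : ((T : ℝ) ^ 13 / 32) ^ 2 = (T : ℝ) ^ 19 * (T : ℝ) ^ 7 / 1024 := by ring
      rw [e, le_div_iff₀ (by norm_num)]
      nlinarith
    rw [div_le_div_iff₀ (by positivity) (by positivity)]
    have := (le_max_left (z (T ^ 17) 47 x y) 0).trans hbound
    have hp : (0 : ℝ) < 32 * (T : ℝ) ^ 4 := by positivity
    calc z (T ^ 17) 47 x y * (32 * (T : ℝ) ^ 4) ≤ (T : ℝ) ^ 13 / 32 * (32 * (T : ℝ) ^ 4) := by gcongr
      _ = 1 * (T : ℝ) ^ 17 := by ring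

end LinearProgram

end SwapRegret

namespace SwapRegret

/-! ### Accuracy of the computed expert weights. -/

section Weights

variable {T : ℕ} {O : Query → ℝ → ℝ} {γ : ℝ}

theorem exists_index (hγ : 0 < γ) (hγT : 1 < γ * T) :
    ∃ I K : Theta γ → ℕ, (∀ θ, I θ < T) ∧ (∀ θ, K θ < T) ∧
      ∀ i k, ∀ h : IsPair γ i k, I (h.pair hγ) = i ∧ K (h.pair hγ) = k := by
  choose I hI K hK hIK hθ using exists_isPair hγ hγT
  refine ⟨I, K, hI, hK, fun i k h => ?_⟩
  obtain ⟨e1, e2⟩ := pair_injective hγ (congrArg Subtype.val (hθ (h.pair hγ)))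
  exact ⟨e1.symm, e2.symm⟩

/-- The sums over the experts as sums over indices. -/
theorem sum_expert_eq (hγ : 0 < γ) (hγT : 1 < γ * T) {m : Mem} (hm : Static T γ m)
    {f : Expert γ → ℝ} {g : Xi → ℕ → ℕ → ℝ}
    (hfg : ∀ i < T, ∀ k < T, ∀ h : IsPair γ i k, ∀ ξ, f (h.pair hγ, ξ) = g ξ i k) :
    ∑ i ∈ Finset.range T, ∑ k ∈ Finset.range T, m 9 i k * ∑ ξ, g ξ i k = ∑ e, f e := by
  rw [Fintype.sum_prod_type, sum_Theta_eq hγ hγT (g := fun i k => m 9 i k * ∑ ξ, g ξ i k)]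
  · intro i hi k hk h
    rw [hm.valid i hi k hk, if_pos h, one_mul]
    exact Finset.sum_congr rfl fun ξ _ => hfg i hi k hk h ξ
  · intro i hi k hk h
    rw [hm.valid i hi k hk, if_neg h, zero_mul]

theorem sum_range_pow_lt (T : ℕ) (f : ℕ → ℝ) :
    ∑ q ∈ Finset.range T, (if 2 ^ q < T then f q else 0) =
      ∑ k : Fin (Nat.clog 2 T), f k := by
  rw [Fin.sum_univ_eq_sum_range f, ← Finset.sum_filter]
  congr 1
  ext q
  have h1 := Nat.lt_clog_iff_pow_lt (b := 2) (by norm_num) (x := T) (y := q)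
  have h2 : q < 2 ^ q := Nat.lt_two_pow_self
  simp only [Finset.mem_filter, Finset.mem_range]
  rw [h1]
  omega

theorem rate_eq_lrate {K : ℕ} (k : Fin K) : rate k = lrate k := rfl

theorem Static.init_eq {m : Mem} (hm : Static T γ m) {q : ℕ} (hq : q < T) :
    m 12 q 0 = if 2 ^ q < T then lrate q ^ 2 / ∑ j : Fin (Nat.clog 2 T), rate j ^ 2 else 0 := by
  rw [hm.init q hq 0 (by omega), sum_range_pow_lt T fun q => lrate q ^ 2]
  simp only [rate_eq_lrate]
  split_ifs
  · rfl
  · rw [zero_div]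

theorem tiltM_eq {m : Mem} (hm : Static T γ m) {G : Fin (Nat.clog 2 T) → ℝ}
    (hG : ∀ k : Fin (Nat.clog 2 T), m 36 k 0 = G k) (x : ℝ) :
    tiltM T m x = ∑ k, tilt rate (masterInit (Nat.clog 2 T)) G x k := by
  unfold tiltM
  rw [Finset.sum_congr rfl fun q hq => by rw [hm.init_eq (Finset.mem_range.1 hq), ite_mul, zero_mul],
    sum_range_pow_lt T fun q => lrate q ^ 2 / (∑ j : Fin (Nat.clog 2 T), rate j ^ 2) *
      Real.exp (-(lrate q * (m 36 q 0 + x)))]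
  refine Finset.sum_congr rfl fun k _ => ?_
  simp only [tilt, masterInit, hG, rate_eq_lrate]

/-- The memory describes the cumulative losses of the experts and of the base algorithms. -/
structure Tracks (hγ : 0 < γ) (T : ℕ) (m : Mem) (L : List (Expert γ → ℝ)) : Prop where
  sum : ∀ i < T, ∀ k < T, ∀ (h : IsPair γ i k) (ξ : Xi),
    m (28 + ξ.num) i k = (L.map fun c => c (h.pair hγ, ξ)).sum
  sq : ∀ i < T, ∀ k < T, ∀ (h : IsPair γ i k) (ξ : Xi),
    m (32 + ξ.num) i k = (L.map fun c => c (h.pair hγ, ξ) ^ 2).sum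
  master : ∀ k : Fin (Nat.clog 2 T), m 36 k 0 = cumLoss rate (masterLosses (Nat.clog 2 T) L) k

theorem Tracks.congr {hγ : 0 < γ} {m m' : Mem} {L : List (Expert γ → ℝ)} (h : Tracks hγ T m L)
    (hm : ∀ a, 28 ≤ a → a < 37 → m' a = m a) : Tracks hγ T m' L := by
  refine ⟨fun i hi k hk hp ξ => ?_, fun i hi k hk hp ξ => ?_, fun k => ?_⟩
  · have := ξ.num_lt
    rw [hm _ (by omega) (by omega), h.sum i hi k hk]
  · have := ξ.num_lt
    rw [hm _ (by omega) (by omega), h.sq i hi k hk]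
  · rw [hm _ (by omega) (by omega), h.master]

theorem cumLoss_const_eq {ι : Type} (η : ℝ) (L : List (ι → ℝ)) (e : ι) :
    cumLoss (fun _ => η) L e = (L.map fun c => c e).sum + 32 * η * (L.map fun c => c e ^ 2).sum := by
  unfold cumLoss
  rw [List.sum_map_add, List.sum_map_mul_left]

theorem Tracks.expoM_eq {hγ : 0 < γ} {m : Mem} {L : List (Expert γ → ℝ)} (h : Tracks hγ T m L)
    (q : Fin (Nat.clog 2 T)) {i k : ℕ} (hi : i < T) (hk : k < T) (hp : IsPair γ i k) (ξ : Xi) :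
    expoM m ξ q i k = Real.exp (-(2 * rate q * cumLoss (fun _ => 2 * rate q) L (hp.pair hγ, ξ))) := by
  rw [cumLoss_const_eq, expoM, h.sum i hi k hk hp, h.sq i hi k hk hp]
  rfl

theorem Tracks.normM_eq {hγ : 0 < γ} (hγT : 1 < γ * T) {m : Mem} (hm : Static T γ m)
    {L : List (Expert γ → ℝ)} (h : Tracks hγ T m L) (q : Fin (Nat.clog 2 T)) :
    normM T m q = ∑ e, Real.exp (-(2 * rate q * cumLoss (fun _ => 2 * rate q) L e)) :=
  sum_expert_eq hγ hγT hm fun _ hi _ hk hp ξ => (h.expoM_eq q hi hk hp ξ).symm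

theorem Tracks.baseWeights_eq {hγ : 0 < γ} (hγ1 : γ ≤ 1) (hγT : 1 < γ * T) {m : Mem}
    (hm : Static T γ m) {L : List (Expert γ → ℝ)} (h : Tracks hγ T m L) (q : Fin (Nat.clog 2 T))
    {i k : ℕ} (hi : i < T) (hk : k < T) (hp : IsPair γ i k) (ξ : Xi) :
    expoM m ξ q i k / normM T m q = baseWeights q L (hp.pair hγ, ξ) := by
  have : Nonempty (Expert γ) := (Theta_nonempty hγ hγ1).map fun θ => (θ, Xi.pos1)
  rw [h.expoM_eq q hi hk hp, h.normM_eq hγT hm q, baseWeights,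
    msmwc_uniform (by have := rate_pos q; positivity)]

theorem abs_cumLoss_le {K : ℕ} {M : List (Fin K → ℝ)} (hM : ∀ c ∈ M, ∀ k, |c k| ≤ 1) (k : Fin K) :
    |cumLoss rate M k| ≤ 2 * M.length := by
  induction M with
  | nil => simp [cumLoss]
  | cons c M ih =>
    have h1 := ih fun c hc => hM c (List.mem_cons_of_mem _ hc)
    have h2 := hM c List.mem_cons_self k
    have h3 : c k ^ 2 ≤ 1 := by rw [← sq_abs]; exact pow_le_one₀ (abs_nonneg _) h2
    have h4 := rate_pos k
    have h5 := rate_le k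
    have h6 : cumLoss rate (c :: M) k = (c k + 32 * rate k * c k ^ 2) + cumLoss rate M k := by
      simp [cumLoss]
    have h7 : 0 ≤ 32 * rate k * c k ^ 2 := by positivity
    have h8 : 32 * rate k * c k ^ 2 ≤ 1 := by nlinarith [sq_nonneg (c k)]
    rw [h6, List.length_cons]
    push_cast
    rw [abs_le] at h1 h2 ⊢
    constructor <;> linarith [h1.1, h1.2, h2.1, h2.2]

theorem length_masterLosses {ι : Type} [Fintype ι] (K : ℕ) (L : List (ι → ℝ)) :
    (masterLosses K L).length = L.length := by
  induction L with
  | nil => rfl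
  | cons c L ih => simp [masterLosses, ih]

/-- The weights that the program computes are close to those of the expert algorithm. -/
def Close (hγ : 0 < γ) (T : ℕ) (m : Mem) (w : Expert γ → ℝ) : Prop :=
  ∀ L : List (Expert γ → ℝ), Tracks hγ T m L → L.length < T → (∀ c ∈ L, ∀ e, |c e| ≤ 1) →
    ∑ e, |w e - expertWeights T L e| ≤ 1 / (32 * T)

theorem expoM_pos (m : Mem) (ξ : Xi) (q i k : ℕ) : 0 < expoM m ξ q i k := Real.exp_pos _

/-- The base weights are exact; only the master's multiplier is approximated. The computed weights
are normalized whatever the multiplier, so they form a point of the simplex even without a tracked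
history. -/
theorem weightProg_weights (hγ : 0 < γ) (hγ1 : γ ≤ 1) (hγT : 1 < γ * T) (hT : 2 < T) {m : Mem}
    (hm : Static T γ m) :
    Spec T O weightProg m fun m' => (∀ a, a < 38 → m' a = m a) ∧
      ∃ w ∈ stdSimplex ℝ (Expert γ), Close hγ T m w ∧
        ∀ i < T, ∀ k < T, ∀ h : IsPair γ i k, ∀ ξ : Xi,
          m' (43 + ξ.num) i k = w (h.pair hγ, ξ) := by
  have hK : 0 < Nat.clog 2 T := Nat.clog_pos (by norm_num) (by omega)
  have hFin : Nonempty (Fin (Nat.clog 2 T)) := ⟨⟨0, hK⟩⟩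
  have hEx : Nonempty (Expert γ) := (Theta_nonempty hγ hγ1).map fun θ => (θ, Xi.pos1)
  refine (weightProg_spec (by omega) m).mono fun m' ⟨hk, x, hx0, hx, hW⟩ => ⟨hk, ?_⟩
  obtain ⟨I, K, hI, hK', hIK⟩ := exists_index hγ hγT
  set G : Fin (Nat.clog 2 T) → ℝ := fun k => m 36 k 0 with hG
  have htilt := tiltM_eq hm (G := G) fun _ => rfl
  set p : Fin (Nat.clog 2 T) → ℝ := fun q => tilt rate (masterInit (Nat.clog 2 T)) G (x (T ^ 4)) q /
    ∑ j, tilt rate (masterInit (Nat.clog 2 T)) G (x (T ^ 4)) j with hp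
  have hsum0 : 0 < ∑ j, tilt rate (masterInit (Nat.clog 2 T)) G (x (T ^ 4)) j :=
    Finset.sum_pos (fun j _ => tilt_pos masterInit_pos _ j) Finset.univ_nonempty
  have hp0 : ∀ q, 0 ≤ p q := fun q => div_nonneg (tilt_pos masterInit_pos _ q).le hsum0.le
  have hp1 : ∑ q, p q = 1 := by rw [hp, ← Finset.sum_div, div_self hsum0.ne']
  set E : ℕ → Expert γ → ℝ := fun q e => expoM m e.2 q (I e.1) (K e.1) with hE
  have hEpos : ∀ q e, 0 < E q e := fun q e => expoM_pos _ _ _ _ _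
  have hEeq : ∀ q i k, ∀ h : IsPair γ i k, ∀ ξ, E q (h.pair hγ, ξ) = expoM m ξ q i k :=
    fun q i k h ξ => by simp only [hE, (hIK i k h).1, (hIK i k h).2]
  have hN : ∀ q, normM T m q = ∑ e, E q e := fun q =>
    sum_expert_eq hγ hγT hm fun i _ k _ h ξ => hEeq q i k h ξ
  have hNpos : ∀ q, 0 < normM T m q := fun q => by
    rw [hN]; exact Finset.sum_pos (fun e _ => hEpos q e) Finset.univ_nonempty
  have hWw : ∀ i < T, ∀ k < T, ∀ h : IsPair γ i k, ∀ ξ : Xi, m' (43 + ξ.num) i k =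
      ∑ q : Fin (Nat.clog 2 T), p q * (E q (h.pair hγ, ξ) / normM T m q) := by
    intro i hi k hk h ξ
    rw [hW ξ i hi k hk, hm.valid i hi k hk, if_pos h, one_mul,
      Finset.sum_congr rfl fun q hq => by
        rw [hm.init_eq (Finset.mem_range.1 hq), ite_mul, ite_div, ite_mul, ite_div, zero_mul,
          zero_div, zero_mul, zero_div],
      sum_range_pow_lt T fun q => lrate q ^ 2 / (∑ j : Fin (Nat.clog 2 T), rate j ^ 2) *
        Real.exp (-(lrate q * (m 36 q 0 + x (T ^ 4)))) / tiltM T m (x (T ^ 4)) *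
          expoM m ξ q i k / normM T m q]
    refine Finset.sum_congr rfl fun q _ => ?_
    rw [hEeq, htilt, mul_div_assoc]
    rfl
  refine ⟨fun e => ∑ q : Fin (Nat.clog 2 T), p q * (E q e / normM T m q), ⟨fun e => ?_, ?_⟩, ?_,
    hWw⟩
  · exact Finset.sum_nonneg fun q _ => mul_nonneg (hp0 q) (div_nonneg (hEpos q e).le (hNpos q).le)
  · rw [Finset.sum_comm]
    simp_rw [← Finset.mul_sum, ← Finset.sum_div, ← hN, div_self (hNpos _).ne', mul_one]
    exact hp1
  · intro L hL hlen hbd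
    have hb : ∀ q : Fin (Nat.clog 2 T), ∀ e, E q e / normM T m q = baseWeights q L e := by
      rintro q ⟨θ, ξ⟩
      obtain ⟨i, hi, k, hk, h, rfl⟩ := exists_isPair hγ hγT θ
      rw [hEeq, hL.baseWeights_eq hγ1 hγT hm q hi hk h]
    have hGc : G = cumLoss rate (masterLosses (Nat.clog 2 T) L) := funext fun k => hL.master k
    have hT0 : (0 : ℝ) < T := by positivity
    -- Each corrected loss of the master is at most `2` in absolute value, since `32 η_k ≤ 1`.
    have hGb : ∀ k, |G k| ≤ 2 * T := fun k => by
      rw [hGc]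
      refine (abs_cumLoss_le (masterLosses_bound L hbd) k).trans ?_
      rw [length_masterLosses]
      have : (L.length : ℝ) ≤ T := by exact_mod_cast hlen.le
      linarith
    obtain ⟨Λ, hΛ, hΛ1⟩ := exists_sum_tilt_eq_one (η := rate) (y := masterInit (Nat.clog 2 T))
      (G := G) rate_pos ⟨fun k => (masterInit_pos k).le, sum_masterInit hK⟩
      (by positivity) hGb
    have hscan : x (T ^ 4) ∈ Set.Icc Λ (Λ + 1 / T) := by
      refine scan_mem_Icc (Φ := tiltM T m) (a := -(2 * T)) ?_ (by positivity) ?_ hΛ.1 hx0 hx ?_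
      · intro a b hab
        rw [htilt, htilt]
        exact sum_tilt_strictAnti rate_pos masterInit_pos hab
      · rw [htilt]; exact hΛ1
      · refine hΛ.2.trans ?_
        have h3 : (3 : ℝ) ≤ T := by exact_mod_cast hT
        have e : ((T ^ 4 : ℕ) : ℝ) * (1 / T) = (T : ℝ) ^ 3 := by push_cast; field_simp
        rw [e]
        nlinarith [mul_nonneg hT0.le (sub_nonneg.2 h3), sq_nonneg ((T : ℝ) - 3)]
    have hmaster : masterWeights (Nat.clog 2 T) L =
        tilt rate (masterInit (Nat.clog 2 T)) G Λ := by
      rw [hGc] at hΛ1 ⊢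
      exact msmwc_eq_tilt rate_pos masterInit_pos (sum_masterInit hK) _ hΛ1
    have herr := sum_abs_tilt_sub_le (η := rate) (y := masterInit (Nat.clog 2 T)) (G := G)
      rate_pos rate_le masterInit_pos hΛ1 hscan (by
        rw [div_le_one hT0]; exact_mod_cast (by omega : 1 ≤ T))
    calc ∑ e, |∑ q : Fin (Nat.clog 2 T), p q * (E q e / normM T m q) - expertWeights T L e|
        ≤ ∑ e, ∑ q : Fin (Nat.clog 2 T),
            |p q - tilt rate (masterInit (Nat.clog 2 T)) G Λ q| * baseWeights q L e := by
          refine Finset.sum_le_sum fun e _ => ?_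
          rw [expertWeights, ← Finset.sum_sub_distrib]
          refine (Finset.abs_sum_le_sum_abs _ _).trans (Finset.sum_le_sum fun q _ => le_of_eq ?_)
          rw [hb, hmaster, ← sub_mul, abs_mul, abs_of_pos (baseWeights_pos q L e)]
      _ = ∑ q : Fin (Nat.clog 2 T), |p q - tilt rate (masterInit (Nat.clog 2 T)) G Λ q| := by
          rw [Finset.sum_comm]
          simp_rw [← Finset.mul_sum, sum_baseWeights, mul_one]
      _ ≤ 1 / T / 32 := herr
      _ = 1 / (32 * T) := by rw [div_div, mul_comm]

end Weights

end SwapRegret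

namespace SwapRegret

/-! ### The rounds of the program and the perturbation to an accurate execution. -/

section Rounds

variable {T : ℕ} {O : Query → ℝ → ℝ} {γ : ℝ}

/-- The memory after a round holds a distribution `κ` that solves the linear program with weights
`w` approximately. -/
structure Solved (hγ : 0 < γ) (T : ℕ) (m : Mem) (w : Expert γ → ℝ) (κ : Theta γ → ℝ) : Prop where
  static : Static T γ m
  weights : w ∈ stdSimplex ℝ (Expert γ)
  close : Close hγ T m w
  dist : κ ∈ stdSimplex ℝ (Theta γ)
  table : ∀ i < T, ∀ k < T, ∀ h : IsPair γ i k, m 50 i k = κ (h.pair hγ)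
  table_zero : ∀ i < T, ∀ k < T, ¬ IsPair γ i k → m 50 i k = 0
  lp : ∀ x < 2, ∀ y : ℕ, y * γ ≤ 1 →
    ∑ θ, κ θ * hmix γ w θ (testPoint γ x y) ≤ 1 / (32 * T ^ 4)

theorem predict_spec (hγ : 0 < γ) (hγ1 : γ ≤ 1) (hγT : 1 < γ * T) (hT : 2 < T) {m : Mem}
    (hm : Static T γ m) :
    Spec T O (weightProg.seq lpProg) m fun m' => (∀ a, a < 38 → m' a = m a) ∧
      ∃ w κ, Solved hγ T m' w κ := by
  refine Spec.seq ((weightProg_weights hγ hγ1 hγT hT hm).mono fun m1 ⟨k1, w, hw, hclose, hwm⟩ => ?_)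
  have hm1 : Static T γ m1 := hm.congr fun a _ ha => k1 a (by omega)
  refine (lpProg_spec hγ hγ1 hγT hT hm1 hw.1 (fun θ => ?_) hwm).mono
    fun m2 ⟨k2, κ, hκ, h1, h2, h3⟩ => ?_
  · rw [← hw.2, Fintype.sum_prod_type]
    exact Finset.single_le_sum (f := fun θ => ∑ ξ, w (θ, ξ))
      (fun θ _ => Finset.sum_nonneg fun ξ _ => hw.1 _) (Finset.mem_univ θ)
  · have hk : ∀ a, a < 38 → m2 a = m a := fun a ha => by rw [k2 a (by omega), k1 a ha]
    exact ⟨hk, w, κ, hm.congr fun a _ ha => hk a (by omega), hw, fun L hL =>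
      hclose L (hL.congr fun a _ ha => (hk a (by omega)).symm), hκ, h1, h2, h3⟩

theorem exists_solved (hT : 2 < T) {δ : ℝ} (hδ : 0 < δ) (hδT : δ ≤ 1 / T) (H : List Loss) :
    ∃ w κ, Solved (gammaParam_pos hT hδ hδT) T (roundMem firstProg nextProg T δ H) w κ := by
  have predict := fun (O : Query → ℝ → ℝ) (m : Mem) => predict_spec (T := T) (O := O) (m := m)
    (gammaParam_pos hT hδ hδT) (gammaParam_le_one T δ) (one_lt_gammaParam_mul hT hδ hδT) hT
  induction H with
  | nil => exact (predict _ _ (initProg_spec (O := fun _ _ => 0) hT hδ hδT).1).2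
  | cons ℓ H ih =>
    obtain ⟨w, κ, h⟩ := ih
    exact (predict _ _ (h.static.congr (updateProg_spec (T := T) (O := ℓ.answer) _).1)).2

theorem tracks_nil (hT : 2 < T) {δ : ℝ} (hδ : 0 < δ) (hδT : δ ≤ 1 / T) :
    Tracks (gammaParam_pos hT hδ hδT) T (roundMem firstProg nextProg T δ []) [] := by
  have h1 := initProg_spec (O := fun _ _ => 0) hT hδ hδT
  have h2 := predict_spec (O := fun _ _ => 0) (gammaParam_pos hT hδ hδT) (gammaParam_le_one T δ)
    (one_lt_gammaParam_mul hT hδ hδT) hT h1.1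
  refine Tracks.congr ⟨fun i _ k _ h ξ => ?_, fun i _ k _ h ξ => ?_, fun k => ?_⟩ fun a _ ha =>
    h2.1 a (by omega)
  · rw [h1.2 _ (by omega)]; simp
  · rw [h1.2 _ (by omega)]; simp
  · rw [h1.2 _ (by omega)]; simp [masterLosses, cumLoss]

theorem Solved.lossM_eq {hγ : 0 < γ} {m : Mem} {w : Expert γ → ℝ} {κ : Theta γ → ℝ}
    (h : Solved hγ T m w κ) (ℓ : Loss) {i k : ℕ} (hi : i < T) (hk : k < T) (hp : IsPair γ i k)
    (ξ : Xi) :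
    lossM ℓ.answer m ξ i k = -reward γ (pmfOfSimplex κ h.dist) ℓ (hp.pair hγ, ξ) := by
  have hr : 0 < 2 ^ i * γ := by positivity
  rw [lossM, h.table i hi k hk hp, h.static.gamma, h.static.scale i hi k hk,
    h.static.bin i hi k hk, if_pos hp, if_pos hp,
    ← hmean_eq_meanFrom γ ξ hr (by positivity) hp.2, reward_eq, pmfOfSimplex_toReal]
  rfl

theorem Solved.baseLoss_eq {hγ : 0 < γ} (hγ1 : γ ≤ 1) (hγT : 1 < γ * T) {m : Mem}
    {w : Expert γ → ℝ} {κ : Theta γ → ℝ} (h : Solved hγ T m w κ) {L : List (Expert γ → ℝ)}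
    (hL : Tracks hγ T m L) (ℓ : Loss) (q : Fin (Nat.clog 2 T)) :
    baseLoss T ℓ.answer m q =
      ∑ e, baseWeights q L e * (-reward γ (pmfOfSimplex κ h.dist) ℓ) e := by
  have e1 := sum_expert_eq hγ hγT h.static
    (f := fun e => baseWeights q L e * (-reward γ (pmfOfSimplex κ h.dist) ℓ) e)
    (g := fun ξ i k => expoM m ξ q i k / normM T m q * lossM ℓ.answer m ξ i k)
    fun i hi k hk hp ξ => by
      rw [hL.baseWeights_eq hγ1 hγT h.static q hi hk hp, h.lossM_eq ℓ hi hk hp]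
      rfl
  rw [← e1, baseLoss, Finset.sum_div]
  refine Finset.sum_congr rfl fun i _ => ?_
  rw [Finset.sum_div]
  refine Finset.sum_congr rfl fun k _ => ?_
  rw [mul_div_assoc, Finset.sum_div]
  congr 1
  exact Finset.sum_congr rfl fun ξ _ => by ring

/-- The stored sums refer to the rewards of the distribution actually output, and are updated
exactly. Hence the errors of earlier multipliers do not accumulate. -/
theorem tracks_cons (hT : 2 < T) {δ : ℝ} (hδ : 0 < δ) (hδT : δ ≤ 1 / T) {H : List Loss}
    {w : Expert (gammaParam T δ) → ℝ} {κ : Theta (gammaParam T δ) → ℝ}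
    (h : Solved (gammaParam_pos hT hδ hδT) T (roundMem firstProg nextProg T δ H) w κ)
    {L : List (Expert (gammaParam T δ) → ℝ)}
    (hL : Tracks (gammaParam_pos hT hδ hδT) T (roundMem firstProg nextProg T δ H) L) (ℓ : Loss) :
    Tracks (gammaParam_pos hT hδ hδT) T (roundMem firstProg nextProg T δ (ℓ :: H))
      (-reward (gammaParam T δ) (pmfOfSimplex κ h.dist) ℓ :: L) := by
  have hγT := one_lt_gammaParam_mul hT hδ hδT
  have h1 := updateProg_spec (T := T) (O := ℓ.answer) (roundMem firstProg nextProg T δ H)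
  have h2 := predict_spec (O := ℓ.answer) (gammaParam_pos hT hδ hδT) (gammaParam_le_one T δ)
    hγT hT (h.static.congr h1.1)
  refine Tracks.congr ⟨fun i hi k hk hp ξ => ?_, fun i hi k hk hp ξ => ?_, fun k => ?_⟩
    fun a _ ha => h2.1 a (by omega)
  · rw [h1.2.1 ξ i hi k hk, hL.sum i hi k hk hp, h.lossM_eq ℓ hi hk hp, List.map_cons,
      List.sum_cons, add_comm]
    rfl
  · rw [h1.2.2.1 ξ i hi k hk, hL.sq i hi k hk hp, h.lossM_eq ℓ hi hk hp, List.map_cons,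
      List.sum_cons, add_comm]
    rfl
  · have hkT : k.val < T := by
      have h3 := (Nat.lt_clog_iff_pow_lt (b := 2) (by norm_num)).1 k.2
      have h4 : k.val < 2 ^ k.val := Nat.lt_two_pow_self
      omega
    rw [h1.2.2.2 k hkT 0 (by omega), hL.master, h.baseLoss_eq (gammaParam_le_one T δ) hγT hL]
    simp only [masterLosses, cumLoss, List.map_cons, List.sum_cons, rate_eq_lrate]
    ring

/-- The uniform weights on two constraints of each pair. -/
noncomputable def twoUniform (γ : ℝ) (e : Expert γ) : ℝ :=
  if e.2 = Xi.pos2 ∨ e.2 = Xi.pos1 then 1 / (2 * ((Theta γ).card : ℝ)) else 0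

theorem twoUniform_nonneg (e : Expert γ) : 0 ≤ twoUniform γ e := by
  unfold twoUniform
  split_ifs <;> positivity

/-- The weights with a small uniform weight on two constraints of each pair. -/
noncomputable def perturb (ε : ℝ) (w : Expert γ → ℝ) (e : Expert γ) : ℝ :=
  (1 - ε) * w e + ε * twoUniform γ e

theorem sum_twoUniform (hγ : 0 < γ) (hγ1 : γ ≤ 1) : ∑ e, twoUniform γ e = 1 := by
  have hc : (0 : ℝ) < (Theta γ).card := by
    have := Theta_nonempty hγ hγ1
    exact_mod_cast Finset.card_pos.2 (Finset.nonempty_coe_sort.1 this)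
  rw [Fintype.sum_prod_type]
  simp only [sum_Xi, twoUniform]
  simp
  field_simp
  norm_num

theorem perturb_mem_stdSimplex (hγ : 0 < γ) (hγ1 : γ ≤ 1) {ε : ℝ} (h0 : 0 ≤ ε) (h1 : ε ≤ 1)
    {w : Expert γ → ℝ} (hw : w ∈ stdSimplex ℝ (Expert γ)) :
    perturb ε w ∈ stdSimplex ℝ (Expert γ) := by
  refine ⟨fun e => add_nonneg (mul_nonneg (by linarith) (hw.1 e)) (mul_nonneg h0
    (twoUniform_nonneg e)), ?_⟩
  unfold perturb
  rw [Finset.sum_add_distrib, ← Finset.mul_sum, ← Finset.mul_sum, hw.2, sum_twoUniform hγ hγ1]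
  ring

theorem sum_abs_perturb_sub_le (hγ : 0 < γ) (hγ1 : γ ≤ 1) {ε : ℝ} (h0 : 0 ≤ ε)
    {w : Expert γ → ℝ} (hw : w ∈ stdSimplex ℝ (Expert γ)) :
    ∑ e, |perturb ε w e - w e| ≤ 2 * ε := by
  calc ∑ e, |perturb ε w e - w e| ≤ ∑ e, (ε * w e + ε * twoUniform γ e) := by
        refine Finset.sum_le_sum fun e _ => ?_
        have hw0 := mul_nonneg h0 (hw.1 e)
        have hu0 := mul_nonneg h0 (twoUniform_nonneg e)
        have e1 : perturb ε w e - w e = ε * twoUniform γ e - ε * w e := by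
          unfold perturb; ring
        rw [e1, abs_le]
        constructor <;> linarith
    _ = 2 * ε := by
        rw [Finset.sum_add_distrib, ← Finset.mul_sum, ← Finset.mul_sum, hw.2,
          sum_twoUniform hγ hγ1]
        ring

/-- The constraints `+2` and `+1` of a pair sum to at most `-γ/(4r) ≤ -γ/4` at every outcome, so
equal weights `1/(2|Θ|)` on the two create slack for each pair at once. -/
theorem hmix_perturb_le (hγ : 0 < γ) {ε : ℝ} (h0 : 0 ≤ ε) {w : Expert γ → ℝ} (θ : Theta γ) (v : ℝ) :
    hmix γ (perturb ε w) θ v ≤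
      (1 - ε) * hmix γ w θ v - ε * (γ / (8 * (Theta γ).card)) := by
  have hr1 : θ.1.1 ≤ 1 := (scale_mem hγ (mem_Theta.1 θ.2).1).2
  have hr0 : 0 < θ.1.1 := hγ.trans_le (Theta_scale_ge hγ θ)
  have h := hval_pos2_add_pos1 (γ := γ) (b := θ.1.2) (v := v) hr0
  have hγr : γ / 4 ≤ γ / (4 * θ.1.1) := by
    rw [div_le_div_iff₀ (by norm_num) (by positivity)]
    nlinarith
  have hc : (0 : ℝ) ≤ 1 / (2 * (Theta γ).card) := by positivity
  have e1 : hmix γ (perturb ε w) θ v = (1 - ε) * hmix γ w θ v + ε * (1 / (2 * (Theta γ).card)) *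
      (hval γ Xi.pos2 θ.1.1 θ.1.2 v + hval γ Xi.pos1 θ.1.1 θ.1.2 v) := by
    simp [hmix, sum_Xi, perturb, twoUniform]
    ring
  rw [e1]
  have e2 : ε * (γ / (8 * (Theta γ).card)) = ε * (1 / (2 * (Theta γ).card)) * (γ / 4) := by
    rw [mul_assoc, div_mul_div_comm, one_mul]
    ring_nf
  rw [e2]
  have := mul_le_mul_of_nonneg_left (h.trans (neg_le_neg hγr)) (mul_nonneg h0 hc)
  linarith

/-- The slack of the perturbed weights outweighs the error of the approachability iteration. The
distribution is unchanged; only the weights it is compared with move. -/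
theorem Solved.lp_perturb {hγ : 0 < γ} (hγ1 : γ ≤ 1) (hγT : 1 < γ * T) (hT : 2 < T) {m : Mem}
    {w : Expert γ → ℝ} {κ : Theta γ → ℝ} (h : Solved hγ T m w κ) (v : unitInterval) :
    ∑ θ, κ θ * mixture γ (perturb (1 / (4 * T)) w) θ v ≤ 0 := by
  have hT0 : (0 : ℝ) < T := by positivity
  have hc : (0 : ℝ) < (Theta γ).card := by
    have := Theta_nonempty hγ hγ1
    exact_mod_cast Finset.card_pos.2 (Finset.nonempty_coe_sort.1 this)
  have hc2 : ((Theta γ).card : ℝ) ≤ (T : ℝ) ^ 2 := by exact_mod_cast card_Theta_le hγ hγT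
  have hε1 : 1 / (4 * (T : ℝ)) ≤ 1 := by
    rw [div_le_one (by positivity)]
    have : (3 : ℝ) ≤ T := by exact_mod_cast hT
    linarith
  obtain ⟨x, hx, y, hy, hxy⟩ := exists_testPoint hγ v.2.1
  have e1 : ∀ θ, mixture γ (perturb (1 / (4 * T)) w) θ v =
      hmix γ (perturb (1 / (4 * T)) w) θ (testPoint γ x y) := fun θ => by
    rw [mixture_eq, hmix]
    exact Finset.sum_congr rfl fun ξ _ => by rw [hxy _ _ θ.2]
  have h1 := h.lp x hx y (hy.trans v.2.2)
  -- Follows from `|Θ| ≤ T²` and `γ T > 1`; this dictates the accuracy required of the iteration.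
  have hslack : 1 / (32 * (T : ℝ) ^ 4) ≤ 1 / (4 * T) * (γ / (8 * (Theta γ).card)) := by
    rw [div_mul_div_comm, div_le_div_iff₀ (by positivity) (by positivity)]
    have h3 : (Theta γ).card * 1 ≤ (T : ℝ) ^ 2 * (γ * T) :=
      mul_le_mul hc2 hγT.le (by norm_num) (by positivity)
    nlinarith
  calc ∑ θ, κ θ * mixture γ (perturb (1 / (4 * T)) w) θ v
      ≤ ∑ θ, κ θ * ((1 - 1 / (4 * T)) * hmix γ w θ (testPoint γ x y) -
          1 / (4 * T) * (γ / (8 * (Theta γ).card))) := by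
        refine Finset.sum_le_sum fun θ _ => mul_le_mul_of_nonneg_left ?_ (h.dist.1 θ)
        rw [e1]
        exact hmix_perturb_le hγ (by positivity) θ _
    _ = (1 - 1 / (4 * T)) * ∑ θ, κ θ * hmix γ w θ (testPoint γ x y) -
          1 / (4 * T) * (γ / (8 * (Theta γ).card)) := by
        simp_rw [mul_sub, Finset.sum_sub_distrib, ← Finset.sum_mul, h.dist.2, one_mul,
          Finset.mul_sum]
        congr 1
        exact Finset.sum_congr rfl fun θ _ => by ring
    _ ≤ 0 := by
        have h2 : (1 - 1 / (4 * (T : ℝ))) * ∑ θ, κ θ * hmix γ w θ (testPoint γ x y) ≤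
            (1 - 1 / (4 * T)) * (1 / (32 * T ^ 4)) :=
          mul_le_mul_of_nonneg_left h1 (by linarith)
        have h3 : (1 - 1 / (4 * (T : ℝ))) * (1 / (32 * T ^ 4)) ≤ 1 / (32 * T ^ 4) :=
          mul_le_of_le_one_left (by positivity) (by
            have : 0 < 1 / (4 * (T : ℝ)) := by positivity
            linarith)
        linarith

theorem Solved.lists {hγ : 0 < γ} (hγ1 : γ ≤ 1) (hγT : 1 < γ * T) {m : Mem}
    {w : Expert γ → ℝ} {κ : Theta γ → ℝ} (h : Solved hγ T m w κ) {s : State}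
    (hs : Emitted T (T * T) (m 7) (m 8) (m 50) s) : s.Lists (pmfOfSimplex κ h.dist) := by
  classical
  have hdiv : ∀ j < T * T, j / T < T ∧ j % T < T := fun j hj =>
    ⟨Nat.div_lt_of_lt_mul hj, Nat.mod_lt _ (by
      rcases Nat.eq_zero_or_pos T with rfl | h
      · simp at hj
      · exact h)⟩
  refine ⟨fun j hj => ?_, fun θ => ?_⟩
  · rw [hs.count] at hj
    obtain ⟨h1, h2⟩ := hdiv j hj
    rw [hs.fst j hj, hs.snd j hj, h.static.scale _ h1 _ h2, h.static.bin _ h1 _ h2]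
    -- Entries of invalid index pairs repeat `(γ, 0)` in the list, with probability zero.
    split_ifs with hp
    · exact hp.mem hγ
    · exact mem_Theta.2 ⟨(mem_scales hγ).2 ⟨⟨0, by simp⟩, hγ1⟩,
        (mem_bins hγ).2 ⟨⟨0, by simp⟩, zero_le_one⟩⟩
  · rw [pmfOfSimplex_toReal, hs.count]
    have e1 : ∑ j ∈ Finset.range (T * T),
        (if (s.real 1 j 0, s.real 2 j 0) = (θ : ℝ × ℝ) then s.real 3 j 0 else 0) =
        ∑ i ∈ Finset.range T, ∑ k ∈ Finset.range T,
          if (m 7 i k, m 8 i k) = (θ : ℝ × ℝ) then m 50 i k else 0 := by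
      rw [Finset.sum_congr rfl fun j hj => by
        rw [hs.fst j (Finset.mem_range.1 hj), hs.snd j (Finset.mem_range.1 hj),
          hs.prob j (Finset.mem_range.1 hj)]]
      rw [← Finset.sum_product (Finset.range T) (Finset.range T) fun p =>
        if (m 7 p.1 p.2, m 8 p.1 p.2) = (θ : ℝ × ℝ) then m 50 p.1 p.2 else 0]
      refine Finset.sum_bij' (fun j _ => (j / T, j % T)) (fun p _ => p.1 * T + p.2) ?_ ?_ ?_ ?_ ?_
      · intro j hj
        have := hdiv j (Finset.mem_range.1 hj)
        simp [this.1, this.2]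
      · intro p hp
        simp only [Finset.mem_product, Finset.mem_range] at hp ⊢
        nlinarith
      · intro j _
        exact Nat.div_add_mod' j T
      · intro p hp
        simp only [Finset.mem_product, Finset.mem_range] at hp
        have hT : 0 < T := by omega
        refine Prod.ext ?_ ?_
        · change (p.1 * T + p.2) / T = p.1
          rw [mul_comm, Nat.mul_add_div hT, Nat.div_eq_of_lt hp.2, add_zero]
        · change (p.1 * T + p.2) % T = p.2
          rw [mul_comm, Nat.mul_add_mod, Nat.mod_eq_of_lt hp.2]
      · intro j _
        rfl
    rw [e1, ← sum_Theta_eq hγ hγT (fun θ' => if (θ' : ℝ × ℝ) = θ then κ θ' else 0)]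
    · rw [Finset.sum_eq_single θ]
      · simp
      · intro θ' _ hne
        rw [if_neg fun e => hne (Subtype.ext e)]
      · simp
    · intro i hi k hk hp
      rw [h.static.scale i hi k hk, h.static.bin i hi k hk, if_pos hp, if_pos hp,
        h.table i hi k hk hp]
      rfl
    · intro i hi k hk hp
      rw [h.table_zero i hi k hk hp]
      simp

/-- The program carries out the algorithm in polynomial time. -/
theorem exists_machine : ∃ (M : Machine) (c k : ℕ), ∀ T : ℕ, 2 < T → ∀ δ : ℝ, 0 < δ → δ ≤ 1 / T →
    ∃ P : Predictor (gammaParam T δ), P.Follows T (1 / T) ∧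
      ∀ H : List Loss, H.length < T →
        ∃ (s : State) (n : ℕ), M.Run T δ H s n ∧ n ≤ c * T ^ k ∧ s.Lists (P.dist H) := by
  obtain ⟨c, k, hrun⟩ := machineOf_run (aR := 7) (aB := 8) (aK := 50) firstProg_ok nextProg_ok
    (visible_of_le (by norm_num)) (visible_of_le (by norm_num)) (visible_of_le (by norm_num))
  refine ⟨machineOf firstProg nextProg 7 8 50, c, k, fun T hT δ hδ hδT => ?_⟩
  choose w κ hsol using exists_solved hT hδ hδT
  have hγ := gammaParam_pos hT hδ hδT
  have hγ1 := gammaParam_le_one T δ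
  have hγT := one_lt_gammaParam_mul hT hδ hδT
  have hT0 : (0 : ℝ) < T := by positivity
  -- The perturbed weights exist only in the proof. The machine computes `w` and `κ`, and `κ` is an
  -- exact solution for the perturbed weights.
  let P : Predictor (gammaParam T δ) :=
    { weights := fun H => perturb (1 / (4 * T)) (w H)
      dist := fun H => pmfOfSimplex (κ H) (hsol H).dist }
  have htrack : ∀ H, Tracks hγ T (roundMem firstProg nextProg T δ H)
      ((P.rewards H).map fun u => -u) := by
    intro H
    induction H with
    | nil => exact tracks_nil hT hδ hδT
    | cons ℓ H ih => exact tracks_cons hT hδ hδT (hsol H) ih ℓ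
  have hlen : ∀ H, (P.rewards H).length = H.length := by
    intro H
    induction H with
    | nil => rfl
    | cons ℓ H ih => simp [Predictor.rewards, ih]
  refine ⟨P, fun H hH => ⟨?_, ?_, fun v => ?_⟩, fun H hH => ?_⟩
  · refine perturb_mem_stdSimplex hγ hγ1 (by positivity) ?_ (hsol H).weights
    rw [div_le_one (by positivity)]
    have : (3 : ℝ) ≤ T := by exact_mod_cast hT
    linarith
  · have h1 := (hsol H).close _ (htrack H) (by rw [List.length_map, hlen]; exact hH) fun c hc e => by
      obtain ⟨u, hu, rfl⟩ := List.mem_map.1 hc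
      obtain ⟨H', ℓ, rfl⟩ := mem_rewards P H hu
      rw [Pi.neg_apply, abs_neg]
      exact (abs_reward_le hγ _ _ _).trans (toReal_pmf_le_one _ _)
    have h2 := sum_abs_perturb_sub_le hγ hγ1 (ε := 1 / (4 * T)) (by positivity) (hsol H).weights
    calc ∑ e, |P.weights H e - expertWeights T ((P.rewards H).map fun u => -u) e|
        ≤ ∑ e, (|perturb (1 / (4 * T)) (w H) e - w H e| +
            |w H e - expertWeights T ((P.rewards H).map fun u => -u) e|) :=
          Finset.sum_le_sum fun e _ => abs_sub_le _ _ _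
      -- Perturbation plus scanning error, `17/32` of the permitted `1/T`.
      _ ≤ 2 * (1 / (4 * T)) + 1 / (32 * T) := by
          rw [Finset.sum_add_distrib]; exact add_le_add h2 h1
      _ ≤ 1 / T := by
          have : 2 * (1 / (4 * (T : ℝ))) + 1 / (32 * T) = 17 / 32 * (1 / T) := by
            field_simp
            norm_num
          rw [this]
          exact mul_le_of_le_one_left (by positivity) (by norm_num)
  · refine le_trans (le_of_eq (Finset.sum_congr rfl fun θ _ => ?_))
      ((hsol H).lp_perturb hγ1 hγT hT v)
    change (pmfOfSimplex (κ H) (hsol H).dist θ).toReal * _ = _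
    rw [pmfOfSimplex_toReal]
  · obtain ⟨s, n, hr, hn, he⟩ := hrun T (by omega) δ H hH
    exact ⟨s, n, hr, hn, (hsol H).lists hγ1 hγT he⟩

end Rounds

end SwapRegret

open SwapRegret in
theorem mainTheorem2 :
    -- regret: high probability and, for `δ = 1/T`, expectation
    (∃ C : ℝ, 0 < C ∧ ∀ T : ℕ, 2 < T → ∀ δ : ℝ, 0 < δ → δ ≤ 1 / T →
      ∀ ε : ℝ, 0 ≤ ε → ε ≤ 1 / T →
      ∀ P : Predictor (gammaParam T δ), P.Follows T ε →
      ∀ adversary : Transcript → Loss,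
        ENNReal.ofReal (1 - δ) ≤
          (play P.strategy adversary T).toOuterMeasure
            {h | swapRegret h ≤ C * Real.sqrt ((T * Real.log T) * Real.log (1 / δ))} ∧
        (δ = 1 / T →
          ∑' h, play P.strategy adversary T h * ENNReal.ofReal (swapRegret h) ≤
            ENNReal.ofReal (C * (Real.sqrt T * Real.log T)))) ∧
    -- the algorithm in exact arithmetic is well defined
    (∀ T : ℕ, 2 < T → ∀ δ : ℝ, 0 < δ → δ ≤ 1 / T →
      ∃ P : Predictor (gammaParam T δ), P.Follows T 0) ∧
    -- running time: one program carries out the algorithm in `poly(T)` steps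
    (∃ (M : Machine) (c k : ℕ), ∀ T : ℕ, 2 < T → ∀ δ : ℝ, 0 < δ → δ ≤ 1 / T →
      ∃ P : Predictor (gammaParam T δ), P.Follows T (1 / T) ∧
        ∀ H : List Loss, H.length < T →
          ∃ (s : State) (n : ℕ), M.Run T δ H s n ∧ n ≤ c * T ^ k ∧ s.Lists (P.dist H)) := by
  refine ⟨⟨300001, by norm_num, fun T hT δ hδ hδT ε _ hε P hP adversary =>
    ⟨regret_high_probability hT hδ hδT hε hP adversary (by norm_num), ?_⟩⟩, ?_, ?_⟩
  · rintro rfl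
    exact regret_expectation hT hε hP adversary
  · exact fun T hT δ hδ hδT => exists_follows_zero (gammaParam_pos hT hδ hδT)
      (gammaParam_le_one T δ) (by omega)
  · exact exists_machine
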